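/- Setting. Let $U$ be a unitary on a finite-dimensional space with orthonormal eigenbasis $U|\phi_j\rangle=e^{i\phi_j}|\phi_j\rangle$, $\phi_j\in[0,2\pi)$, let $|\psi\rangle$ be a unit vector, $a_j=|\langle\phi_j|\psi\rangle|^2$, and let $\phi_0$ be a target phase with $a_0>0$. Let $0<\Delta\le\pi$, $|\phi_j-\phi_0|>\Delta$ for all $j\neq0$, and let $\phi_{guess}$ satisfy $|\phi_0-\phi_{guess}|<\Delta/3$. Put $\mathcal D=[\phi_{guess}-\Delta/2,\phi_{guess}+\Delta/2]$ and assume $\mathcal D\subset[\Delta/6,2\pi-\Delta/6)$ (no wrapping around the circle). Let $\gamma\ge0$ and $0<\epsilon\le1/2$. A circuit with $t\in\mathbb N$ calls to $U$ has fidelity $F=e^{-\gamma t}$ and, under global depolarizing noise, returns a sample in $[0,2\pi)$ with density $$p(x)=F\sum_j a_jf_\sigma(x-\phi_j)+\frac{1-F}{2\pi},$$ where $f_\sigma$ is the $2\pi$-periodic function proportional to $e^{-x^2/2\sigma^2}$ on $(-\pi,\pi]$ with $\int_{-\pi}^{\pi}f_\sigma=1$, and $\sigma=\Theta(t^{-1})$,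 i.e. $\kappa_1\le\sigma t\le\kappa_2$ for fixed $0<\kappa_1\le\kappa_2$. Samples outside $\mathcal D$ are rejected; accepted samples have density $P=p/\int_{\mathcal D}p$ on $\mathcal D$. Given $M$ accepted samples $x_1,\dots,x_M$, the filtered moment projection phase estimator (fMPE) is a (measurable) maximizer $\tilde\phi_M\in\mathcal D$ of $\frac1M\sum_i\log Q(x_i|\phi)$ over $\phi\in\mathcal D$, where $$Q(x|\phi)=\frac{Fa_0f_\sigma(x-\phi)+(1-F)\frac1{2\pi}}{Fa_0\int_{\mathcal D}f_\sigma(y-\phi)\,dy+(1-F)\frac{\Delta}{2\pi}}.$$ $T$ denotes $t$ times the expected number of circuit runs (shots) needed to accept $M$ samples. The RMS error is understood to leading order for large $M$: for fixed $t$ the limits $b=\lim_M\mathbb E[\tilde\phi_M]-\phi_0$ and $v=\lim_M M\,\mathrm{Var}[\tilde\phi_M]$ exist, $\big(\mathbb E(\tilde\phi_M-\phi_0)^2\big)^{1/2}\sim\sqrt{b^2+v/M}$ as $M\to\infty$, and $\sqrt{b^2+v/M}$ is the RMS error for $M$ samples. Theorem. There is a constant $C>0$ depending only on $\kappa_1,\kappa_2$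 such that the following holds. (1) If $t\ge C\,\Delta^{-1}\big(\gamma\Delta^{-1}+\log(a_0^{-1}\epsilon^{-1})\big)$, then the fMPE with $t$ calls to $U$ per circuit exists, the above limits exist, and it attains RMS error $\epsilon$ using $M=O(a_0^{-2}t^{-2}\epsilon^{-2}e^{2\gamma t})$ samples and $T=O(\epsilon^{-2}t^{-1}e^{2\gamma t}a_0^{-2})$ expected total calls to $U$; moreover it attains RMS error $\epsilon$ for every $M\ge1$ whose expected number of calls is at least $C\epsilon^{-2}t^{-1}e^{2\gamma t}a_0^{-2}$. If in addition $\gamma t\le1\le a_0t$, the same holds with $M=O(a_0^{-1}t^{-2}\epsilon^{-2})$ and $T=O(a_0^{-1}t^{-1}\epsilon^{-2})$. All implied constants are at most $C$, and the bounds hold up to rounding $M$ to a positive integer (one extra accepted sample); for $\epsilon t\le1$ they hold without this allowance. (2) Let $\gamma>0$ and suppose that some $t$ allowed in (1) satisfies $\gamma t\le1$. Then the cost $\epsilon^{-2}t^{-1}e^{2\gamma t}a_0^{-2}$ has a minimizer among the $t\in\mathbb N$ allowed in (1); every minimizer satisfies $t=\Theta(\gamma^{-1})$, the minimal cost is $\Theta(\gamma\epsilon^{-2}a_0^{-2})$,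 and at such $t$ the fMPE attains RMS error $\epsilon$, in the sense of (1), with $M=O(\gamma^2\epsilon^{-2}a_0^{-2})$ samples and $T=O(\gamma\epsilon^{-2}a_0^{-2})$ expected calls, where the constants depend only on $\kappa_1,\kappa_2$. -/

import Mathlib

open MeasureTheory ProbabilityTheory Filter Topology
open scoped ENNReal Real

namespace QPE

/-- A unitary `U` on a finite-dimensional space with an orthonormal eigenbasis
`U |φ_j⟩ = exp(i φ_j) |φ_j⟩`, `φ_j ∈ [0, 2π)`, an initial state `ψ`, and the index of the
target eigenstate. -/
structure PhaseProblem where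
  n : ℕ
  U : Matrix.unitaryGroup (Fin n) ℂ
  eigvec : OrthonormalBasis (Fin n) ℂ (EuclideanSpace ℂ (Fin n))
  phase : Fin n → ℝ
  phase_mem : ∀ j, phase j ∈ Set.Ico 0 (2 * π)
  eigen : ∀ j, Matrix.toEuclideanLin (U : Matrix (Fin n) (Fin n) ℂ) (eigvec j) =
    Complex.exp (Complex.I * (phase j : ℂ)) • eigvec j
  ψ : EuclideanSpace ℂ (Fin n)
  norm_ψ : ‖ψ‖ = 1
  target : Fin n

noncomputable section

/-- The spectral weight `a_j = |⟨φ_j|ψ⟩|²`. -/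
def PhaseProblem.weight (S : PhaseProblem) (j : Fin S.n) : ℝ :=
  ‖inner ℂ (S.eigvec j) S.ψ‖ ^ 2

/-- The target phase `φ_0`. -/
def PhaseProblem.φ₀ (S : PhaseProblem) : ℝ := S.phase S.target

/-- The overlap `a_0 = |⟨φ_0|ψ⟩|²`. -/
def PhaseProblem.a₀ (S : PhaseProblem) : ℝ := S.weight S.target

/-- The Gaussian kernel of width `σ` on the circle: the `2π`-periodic function that equals
`exp(-x²/2σ²) / ∫_{-π}^{π} exp(-y²/2σ²) dy` for `-π < x ≤ π`. -/
def gaussianKernel (σ x : ℝ) : ℝ :=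
  Real.exp (-(toIocMod Real.two_pi_pos (-π) x) ^ 2 / (2 * σ ^ 2)) /
    ∫ y in (-π)..π, Real.exp (-y ^ 2 / (2 * σ ^ 2))

/-- A filtered phase estimation experiment: the phase estimation problem together with the
guess and the width `Δ` of the filtering interval, the circuit fidelity `F` and the kernel
width `σ`. -/
structure Experiment extends PhaseProblem where
  guess : ℝ
  Δ : ℝ
  F : ℝ
  σ : ℝ

namespace Experiment

variable (E : Experiment)

/-- The filtering interval `D`, of width `Δ` and centred at the guess. -/
def D : Set ℝ := Set.Icc (E.guess - E.Δ / 2) (E.guess + E.Δ / 2)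

/-- The density `p(x) = F ∑_j a_j f_σ(x - φ_j) + (1 - F)/(2π)` of the outcome of one circuit
under global depolarising noise. -/
def noisyDensity (x : ℝ) : ℝ :=
  E.F * ∑ j, E.weight j * gaussianKernel E.σ (x - E.phase j) + (1 - E.F) * (1 / (2 * π))

/-- The law on `[0, 2π)` of the outcome of one circuit (one shot). -/
def shotLaw : Measure ℝ :=
  (volume.restrict (Set.Ico 0 (2 * π))).withDensity fun x => ENNReal.ofReal (E.noisyDensity x)

/-- The filtered law, with density `P(x) = p(x) / ∫_D p` on `D`. -/
def filteredLaw : Measure ℝ :=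
  (volume.restrict E.D).withDensity fun x =>
    ENNReal.ofReal (E.noisyDensity x / ∫ y in E.D, E.noisyDensity y)

/-- The law of `M` independent samples from the filtered law. -/
def samplesLaw (M : ℕ) : Measure (Fin M → ℝ) := Measure.pi fun _ => E.filteredLaw

/-- The single-phase model `Q(x|φ)` that accounts for global depolarising noise. -/
def model (φ x : ℝ) : ℝ :=
  (E.F * E.a₀ * gaussianKernel E.σ (x - φ) + (1 - E.F) * (1 / (2 * π))) /
    (E.F * E.a₀ * (∫ y in E.D, gaussianKernel E.σ (y - φ)) + (1 - E.F) * (E.Δ / (2 * π)))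

/-- The log-likelihood `ℓ(φ|x) = M⁻¹ ∑_j log Q(x_j|φ)`. -/
def logLikelihood {M : ℕ} (x : Fin M → ℝ) (φ : ℝ) : ℝ :=
  (M : ℝ)⁻¹ * ∑ j, Real.log (E.model φ (x j))

/-- `est` is a filtered moment projection phase estimator (fMPE): for every number `M` of
samples, a measurable choice of a maximiser over `D` of the log-likelihood. -/
def IsFMPE (est : (M : ℕ) → (Fin M → ℝ) → ℝ) : Prop :=
  ∀ M, Measurable (est M) ∧
    ∀ x : Fin M → ℝ, (∀ i, x i ∈ E.D) →
      est M x ∈ E.D ∧ ∀ φ ∈ E.D, E.logLikelihood x φ ≤ E.logLikelihood x (est M x)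

/-- The root mean square error of the estimator on `M` filtered samples. -/
def rmse (est : (M : ℕ) → (Fin M → ℝ) → ℝ) (M : ℕ) : ℝ :=
  √(∫ x, (est M x - E.φ₀) ^ 2 ∂E.samplesLaw M)

/-- In the limit of many samples, the estimator has bias `b` and variance `v / M`, and its root
mean square error is `√(b² + v / M)` to leading order. -/
structure HasAsymptoticError (est : (M : ℕ) → (Fin M → ℝ) → ℝ) (b v : ℝ) : Prop where
  bias : Tendsto (fun M : ℕ => (∫ x, est M x ∂E.samplesLaw M) - E.φ₀) atTop (𝓝 b)
  var : Tendsto (fun M : ℕ => (M : ℝ) * variance (est M) (E.samplesLaw M)) atTop (𝓝 v)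
  rmse : Tendsto (fun M : ℕ => E.rmse est M / √(b ^ 2 + v / M)) atTop (𝓝 1)

/-- The expected number of shots until `M` of the outcomes lie in `D`, as the sum over `m` of
the probability that the first `m` shots yield fewer than `M` such outcomes. -/
def expectedShots (M : ℕ) : ℝ≥0∞ :=
  ∑' m : ℕ, (Measure.pi fun _ : Fin m => E.shotLaw) {x | {i | x i ∈ E.D}.ncard < M}

/-- The expected total number of calls to `U` for `M` filtered samples, at `t` calls per shot. -/
def expectedCalls (t M : ℕ) : ℝ≥0∞ := t * E.expectedShots M

/-- With `t` calls per shot, the fMPE attains root mean square error `ε` (to leading order in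
the number of samples) as soon as the expected total number of calls is at least `T`, and
it does so with some `M ≤ m` samples and at most `T` expected calls, up to the
rounding of the number of samples to a positive integer; for `ε t ≤ 1` no such
allowance is needed. -/
def AttainsRMSE (t : ℕ) (ε m T : ℝ) : Prop :=
  (∃ est, E.IsFMPE est) ∧
  ∀ est, E.IsFMPE est → ∃ b v : ℝ, E.HasAsymptoticError est b v ∧
    (∀ M : ℕ, 1 ≤ M → ENNReal.ofReal T ≤ E.expectedCalls t M → √(b ^ 2 + v / M) ≤ ε) ∧
    ∃ M : ℕ, 1 ≤ M ∧ √(b ^ 2 + v / M) ≤ ε ∧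
      (M : ℝ) ≤ m + 1 ∧ E.expectedCalls t M ≤ ENNReal.ofReal T + E.expectedCalls t 1 ∧
      (ε * t ≤ 1 → (M : ℝ) ≤ m ∧ E.expectedCalls t M ≤ ENNReal.ofReal T)

end Experiment

/-- The experiment run on `S` with `t` calls to `U` per circuit, each with noise rate `γ`, so
that the circuit fidelity is `exp(-γ t)`. -/
def PhaseProblem.experiment (S : PhaseProblem) (guess Δ γ : ℝ) (t : ℕ) (σ : ℝ) : Experiment :=
  { S with guess := guess, Δ := Δ, F := Real.exp (-γ * t), σ := σ }

/-- The depth condition `t ≥ C Δ⁻¹ (γ Δ⁻¹ + log (a₀⁻¹ ε⁻¹))`. -/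
def DepthOK (C Δ γ a₀ ε : ℝ) (t : ℕ) : Prop :=
  C * (Δ⁻¹ * (γ * Δ⁻¹ + Real.log (a₀⁻¹ * ε⁻¹))) ≤ t

/-- The cost `ε⁻² t⁻¹ exp(2γt) a₀⁻²` as a function of the depth `t`. -/
def callCost (γ a₀ ε : ℝ) (t : ℕ) : ℝ :=
  (ε ^ 2)⁻¹ * (t : ℝ)⁻¹ * Real.exp (2 * γ * t) * (a₀ ^ 2)⁻¹

/-- `t` minimises the cost among all depths that satisfy the depth condition. -/
def IsOptimalDepth (C Δ γ a₀ ε : ℝ) (t : ℕ) : Prop :=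
  DepthOK C Δ γ a₀ ε t ∧ ∀ s, DepthOK C Δ γ a₀ ε s → callCost γ a₀ ε t ≤ callCost γ a₀ ε s

end

end QPE

namespace QPE

/-! ### Moments of averages of independent bounded variables -/

/-- The empirical mean of `h` over the sample `x`. -/
noncomputable def empMean {M : ℕ} (h : ℝ → ℝ) (x : Fin M → ℝ) : ℝ := (M : ℝ)⁻¹ * ∑ i, h (x i)

theorem ae_pi_forall {Ω : Type*} [MeasurableSpace Ω] {μ : Measure Ω} [IsProbabilityMeasure μ]
    {p : Ω → Prop} (hp : ∀ᵐ x ∂μ, p x) (M : ℕ) :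
    ∀ᵐ x ∂(Measure.pi fun _ : Fin M => μ), ∀ i, p (x i) := by
  rw [ae_all_iff]
  intro i
  exact (Measure.quasiMeasurePreserving_eval (fun _ : Fin M => μ) i).ae hp

theorem integrable_of_abs_le {Ω : Type*} [MeasurableSpace Ω] {μ : Measure Ω} [IsFiniteMeasure μ]
    {f : Ω → ℝ} (hf : AEStronglyMeasurable f μ) {K : ℝ} (hK : ∀ᵐ x ∂μ, |f x| ≤ K) :
    Integrable f μ :=
  Integrable.of_bound hf K (by simpa only [Real.norm_eq_abs] using hK)

theorem abs_integral_le_of_abs_le {Ω : Type*} [MeasurableSpace Ω] {μ : Measure Ω}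
    [IsProbabilityMeasure μ] {f : Ω → ℝ} {K : ℝ} (hK : ∀ᵐ x ∂μ, |f x| ≤ K) :
    |∫ x, f x ∂μ| ≤ K := by
  have := norm_integral_le_of_norm_le_const (f := f) (C := K) (μ := μ)
    (by simpa only [Real.norm_eq_abs] using hK)
  simpa using this

theorem abs_sum_le_of_abs_le {M : ℕ} {f : Fin M → ℝ} {K : ℝ} (hK : ∀ i, |f i| ≤ K) :
    |∑ i, f i| ≤ M * K := by
  calc |∑ i, f i| ≤ ∑ i, |f i| := Finset.abs_sum_le_sum_abs _ _
    _ ≤ ∑ _i : Fin M, K := Finset.sum_le_sum fun i _ => hK i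
    _ = M * K := by simp

theorem integral_sum_pow_four_le {Ω : Type*} [MeasurableSpace Ω] {μ : Measure Ω}
    [IsProbabilityMeasure μ] {h : Ω → ℝ} (hm : Measurable h) {K : ℝ} (hK : 0 < K)
    (hb : ∀ᵐ x ∂μ, |h x| ≤ K) (h0 : ∫ x, h x ∂μ = 0) (M : ℕ) :
    ∫ x, (∑ i, h (x i)) ^ 4 ∂(Measure.pi fun _ : Fin M => μ) ≤ 96 * K ^ 4 * M ^ 2 := by
  rcases Nat.eq_zero_or_pos M with rfl | hM
  · simp
  have hM' : (0 : ℝ) < M := by exact_mod_cast hM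
  set ν := Measure.pi fun _ : Fin M => μ with hν
  have hsg : HasSubgaussianMGF h ((‖K - (-K)‖₊ / 2) ^ 2) μ :=
    hasSubgaussianMGF_of_mem_Icc_of_integral_eq_zero hm.aemeasurable
      (hb.mono fun x hx => abs_le.1 hx) h0
  have hc : (((‖K - (-K)‖₊ / 2) ^ 2 : NNReal) : ℝ) = K ^ 2 := by
    simp only [sub_neg_eq_add, NNReal.coe_pow, NNReal.coe_div, coe_nnnorm, Real.norm_eq_abs,
      NNReal.coe_ofNat]
    rw [abs_of_pos (by linarith)]; ring
  set s : ℝ := (K * √M)⁻¹ with hs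
  have hsq : √(M : ℝ) ^ 2 = M := Real.sq_sqrt hM'.le
  have hspos : 0 < s := by positivity
  have hs2 : s ^ 2 * (K ^ 2 * M) = 1 := by
    rw [hs, inv_pow, mul_pow, hsq]; field_simp
  have hexp : ∀ u : ℝ, u ^ 2 = s ^ 2 →
      Integrable (fun x => Real.exp (u * ∑ i, h (x i))) ν ∧
      ∫ x, Real.exp (u * ∑ i, h (x i)) ∂ν ≤ 2 := by
    intro u hu
    have hfe : (fun x : Fin M → Ω => Real.exp (u * ∑ i, h (x i))) =
        fun x => ∏ i, Real.exp (u * h (x i)) := by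
      funext x; rw [Finset.mul_sum, Real.exp_sum]
    constructor
    · rw [hfe]
      exact Integrable.fintype_prod (f := fun _ : Fin M => fun y => Real.exp (u * h y))
        (fun _ => hsg.integrable_exp_mul u)
    · rw [hfe, hν, integral_fintype_prod_eq_pow (fun y => Real.exp (u * h y)), Fintype.card_fin]
      have h1 := hsg.mgf_le u
      rw [hc, hu] at h1
      have h2 : (∫ y, Real.exp (u * h y) ∂μ) ^ M ≤ Real.exp (K ^ 2 * s ^ 2 / 2) ^ M :=
        pow_le_pow_left₀ (integral_nonneg fun _ => (Real.exp_pos _).le) h1 M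
      refine h2.trans ?_
      rw [← Real.exp_nat_mul]
      have : (M : ℝ) * (K ^ 2 * s ^ 2 / 2) = 1 / 2 := by linarith
      rw [this]
      have h3 := Real.exp_one_lt_d9
      have h4 : Real.exp (1 / 2) ^ 2 = Real.exp 1 := by rw [← Real.exp_nat_mul]; norm_num
      nlinarith [Real.exp_pos (1 / 2)]
  obtain ⟨i1, e1⟩ := hexp s rfl
  obtain ⟨i2, e2⟩ := hexp (-s) (by ring)
  have hpt : ∀ z : ℝ, z ^ 4 ≤ 24 * (Real.exp z + Real.exp (-z)) := by
    intro z
    have h1 := Real.pow_div_factorial_le_exp |z| (abs_nonneg z) 4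
    have h2 : Real.exp |z| ≤ Real.exp z + Real.exp (-z) := by
      rcases abs_cases z with ⟨h, -⟩ | ⟨h, -⟩ <;> rw [h] <;>
        linarith [Real.exp_pos z, Real.exp_pos (-z)]
    have h3 : |z| ^ 4 = z ^ 4 := by rw [show (4 : ℕ) = 2 * 2 from rfl, pow_mul, pow_mul, sq_abs]
    rw [h3, show ((Nat.factorial 4 : ℕ) : ℝ) = 24 by norm_num [Nat.factorial]] at h1
    linarith
  have hI : ∫ x, (s * ∑ i, h (x i)) ^ 4 ∂ν ≤ 96 := by
    calc ∫ x, (s * ∑ i, h (x i)) ^ 4 ∂ν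
        ≤ ∫ x, 24 * (Real.exp (s * ∑ i, h (x i)) + Real.exp (-s * ∑ i, h (x i))) ∂ν := by
          refine integral_mono_of_nonneg (ae_of_all _ fun x => by positivity)
            ((i1.add i2).const_mul 24) (ae_of_all _ fun x => ?_)
          have := hpt (s * ∑ i, h (x i))
          simpa only [neg_mul] using this
      _ = 24 * (∫ x, Real.exp (s * ∑ i, h (x i)) ∂ν + ∫ x, Real.exp (-s * ∑ i, h (x i)) ∂ν) := by
          rw [integral_const_mul, integral_add i1 i2]
      _ ≤ 96 := by linarith
  simp_rw [mul_pow] at hI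
  rw [integral_const_mul] at hI
  have hs4 : s ^ 4 * (K ^ 4 * M ^ 2) = 1 := by
    calc s ^ 4 * (K ^ 4 * M ^ 2) = (s ^ 2 * (K ^ 2 * M)) ^ 2 := by ring
      _ = 1 := by rw [hs2]; norm_num
  calc ∫ x, (∑ i, h (x i)) ^ 4 ∂ν
      = (s ^ 4 * ∫ x, (∑ i, h (x i)) ^ 4 ∂ν) * (K ^ 4 * M ^ 2) := by
        linear_combination (-∫ x, (∑ i, h (x i)) ^ 4 ∂ν) * hs4
    _ ≤ 96 * (K ^ 4 * M ^ 2) := by gcongr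
    _ = _ := by ring

variable {μ : Measure ℝ} [IsProbabilityMeasure μ] {h : ℝ → ℝ} {K : ℝ} {M : ℕ}

theorem measurable_empMean (hm : Measurable h) : Measurable (empMean h : (Fin M → ℝ) → ℝ) := by
  unfold empMean; fun_prop

theorem abs_empMean_le (hM : 1 ≤ M) {x : Fin M → ℝ} (hx : ∀ i, |h (x i)| ≤ K) :
    |empMean h x| ≤ K := by
  have hM' : (0 : ℝ) < M := by exact_mod_cast hM
  rw [empMean, abs_mul, abs_of_pos (inv_pos.2 hM')]
  calc (M : ℝ)⁻¹ * |∑ i, h (x i)| ≤ (M : ℝ)⁻¹ * (M * K) := by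
        gcongr; exact abs_sum_le_of_abs_le hx
    _ = K := by field_simp

theorem empMean_sub_const (hM : 1 ≤ M) (c : ℝ) (x : Fin M → ℝ) :
    empMean h x - c = (M : ℝ)⁻¹ * ∑ i, (h (x i) - c) := by
  have hM' : (0 : ℝ) < M := by exact_mod_cast hM
  rw [empMean, Finset.sum_sub_distrib]; simp; field_simp

theorem integral_empMean_sub_pow_four_le (hm : Measurable h) (hK : 0 < K)
    (hb : ∀ᵐ x ∂μ, |h x| ≤ K) (hM : 1 ≤ M) :
    ∫ x, (empMean h x - ∫ y, h y ∂μ) ^ 4 ∂(Measure.pi fun _ : Fin M => μ) ≤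
      1536 * K ^ 4 / M ^ 2 := by
  have hM' : (0 : ℝ) < M := by exact_mod_cast hM
  have hinteg : Integrable h μ := integrable_of_abs_le hm.aestronglyMeasurable hb
  have hmean := abs_integral_le_of_abs_le hb
  have h4 := integral_sum_pow_four_le (μ := μ) (h := fun y => h y - ∫ z, h z ∂μ) (K := 2 * K)
    (hm.sub_const _) (by positivity)
    (hb.mono fun x hx => (abs_sub _ _).trans (by linarith))
    (by rw [integral_sub hinteg (integrable_const _)]; simp) M
  simp_rw [empMean_sub_const hM, mul_pow]
  rw [integral_const_mul]
  calc ((M : ℝ)⁻¹) ^ 4 * _ ≤ ((M : ℝ)⁻¹) ^ 4 * (96 * (2 * K) ^ 4 * M ^ 2) := by gcongr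
    _ = _ := by field_simp; ring

theorem integral_empMean (hm : Measurable h) (hb : ∀ᵐ x ∂μ, |h x| ≤ K) (hM : 1 ≤ M) :
    ∫ x, empMean h x ∂(Measure.pi fun _ : Fin M => μ) = ∫ y, h y ∂μ := by
  have hM' : (0 : ℝ) < M := by exact_mod_cast hM
  have hinteg : Integrable h μ := integrable_of_abs_le hm.aestronglyMeasurable hb
  unfold empMean
  rw [integral_const_mul, integral_finsetSum]
  · have : ∀ i : Fin M, ∫ x : Fin M → ℝ, h (x i) ∂(Measure.pi fun _ : Fin M => μ) = ∫ y, h y ∂μ :=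
      fun i => integral_comp_eval (μ := fun _ : Fin M => μ) hm.aestronglyMeasurable
    simp [this]; field_simp
  · intro i _
    exact (measurePreserving_eval (fun _ : Fin M => μ) i).integrable_comp_of_integrable hinteg

theorem integral_empMean_sq (hm : Measurable h) (hb : ∀ᵐ x ∂μ, |h x| ≤ K)
    (h0 : ∫ x, h x ∂μ = 0) (hM : 1 ≤ M) :
    ∫ x, empMean h x ^ 2 ∂(Measure.pi fun _ : Fin M => μ) = (∫ y, h y ^ 2 ∂μ) / M := by
  have hM' : (0 : ℝ) < M := by exact_mod_cast hM
  have hL : MemLp h 2 μ := MemLp.of_bound hm.aestronglyMeasurable K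
    (by simpa only [Real.norm_eq_abs] using hb)
  have hv := variance_sum_pi (μ := fun _ : Fin M => μ) (X := fun _ => h) (fun _ => hL)
  have hmeas : Measurable (∑ i : Fin M, fun ω : Fin M → ℝ => h (ω i)) := by
    have : (∑ i : Fin M, fun ω : Fin M → ℝ => h (ω i)) = fun ω => ∑ i, h (ω i) := by
      funext ω; simp
    rw [this]; fun_prop
  have hz : ∫ x, (∑ i : Fin M, fun ω : Fin M → ℝ => h (ω i)) x ∂(Measure.pi fun _ : Fin M => μ)
      = 0 := by
    have := integral_empMean hm hb hM
    unfold empMean at this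
    rw [integral_const_mul, h0] at this
    simpa [hM'.ne', Finset.sum_apply] using this
  rw [variance_of_integral_eq_zero hmeas.aemeasurable hz] at hv
  simp only [Finset.sum_apply, Finset.sum_const, Finset.card_univ, Fintype.card_fin,
    nsmul_eq_mul] at hv
  rw [variance_of_integral_eq_zero hm.aemeasurable h0] at hv
  unfold empMean
  simp_rw [mul_pow]
  rw [integral_const_mul, hv]
  field_simp

end QPE

namespace QPE

/-! ### M-estimation on a compact interval -/

/-- A criterion function `q θ x` with derivatives `q₁`, `q₂` in the parameter that are bounded by
`K` on a neighbourhood of `[a, b]`, for almost every outcome `x`; the second derivative is also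
`K`-Lipschitz in the parameter. -/
structure RegularCriterion (μ : Measure ℝ) (a b K : ℝ) (q q₁ q₂ : ℝ → ℝ → ℝ) : Prop where
  pos : 0 < K
  cont : Continuous (Function.uncurry q)
  cont₁ : Continuous (Function.uncurry q₁)
  cont₂ : Continuous (Function.uncurry q₂)
  deriv₁ : ∀ θ x, HasDerivAt (fun θ => q θ x) (q₁ θ x) θ
  deriv₂ : ∀ θ x, HasDerivAt (fun θ => q₁ θ x) (q₂ θ x) θ
  bound : ∀ᵐ x ∂μ, ∀ θ ∈ Set.Icc (a - 1) (b + 1), |q θ x| ≤ K ∧ |q₁ θ x| ≤ K ∧ |q₂ θ x| ≤ K ∧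
    ∀ θ' ∈ Set.Icc (a - 1) (b + 1), |q₂ θ x - q₂ θ' x| ≤ K * |θ - θ'|

theorem pow_four_integral_le {a b : ℝ} (hab : a < b) {f : ℝ → ℝ}
    (hf : ContinuousOn f (Set.Icc a b)) :
    (∫ x in a..b, f x) ^ 4 ≤ (b - a) ^ 3 * ∫ x in a..b, f x ^ 4 := by
  have hpos : 0 < b - a := sub_pos.2 hab
  have hf' : ContinuousOn f (Set.uIcc a b) := by rwa [Set.uIcc_of_le hab.le]
  set m := (∫ x in a..b, f x) / (b - a) with hm
  have hI : ∫ x in a..b, f x = m * (b - a) := by rw [hm]; field_simp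
  have h1 : ∫ x in a..b, (m ^ 4 + 4 * m ^ 3 * (f x - m)) ≤ ∫ x in a..b, f x ^ 4 := by
    refine intervalIntegral.integral_mono_on hab.le ?_ ?_ fun x _ => ?_
    · exact ContinuousOn.intervalIntegrable (by fun_prop)
    · exact ContinuousOn.intervalIntegrable (by fun_prop)
    · nlinarith [sq_nonneg (f x - m), sq_nonneg (f x + m), mul_nonneg (sq_nonneg (f x - m))
        (add_nonneg (sq_nonneg (f x + m)) (mul_nonneg zero_le_two (sq_nonneg m)))]
  have h2 : ∫ x in a..b, (m ^ 4 + 4 * m ^ 3 * (f x - m)) = m ^ 4 * (b - a) := by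
    rw [intervalIntegral.integral_add (by simp), intervalIntegral.integral_const_mul,
      intervalIntegral.integral_sub hf'.intervalIntegrable (by simp), hI]
    · simp; ring
    · exact ContinuousOn.intervalIntegrable (by fun_prop)
  rw [h2] at h1
  rw [hI]
  calc (m * (b - a)) ^ 4 = (b - a) ^ 3 * (m ^ 4 * (b - a)) := by ring
    _ ≤ _ := by gcongr

theorem add_pow_four_le (u v : ℝ) : (u + v) ^ 4 ≤ 8 * (u ^ 4 + v ^ 4) := by
  have h1 : (u + v) ^ 2 ≤ 2 * (u ^ 2 + v ^ 2) := by nlinarith [sq_nonneg (u - v)]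
  have h2 : (u ^ 2 + v ^ 2) ^ 2 ≤ 2 * (u ^ 4 + v ^ 4) := by nlinarith [sq_nonneg (u ^ 2 - v ^ 2)]
  calc (u + v) ^ 4 = ((u + v) ^ 2) ^ 2 := by ring
    _ ≤ (2 * (u ^ 2 + v ^ 2)) ^ 2 := by gcongr
    _ ≤ _ := by nlinarith

theorem abs_sub_le_integral_deriv {a b : ℝ} (hab : a < b) {g g₁ g₂ : ℝ → ℝ}
    (h₁ : ∀ θ ∈ Set.Icc a b, HasDerivAt g (g₁ θ) θ) (h₂ : ∀ θ ∈ Set.Icc a b, HasDerivAt g₁ (g₂ θ) θ)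
    (hc : ContinuousOn g₂ (Set.Icc a b)) {θ θ' : ℝ} (hθ : θ ∈ Set.Icc a b)
    (hθ' : θ' ∈ Set.Icc a b) :
    |g θ' - g θ| ≤ (|g₁ θ| + ∫ s in a..b, |g₂ s|) * |θ' - θ| := by
  have hsub : ∀ s ∈ Set.Icc a b, |g₁ s| ≤ |g₁ θ| + ∫ s in a..b, |g₂ s| := by
    intro s hs
    have hss : Set.uIcc θ s ⊆ Set.Icc a b := Set.uIcc_subset_Icc hθ hs
    have hft := intervalIntegral.integral_eq_sub_of_hasDerivAt (a := θ) (b := s)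
      (fun u hu => h₂ u (hss hu)) ((hc.mono hss).intervalIntegrable)
    have habs : |∫ u in θ..s, g₂ u| ≤ |(∫ u in θ..s, |g₂ u|)| := by
      simpa only [Real.norm_eq_abs] using
        intervalIntegral.norm_integral_le_abs_integral_norm (f := g₂) (a := θ) (b := s)
          (μ := volume)
    have hmono : |(∫ u in θ..s, |g₂ u|)| ≤ |(∫ u in a..b, |g₂ u|)| := by
      apply intervalIntegral.abs_integral_mono_interval
      · rw [Set.uIoc_of_le hab.le]
        rw [Set.uIoc_eq_union]
        rintro u (hu | hu)
        · exact ⟨lt_of_le_of_lt hθ.1 hu.1, hu.2.trans hs.2⟩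
        · exact ⟨lt_of_le_of_lt hs.1 hu.1, hu.2.trans hθ.2⟩
      · exact ae_of_all _ fun u => abs_nonneg _
      · exact (ContinuousOn.intervalIntegrable (by rw [Set.uIcc_of_le hab.le]; exact hc.abs))
    have hnn : 0 ≤ ∫ u in a..b, |g₂ u| :=
      intervalIntegral.integral_nonneg hab.le fun _ _ => abs_nonneg _
    rw [abs_of_nonneg hnn] at hmono
    have : |g₁ s - g₁ θ| ≤ ∫ u in a..b, |g₂ u| := by rw [← hft]; exact habs.trans hmono
    have h3 : |g₁ s| ≤ |g₁ θ| + |g₁ s - g₁ θ| := by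
      have := abs_add_le (g₁ θ) (g₁ s - g₁ θ); simpa using this
    linarith
  have := (convex_Icc a b).norm_image_sub_le_of_norm_hasDerivWithin_le
    (f := g) (f' := g₁) (fun s hs => (h₁ s hs).hasDerivWithinAt)
    (fun s hs => by simpa only [Real.norm_eq_abs] using hsub s hs) hθ hθ'
  simpa only [Real.norm_eq_abs] using this

namespace RegularCriterion

variable {μ : Measure ℝ} {a b K : ℝ} {q q₁ q₂ : ℝ → ℝ → ℝ}

theorem measurable_section {f : ℝ → ℝ → ℝ} (hf : Continuous (Function.uncurry f)) (θ : ℝ) :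
    Measurable (f θ) :=
  (hf.comp (Continuous.prodMk_right θ)).measurable

theorem Icc_subset : Set.Icc a b ⊆ Set.Icc (a - 1) (b + 1) :=
  Set.Icc_subset_Icc (by linarith) (by linarith)

theorem Icc_mem_nhds {θ : ℝ} (hθ : θ ∈ Set.Icc a b) : Set.Icc (a - 1) (b + 1) ∈ 𝓝 θ :=
  _root_.Icc_mem_nhds (by linarith [hθ.1]) (by linarith [hθ.2])

theorem hasDerivAt_empMean (H : RegularCriterion μ a b K q q₁ q₂) {M : ℕ} (x : Fin M → ℝ) (θ : ℝ) :
    HasDerivAt (fun θ => empMean (q θ) x) (empMean (q₁ θ) x) θ :=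
  (HasDerivAt.fun_sum fun i _ => H.deriv₁ θ (x i)).const_mul _

theorem hasDerivAt_empMean₁ (H : RegularCriterion μ a b K q q₁ q₂) {M : ℕ} (x : Fin M → ℝ)
    (θ : ℝ) : HasDerivAt (fun θ => empMean (q₁ θ) x) (empMean (q₂ θ) x) θ :=
  (HasDerivAt.fun_sum fun i _ => H.deriv₂ θ (x i)).const_mul _

theorem continuous_empMean₂ (H : RegularCriterion μ a b K q q₁ q₂) {M : ℕ} :
    Continuous fun z : ℝ × (Fin M → ℝ) => empMean (q₂ z.1) z.2 := by
  unfold empMean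
  refine continuous_const.mul (continuous_finsetSum _ fun i _ => ?_)
  exact H.cont₂.comp (continuous_fst.prodMk ((continuous_apply i).comp continuous_snd))

variable [IsProbabilityMeasure μ]

theorem hasDerivAt_integral (H : RegularCriterion μ a b K q q₁ q₂) {θ : ℝ}
    (hθ : θ ∈ Set.Icc a b) :
    HasDerivAt (fun θ => ∫ x, q θ x ∂μ) (∫ x, q₁ θ x ∂μ) θ := by
  refine (hasDerivAt_integral_of_dominated_loc_of_deriv_le (bound := fun _ => K)
    (Icc_mem_nhds hθ) (.of_forall fun s => (measurable_section H.cont s).aestronglyMeasurable)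
    (integrable_of_abs_le (measurable_section H.cont θ).aestronglyMeasurable
      (H.bound.mono fun x hx => (hx θ (Icc_subset hθ)).1))
    (measurable_section H.cont₁ θ).aestronglyMeasurable
    (H.bound.mono fun x hx s hs => (hx s hs).2.1) (integrable_const K)
    (ae_of_all _ fun x s _ => H.deriv₁ s x)).2

theorem hasDerivAt_integral₁ (H : RegularCriterion μ a b K q q₁ q₂) {θ : ℝ}
    (hθ : θ ∈ Set.Icc a b) :
    HasDerivAt (fun θ => ∫ x, q₁ θ x ∂μ) (∫ x, q₂ θ x ∂μ) θ := by
  refine (hasDerivAt_integral_of_dominated_loc_of_deriv_le (bound := fun _ => K)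
    (Icc_mem_nhds hθ) (.of_forall fun s => (measurable_section H.cont₁ s).aestronglyMeasurable)
    (integrable_of_abs_le (measurable_section H.cont₁ θ).aestronglyMeasurable
      (H.bound.mono fun x hx => (hx θ (Icc_subset hθ)).2.1))
    (measurable_section H.cont₂ θ).aestronglyMeasurable
    (H.bound.mono fun x hx s hs => (hx s hs).2.2.1) (integrable_const K)
    (ae_of_all _ fun x s _ => H.deriv₂ s x)).2

theorem abs_integral₂_sub_le (H : RegularCriterion μ a b K q q₁ q₂) {θ θ' : ℝ}
    (hθ : θ ∈ Set.Icc a b) (hθ' : θ' ∈ Set.Icc a b) :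
    |∫ x, q₂ θ x ∂μ - ∫ x, q₂ θ' x ∂μ| ≤ K * |θ - θ'| := by
  have hi : ∀ s ∈ Set.Icc a b, Integrable (q₂ s) μ := fun s hs =>
    integrable_of_abs_le (measurable_section H.cont₂ s).aestronglyMeasurable
      (H.bound.mono fun x hx => (hx s (Icc_subset hs)).2.2.1)
  rw [← integral_sub (hi θ hθ) (hi θ' hθ')]
  exact abs_integral_le_of_abs_le
    (H.bound.mono fun x hx => (hx θ (Icc_subset hθ)).2.2.2 θ' (Icc_subset hθ'))

theorem continuousOn_integral₂ (H : RegularCriterion μ a b K q q₁ q₂) :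
    ContinuousOn (fun θ => ∫ x, q₂ θ x ∂μ) (Set.Icc a b) := by
  have : LipschitzOnWith ⟨K, H.pos.le⟩ (fun θ => ∫ x, q₂ θ x ∂μ) (Set.Icc a b) :=
    LipschitzOnWith.of_dist_le_mul fun s hs s' hs' => H.abs_integral₂_sub_le hs hs'
  exact this.continuousOn

/-- The fluctuation `∫ (q̂₂ - E q₂)⁴` of the second derivative over the parameter interval. -/
noncomputable def fluctuation (μ : Measure ℝ) (a b : ℝ) (q₂ : ℝ → ℝ → ℝ) {M : ℕ}
    (x : Fin M → ℝ) : ℝ :=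
  ∫ θ in a..b, (empMean (q₂ θ) x - ∫ y, q₂ θ y ∂μ) ^ 4

theorem integrable_uncurry_fluctuation (H : RegularCriterion μ a b K q q₁ q₂) {M : ℕ}
    (hM : 1 ≤ M) :
    Integrable (Function.uncurry fun (x : Fin M → ℝ) (θ : ℝ) =>
        (empMean (q₂ θ) x - ∫ y, q₂ θ y ∂μ) ^ 4)
      ((Measure.pi fun _ : Fin M => μ).prod (volume.restrict (Set.Ioc a b))) := by
  have hmeas2 : StronglyMeasurable fun θ => ∫ y, q₂ θ y ∂μ :=
    StronglyMeasurable.integral_prod_right (f := q₂) H.cont₂.stronglyMeasurable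
  have hmeas : Measurable (Function.uncurry fun (x : Fin M → ℝ) (θ : ℝ) =>
        (empMean (q₂ θ) x - ∫ y, q₂ θ y ∂μ) ^ 4) := by
    have h1 : Measurable fun z : (Fin M → ℝ) × ℝ => empMean (q₂ z.2) z.1 :=
      (H.continuous_empMean₂.comp continuous_swap).measurable
    have h2 : Measurable fun z : (Fin M → ℝ) × ℝ => ∫ y, q₂ z.2 y ∂μ :=
      hmeas2.measurable.comp measurable_snd
    exact (h1.sub h2).pow_const 4
  refine integrable_of_abs_le (K := (2 * K) ^ 4) hmeas.aestronglyMeasurable ?_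
  have hset : MeasurableSet {z : (Fin M → ℝ) × ℝ | |Function.uncurry (fun (x : Fin M → ℝ) (θ : ℝ) =>
        (empMean (q₂ θ) x - ∫ y, q₂ θ y ∂μ) ^ 4) z| ≤ (2 * K) ^ 4} :=
    measurableSet_le hmeas.abs measurable_const
  rw [Measure.ae_prod_iff_ae_ae hset]
  filter_upwards [ae_pi_forall H.bound M] with x hx
  filter_upwards [ae_restrict_mem measurableSet_Ioc] with θ hθ
  have hθ' : θ ∈ Set.Icc (a - 1) (b + 1) := Icc_subset (Set.Ioc_subset_Icc_self hθ)
  have h1 : |empMean (q₂ θ) x| ≤ K := abs_empMean_le hM fun i => (hx i θ hθ').2.2.1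
  have h2 : |∫ y, q₂ θ y ∂μ| ≤ K :=
    abs_integral_le_of_abs_le (H.bound.mono fun y hy => (hy θ hθ').2.2.1)
  simp only [Function.uncurry, abs_pow]
  exact pow_le_pow_left₀ (abs_nonneg _) ((abs_sub _ _).trans (by linarith)) 4

theorem integrable_fluctuation (H : RegularCriterion μ a b K q q₁ q₂) (hab : a < b) {M : ℕ}
    (hM : 1 ≤ M) :
    Integrable (fun x : Fin M → ℝ => fluctuation μ a b q₂ x) (Measure.pi fun _ => μ) := by
  unfold fluctuation
  simp_rw [intervalIntegral.integral_of_le hab.le]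
  exact (H.integrable_uncurry_fluctuation hM).integral_prod_left

theorem integral_fluctuation_le (H : RegularCriterion μ a b K q q₁ q₂) (hab : a < b) {M : ℕ}
    (hM : 1 ≤ M) :
    ∫ x : Fin M → ℝ, fluctuation μ a b q₂ x ∂(Measure.pi fun _ => μ) ≤
      (b - a) * (1536 * K ^ 4 / M ^ 2) := by
  unfold fluctuation
  simp_rw [intervalIntegral.integral_of_le hab.le]
  rw [integral_integral_swap (H.integrable_uncurry_fluctuation hM)]
  have hle : ∀ θ ∈ Set.Ioc a b, ∫ x : Fin M → ℝ, (empMean (q₂ θ) x - ∫ y, q₂ θ y ∂μ) ^ 4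
      ∂(Measure.pi fun _ => μ) ≤ 1536 * K ^ 4 / M ^ 2 := fun θ hθ =>
    integral_empMean_sub_pow_four_le (measurable_section H.cont₂ θ) H.pos
      (H.bound.mono fun y hy => (hy θ (Icc_subset (Set.Ioc_subset_Icc_self hθ))).2.2.1) hM
  calc _ ≤ ∫ θ in Set.Ioc a b, (1536 * K ^ 4 / M ^ 2 : ℝ) := by
        refine integral_mono_of_nonneg (ae_of_all _ fun θ => ?_) (integrable_const _) ?_
        · exact integral_nonneg fun x => by positivity
        · filter_upwards [ae_restrict_mem measurableSet_Ioc] with θ hθ using hle θ hθ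
    _ = _ := by simp [hab.le]

end RegularCriterion

end QPE

namespace QPE

namespace RegularCriterion

variable {μ : Measure ℝ} {a b K : ℝ} {q q₁ q₂ : ℝ → ℝ → ℝ}

/-- `est` selects, for almost every sample, a maximiser over `[a, b]` of the empirical mean of
the criterion. -/
def IsMaximizer (μ : Measure ℝ) (a b : ℝ) (q : ℝ → ℝ → ℝ) {M : ℕ} (est : (Fin M → ℝ) → ℝ) : Prop :=
  Measurable est ∧ ∀ᵐ x ∂(Measure.pi fun _ : Fin M => μ), est x ∈ Set.Icc a b ∧
    ∀ θ ∈ Set.Icc a b, empMean (q θ) x ≤ empMean (q (est x)) x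

variable [IsProbabilityMeasure μ]

/-- Under a quadratic lower bound on the loss of the population criterion, the distance of the
maximiser from the optimum is controlled by the fluctuations of the derivatives. -/
theorem IsMaximizer.pow_four_le (H : RegularCriterion μ a b K q q₁ q₂) (hab : a < b)
    {θ₀ : ℝ} (hθ₀ : θ₀ ∈ Set.Icc a b) {c : ℝ} (hc : 0 < c)
    (hwell : ∀ θ ∈ Set.Icc a b, c * (θ - θ₀) ^ 2 ≤ ∫ x, q θ₀ x ∂μ - ∫ x, q θ x ∂μ)
    {M : ℕ} {est : (Fin M → ℝ) → ℝ} (hest : IsMaximizer μ a b q est) :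
    ∀ᵐ x ∂(Measure.pi fun _ : Fin M => μ), (est x - θ₀) ^ 4 ≤ c⁻¹ ^ 4 *
      (8 * ((empMean (q₁ θ₀) x - ∫ y, q₁ θ₀ y ∂μ) ^ 4 +
        (b - a) ^ 3 * fluctuation μ a b q₂ x)) := by
  filter_upwards [hest.2] with x hx
  set θ := est x with hθ
  have h₁ : ∀ s ∈ Set.Icc a b, HasDerivAt (fun s => empMean (q s) x - ∫ y, q s y ∂μ)
      (empMean (q₁ s) x - ∫ y, q₁ s y ∂μ) s := fun s hs =>
    (H.hasDerivAt_empMean x s).sub (H.hasDerivAt_integral hs)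
  have h₂ : ∀ s ∈ Set.Icc a b, HasDerivAt (fun s => empMean (q₁ s) x - ∫ y, q₁ s y ∂μ)
      (empMean (q₂ s) x - ∫ y, q₂ s y ∂μ) s := fun s hs =>
    (H.hasDerivAt_empMean₁ x s).sub (H.hasDerivAt_integral₁ hs)
  have hcont : ContinuousOn (fun s => empMean (q₂ s) x - ∫ y, q₂ s y ∂μ) (Set.Icc a b) :=
    (H.continuous_empMean₂.comp (Continuous.prodMk_left x)).continuousOn.sub
      H.continuousOn_integral₂
  have hdev := abs_sub_le_integral_deriv hab h₁ h₂ hcont hθ₀ hx.1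
  set G := |empMean (q₁ θ₀) x - ∫ y, q₁ θ₀ y ∂μ| +
    ∫ s in a..b, |empMean (q₂ s) x - ∫ y, q₂ s y ∂μ| with hG
  have hGnn : 0 ≤ G := add_nonneg (abs_nonneg _)
    (intervalIntegral.integral_nonneg hab.le fun _ _ => abs_nonneg _)
  have hmain : c * (θ - θ₀) ^ 2 ≤ G * |θ - θ₀| := by
    have h3 := hwell θ hx.1
    have h4 := hx.2 θ₀ hθ₀
    have h5 := (le_abs_self _).trans hdev
    linarith
  have hd : |θ - θ₀| ≤ c⁻¹ * G := by
    rcases eq_or_ne (θ - θ₀) 0 with h0 | h0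
    · rw [h0, abs_zero]; positivity
    · have hp : 0 < |θ - θ₀| := abs_pos.2 h0
      rw [← sq_abs, sq, ← mul_assoc] at hmain
      have := le_of_mul_le_mul_right hmain hp
      rw [inv_mul_eq_div, le_div_iff₀ hc]; linarith
  have habs4 : ∀ z : ℝ, |z| ^ 4 = z ^ 4 := fun z => by
    rw [show (4 : ℕ) = 2 * 2 from rfl, pow_mul, pow_mul, sq_abs]
  calc (θ - θ₀) ^ 4 = |θ - θ₀| ^ 4 := (habs4 _).symm
    _ ≤ (c⁻¹ * G) ^ 4 := pow_le_pow_left₀ (abs_nonneg _) hd 4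
    _ = c⁻¹ ^ 4 * G ^ 4 := mul_pow _ _ _
    _ ≤ _ := by
      gcongr
      refine (add_pow_four_le _ _).trans ?_
      rw [habs4]
      gcongr
      refine (pow_four_integral_le hab hcont.abs).trans ?_
      simp_rw [habs4]
      exact le_rfl

theorem IsMaximizer.integrable_pow {M : ℕ} {est : (Fin M → ℝ) → ℝ}
    (hest : IsMaximizer μ a b q est) {θ₀ : ℝ} (hθ₀ : θ₀ ∈ Set.Icc a b) (k : ℕ) :
    Integrable (fun x => (est x - θ₀) ^ k) (Measure.pi fun _ : Fin M => μ) := by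
  refine integrable_of_abs_le (K := (b - a) ^ k)
    ((hest.1.sub_const θ₀).pow_const k).aestronglyMeasurable (hest.2.mono fun x hx => ?_)
  rw [abs_pow]
  refine pow_le_pow_left₀ (abs_nonneg _) (abs_le.2 ⟨?_, ?_⟩) k <;>
    linarith [hx.1.1, hx.1.2, hθ₀.1, hθ₀.2]

theorem integrable_empMean_sub_pow (H : RegularCriterion μ a b K q q₁ q₂) {h : ℝ → ℝ}
    (hm : Measurable h) (hb : ∀ᵐ x ∂μ, |h x| ≤ K) {M : ℕ} (hM : 1 ≤ M) (k : ℕ) :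
    Integrable (fun x => (empMean h x - ∫ y, h y ∂μ) ^ k) (Measure.pi fun _ : Fin M => μ) := by
  have := H.pos
  refine integrable_of_abs_le (K := (2 * K) ^ k)
    (((measurable_empMean hm).sub_const _).pow_const k).aestronglyMeasurable ?_
  filter_upwards [ae_pi_forall hb M] with x hx
  rw [abs_pow]
  refine pow_le_pow_left₀ (abs_nonneg _) ((abs_sub _ _).trans ?_) k
  linarith [abs_empMean_le hM hx, abs_integral_le_of_abs_le hb]

theorem IsMaximizer.integral_pow_four_le (H : RegularCriterion μ a b K q q₁ q₂) (hab : a < b)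
    {θ₀ : ℝ} (hθ₀ : θ₀ ∈ Set.Icc a b) {c : ℝ} (hc : 0 < c)
    (hwell : ∀ θ ∈ Set.Icc a b, c * (θ - θ₀) ^ 2 ≤ ∫ x, q θ₀ x ∂μ - ∫ x, q θ x ∂μ)
    {M : ℕ} (hM : 1 ≤ M) {est : (Fin M → ℝ) → ℝ} (hest : IsMaximizer μ a b q est) :
    ∫ x, (est x - θ₀) ^ 4 ∂(Measure.pi fun _ : Fin M => μ) ≤
      c⁻¹ ^ 4 * (8 * (1 + (b - a) ^ 4)) * (1536 * K ^ 4) / M ^ 2 := by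
  have hba : 0 < b - a := sub_pos.2 hab
  have hb₁ : ∀ᵐ x ∂μ, |q₁ θ₀ x| ≤ K := H.bound.mono fun x hx => (hx θ₀ (Icc_subset hθ₀)).2.1
  have i1 := H.integrable_empMean_sub_pow (measurable_section H.cont₁ θ₀) hb₁ hM 4
  have i2 := H.integrable_fluctuation hab hM
  have e1 := integral_empMean_sub_pow_four_le (measurable_section H.cont₁ θ₀) H.pos hb₁ hM
  have e2 := H.integral_fluctuation_le hab hM
  calc _ ≤ ∫ x, c⁻¹ ^ 4 * (8 * ((empMean (q₁ θ₀) x - ∫ y, q₁ θ₀ y ∂μ) ^ 4 +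
        (b - a) ^ 3 * fluctuation μ a b q₂ x)) ∂(Measure.pi fun _ : Fin M => μ) :=
        integral_mono_of_nonneg (ae_of_all _ fun x => by positivity)
          (((i1.add (i2.const_mul _)).const_mul _).const_mul _)
          (hest.pow_four_le H hab hθ₀ hc hwell)
    _ = c⁻¹ ^ 4 * (8 * (∫ x, (empMean (q₁ θ₀) x - ∫ y, q₁ θ₀ y ∂μ) ^ 4
          ∂(Measure.pi fun _ : Fin M => μ) +
        (b - a) ^ 3 * ∫ x, fluctuation μ a b q₂ x ∂(Measure.pi fun _ : Fin M => μ))) := by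
        rw [integral_const_mul, integral_const_mul, integral_add i1 (i2.const_mul _),
          integral_const_mul]
    _ ≤ c⁻¹ ^ 4 * (8 * (1536 * K ^ 4 / M ^ 2 +
        (b - a) ^ 3 * ((b - a) * (1536 * K ^ 4 / M ^ 2)))) := by gcongr
    _ = _ := by ring

/-- The deviation of the maximiser from its linearisation by the score is of second order. -/
theorem IsMaximizer.sq_sub_linear_le (H : RegularCriterion μ a b K q q₁ q₂)
    {θ₀ : ℝ} (hθ₀ : θ₀ ∈ Set.Ioo a b) {J : ℝ} (hJ : 0 < J) (hJ' : ∫ x, q₂ θ₀ x ∂μ = -J)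
    {δ : ℝ} (hδ : 0 < δ) (hδa : δ ≤ θ₀ - a) (hδb : δ ≤ b - θ₀)
    {M : ℕ} (hM : 1 ≤ M) {est : (Fin M → ℝ) → ℝ} (hest : IsMaximizer μ a b q est) :
    ∀ᵐ x ∂(Measure.pi fun _ : Fin M => μ), (est x - θ₀ - empMean (q₁ θ₀) x / J) ^ 2 ≤
      ((2 * K ^ 2 + 1) / J ^ 2 + (2 * (b - a) ^ 2 + 2 * (K / J) ^ 2) / δ ^ 4) * (est x - θ₀) ^ 4 +
      1 / J ^ 2 * (empMean (q₂ θ₀) x - ∫ y, q₂ θ₀ y ∂μ) ^ 4 := by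
  have hθI : θ₀ ∈ Set.Icc a b := Set.Ioo_subset_Icc_self hθ₀
  filter_upwards [hest.2, ae_pi_forall H.bound M] with x hx hxb
  set θ := est x with hθ
  set d := θ - θ₀ with hd
  set e := empMean (q₂ θ₀) x - ∫ y, q₂ θ₀ y ∂μ with he
  by_cases hcase : δ ≤ |d|
  · have h1 : |empMean (q₁ θ₀) x| ≤ K := abs_empMean_le hM fun i => (hxb i θ₀ (Icc_subset hθI)).2.1
    have h2 : d ^ 2 ≤ (b - a) ^ 2 := by
      rw [← sq_abs d]
      refine pow_le_pow_left₀ (abs_nonneg _) (abs_le.2 ⟨?_, ?_⟩) 2 <;>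
        linarith [hx.1.1, hx.1.2, hθI.1, hθI.2]
    have h3 : (empMean (q₁ θ₀) x / J) ^ 2 ≤ (K / J) ^ 2 := by
      rw [div_pow, div_pow, ← sq_abs (empMean _ _)]
      exact div_le_div_of_nonneg_right (pow_le_pow_left₀ (abs_nonneg _) h1 2) (by positivity)
    have h4 : 1 ≤ d ^ 4 / δ ^ 4 := by
      rw [le_div_iff₀ (by positivity), one_mul, ← Even.pow_abs (by decide : Even 4) d]
      exact pow_le_pow_left₀ hδ.le hcase 4
    have h5 : (d - empMean (q₁ θ₀) x / J) ^ 2 ≤ 2 * (b - a) ^ 2 + 2 * (K / J) ^ 2 := by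
      nlinarith [sq_nonneg (d + empMean (q₁ θ₀) x / J)]
    calc _ ≤ (2 * (b - a) ^ 2 + 2 * (K / J) ^ 2) * 1 := by linarith
      _ ≤ (2 * (b - a) ^ 2 + 2 * (K / J) ^ 2) * (d ^ 4 / δ ^ 4) := by gcongr
      _ = 0 + (2 * (b - a) ^ 2 + 2 * (K / J) ^ 2) / δ ^ 4 * d ^ 4 + 0 := by ring
      _ ≤ (2 * K ^ 2 + 1) / J ^ 2 * d ^ 4 +
          (2 * (b - a) ^ 2 + 2 * (K / J) ^ 2) / δ ^ 4 * d ^ 4 + 1 / J ^ 2 * e ^ 4 := by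
        gcongr <;> positivity
      _ = _ := by ring
  · push Not at hcase
    have hinteg : θ ∈ Set.Ioo a b := by
      have := abs_lt.1 hcase; constructor <;> linarith
    have hmax : IsLocalMax (fun s => empMean (q s) x) θ := by
      filter_upwards [Ioo_mem_nhds hinteg.1 hinteg.2] with s hs
      exact hx.2 s (Set.Ioo_subset_Icc_self hs)
    have hzero : empMean (q₁ θ) x = 0 := hmax.hasDerivAt_eq_zero (H.hasDerivAt_empMean x θ)
    have hlip : ∀ s ∈ Set.Icc a b, ∀ s' ∈ Set.Icc a b,
        |empMean (q₂ s) x - empMean (q₂ s') x| ≤ K * |s - s'| := by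
      intro s hs s' hs'
      have := abs_empMean_le (h := fun y => q₂ s y - q₂ s' y) (K := K * |s - s'|) hM
        (fun i => (hxb i s (Icc_subset hs)).2.2.2 s' (Icc_subset hs'))
      have heq : empMean (fun y => q₂ s y - q₂ s' y) x =
          empMean (q₂ s) x - empMean (q₂ s') x := by
        simp [empMean, Finset.sum_sub_distrib, mul_sub]
      rwa [heq] at this
    have htaylor : |empMean (q₁ θ) x - empMean (q₁ θ₀) x - empMean (q₂ θ₀) x * d| ≤
        K * |d| * |d| := by
      have hmv := (convex_uIcc θ₀ θ).norm_image_sub_le_of_norm_hasDerivWithin_le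
        (f := fun s => empMean (q₁ s) x - empMean (q₂ θ₀) x * (s - θ₀))
        (f' := fun s => empMean (q₂ s) x - empMean (q₂ θ₀) x) (C := K * |d|)
        (fun s _ => (((H.hasDerivAt_empMean₁ x s).sub
          (((hasDerivAt_id s).sub_const θ₀).const_mul _)).congr_deriv (by simp)).hasDerivWithinAt)
        (fun s hs => ?_) Set.left_mem_uIcc Set.right_mem_uIcc
      · simp only [Real.norm_eq_abs, sub_self, mul_zero, sub_zero] at hmv
        refine le_trans (le_of_eq ?_) hmv
        congr 1; ring
      · have hs' : s ∈ Set.Icc a b := Set.uIcc_subset_Icc hθI hx.1 hs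
        refine (hlip s hs' θ₀ hθI).trans ?_
        exact mul_le_mul_of_nonneg_left (Set.abs_sub_left_of_mem_uIcc hs) H.pos.le
    rw [hzero] at htaylor
    have hmain : |J * (d - empMean (q₁ θ₀) x / J)| ≤ K * d ^ 2 + |e| * |d| := by
      have heq : J * (d - empMean (q₁ θ₀) x / J) =
          (0 - empMean (q₁ θ₀) x - empMean (q₂ θ₀) x * d) + e * d := by
        rw [he, hJ', mul_sub, mul_div_cancel₀ _ hJ.ne']; ring
      rw [heq]
      refine (abs_add_le _ _).trans ?_
      rw [abs_mul e, ← sq_abs d]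
      nlinarith
    have hsq : (J * (d - empMean (q₁ θ₀) x / J)) ^ 2 ≤ (2 * K ^ 2 + 1) * d ^ 4 + e ^ 4 := by
      rw [← sq_abs]
      calc _ ≤ (K * d ^ 2 + |e| * |d|) ^ 2 := pow_le_pow_left₀ (abs_nonneg _) hmain 2
        _ ≤ 2 * (K * d ^ 2) ^ 2 + 2 * (|e| * |d|) ^ 2 := by
          nlinarith [sq_nonneg (K * d ^ 2 - |e| * |d|)]
        _ = 2 * K ^ 2 * d ^ 4 + 2 * (e ^ 2 * d ^ 2) := by rw [mul_pow |e|, sq_abs, sq_abs]; ring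
        _ ≤ _ := by nlinarith [sq_nonneg (e ^ 2 - d ^ 2)]
    rw [mul_pow] at hsq
    have hJ2 : 0 < J ^ 2 := by positivity
    calc (d - empMean (q₁ θ₀) x / J) ^ 2 ≤ ((2 * K ^ 2 + 1) * d ^ 4 + e ^ 4) / J ^ 2 := by
          rw [le_div_iff₀ hJ2]; linarith
      _ = (2 * K ^ 2 + 1) / J ^ 2 * d ^ 4 + 0 + 1 / J ^ 2 * e ^ 4 := by ring
      _ ≤ (2 * K ^ 2 + 1) / J ^ 2 * d ^ 4 +
          (2 * (b - a) ^ 2 + 2 * (K / J) ^ 2) / δ ^ 4 * d ^ 4 + 1 / J ^ 2 * e ^ 4 := by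
        gcongr; positivity
      _ = _ := by ring

theorem exists_integral_sq_sub_linear_le (H : RegularCriterion μ a b K q q₁ q₂)
    {θ₀ : ℝ} (hθ₀ : θ₀ ∈ Set.Ioo a b) {c : ℝ} (hc : 0 < c)
    (hwell : ∀ θ ∈ Set.Icc a b, c * (θ - θ₀) ^ 2 ≤ ∫ x, q θ₀ x ∂μ - ∫ x, q θ x ∂μ)
    {J : ℝ} (hJ : 0 < J) (hJ' : ∫ x, q₂ θ₀ x ∂μ = -J) :
    ∃ B : ℝ, 0 ≤ B ∧ ∀ M : ℕ, 1 ≤ M → ∀ est : (Fin M → ℝ) → ℝ, IsMaximizer μ a b q est →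
      ∫ x, (est x - θ₀ - empMean (q₁ θ₀) x / J) ^ 2 ∂(Measure.pi fun _ : Fin M => μ) ≤
        B / M ^ 2 := by
  have hab : a < b := hθ₀.1.trans hθ₀.2
  have hθI : θ₀ ∈ Set.Icc a b := Set.Ioo_subset_Icc_self hθ₀
  set δ := min (θ₀ - a) (b - θ₀) with hδ
  have hδpos : 0 < δ := lt_min (sub_pos.2 hθ₀.1) (sub_pos.2 hθ₀.2)
  set A₁ := (2 * K ^ 2 + 1) / J ^ 2 + (2 * (b - a) ^ 2 + 2 * (K / J) ^ 2) / δ ^ 4 with hA₁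
  have hA₁nn : 0 ≤ A₁ := by positivity
  set A₂ := c⁻¹ ^ 4 * (8 * (1 + (b - a) ^ 4)) * (1536 * K ^ 4) with hA₂
  have hA₂nn : 0 ≤ A₂ := by have := H.pos; positivity
  refine ⟨A₁ * A₂ + 1 / J ^ 2 * (1536 * K ^ 4), by have := H.pos; positivity,
    fun M hM est hest => ?_⟩
  have hb₂ : ∀ᵐ x ∂μ, |q₂ θ₀ x| ≤ K := H.bound.mono fun x hx => (hx θ₀ (Icc_subset hθI)).2.2.1
  have i1 := hest.integrable_pow hθI 4
  have i2 := H.integrable_empMean_sub_pow (measurable_section H.cont₂ θ₀) hb₂ hM 4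
  have e1 := hest.integral_pow_four_le H hab hθI hc hwell hM
  have e2 := integral_empMean_sub_pow_four_le (measurable_section H.cont₂ θ₀) H.pos hb₂ hM
  calc _ ≤ ∫ x, (A₁ * (est x - θ₀) ^ 4 +
        1 / J ^ 2 * (empMean (q₂ θ₀) x - ∫ y, q₂ θ₀ y ∂μ) ^ 4)
          ∂(Measure.pi fun _ : Fin M => μ) :=
        integral_mono_of_nonneg (ae_of_all _ fun x => by positivity)
          ((i1.const_mul _).add (i2.const_mul _))
          (hest.sq_sub_linear_le H hθ₀ hJ hJ' hδpos (min_le_left _ _) (min_le_right _ _) hM)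
    _ = A₁ * ∫ x, (est x - θ₀) ^ 4 ∂(Measure.pi fun _ : Fin M => μ) +
        1 / J ^ 2 * ∫ x, (empMean (q₂ θ₀) x - ∫ y, q₂ θ₀ y ∂μ) ^ 4
          ∂(Measure.pi fun _ : Fin M => μ) := by
        rw [integral_add (i1.const_mul _) (i2.const_mul _), integral_const_mul,
          integral_const_mul]
    _ ≤ A₁ * (A₂ / M ^ 2) + 1 / J ^ 2 * (1536 * K ^ 4 / M ^ 2) := by gcongr
    _ = _ := by ring

end RegularCriterion

end QPE

namespace QPE

theorem sq_integral_le_integral_sq {Ω : Type*} [MeasurableSpace Ω] {ν : Measure Ω}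
    [IsProbabilityMeasure ν] {f : Ω → ℝ} (hf : MemLp f 2 ν) :
    (∫ x, f x ∂ν) ^ 2 ≤ ∫ x, f x ^ 2 ∂ν := by
  have h1 := variance_eq_sub hf
  have h2 := variance_nonneg f ν
  simp only [Pi.pow_apply] at h1
  linarith

theorem tendsto_inv_sqrt_natCast : Tendsto (fun M : ℕ => (√(M : ℝ))⁻¹) atTop (𝓝 0) :=
  tendsto_inv_atTop_zero.comp (Real.tendsto_sqrt_atTop.comp tendsto_natCast_atTop_atTop)

namespace RegularCriterion

variable {μ : Measure ℝ} [IsProbabilityMeasure μ] {a b K : ℝ} {q q₁ q₂ : ℝ → ℝ → ℝ}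

theorem IsMaximizer.memLp {M : ℕ} {est : (Fin M → ℝ) → ℝ}
    (hest : IsMaximizer μ a b q est) {p : ℝ≥0∞} : MemLp est p (Measure.pi fun _ : Fin M => μ) := by
  refine MemLp.of_bound hest.1.aestronglyMeasurable (max |a| |b|) (hest.2.mono fun x hx => ?_)
  exact abs_le_max_abs_abs hx.1.1 hx.1.2

theorem memLp_empMean {h : ℝ → ℝ} (hm : Measurable h) (hb : ∀ᵐ x ∂μ, |h x| ≤ K) {M : ℕ}
    (hM : 1 ≤ M) {p : ℝ≥0∞} : MemLp (empMean h) p (Measure.pi fun _ : Fin M => μ) := by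
  refine MemLp.of_bound (measurable_empMean hm).aestronglyMeasurable K ?_
  filter_upwards [ae_pi_forall hb M] with x hx using abs_empMean_le hM hx

/-- Asymptotics of a maximiser of the empirical criterion: its bias is `o(M^{-1/2})` and its mean
square error is `V / (J² M)` to leading order, where `V` is the second moment of the score and
`-J` the expected second derivative. -/
theorem tendsto_bias_and_mse (H : RegularCriterion μ a b K q q₁ q₂)
    {θ₀ : ℝ} (hθ₀ : θ₀ ∈ Set.Ioo a b) {c : ℝ} (hc : 0 < c)
    (hwell : ∀ θ ∈ Set.Icc a b, c * (θ - θ₀) ^ 2 ≤ ∫ x, q θ₀ x ∂μ - ∫ x, q θ x ∂μ)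
    (hscore : ∫ x, q₁ θ₀ x ∂μ = 0) {J : ℝ} (hJ : 0 < J) (hJ' : ∫ x, q₂ θ₀ x ∂μ = -J)
    {est : (M : ℕ) → (Fin M → ℝ) → ℝ} (hest : ∀ M, 1 ≤ M → IsMaximizer μ a b q (est M)) :
    Tendsto (fun M : ℕ => √(M : ℝ) * (∫ x, est M x ∂(Measure.pi fun _ : Fin M => μ) - θ₀))
      atTop (𝓝 0) ∧
    Tendsto (fun M : ℕ => (M : ℝ) * ∫ x, (est M x - θ₀) ^ 2 ∂(Measure.pi fun _ : Fin M => μ))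
      atTop (𝓝 ((∫ x, q₁ θ₀ x ^ 2 ∂μ) / J ^ 2)) := by
  obtain ⟨B, hB, hBM⟩ := H.exists_integral_sq_sub_linear_le hθ₀ hc hwell hJ hJ'
  have hθI : θ₀ ∈ Set.Icc a b := Set.Ioo_subset_Icc_self hθ₀
  have hb₁ : ∀ᵐ x ∂μ, |q₁ θ₀ x| ≤ K := H.bound.mono fun x hx => (hx θ₀ (Icc_subset hθI)).2.1
  have hm₁ := measurable_section H.cont₁ θ₀
  set V := ∫ x, q₁ θ₀ x ^ 2 ∂μ with hV
  have hVnn : 0 ≤ V := integral_nonneg fun x => sq_nonneg _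
  have hrem : ∀ M, 1 ≤ M → MemLp (fun x => est M x - θ₀ - empMean (q₁ θ₀) x / J) 2
      (Measure.pi fun _ : Fin M => μ) := fun M hM => by
    have h1 : MemLp (fun x => empMean (q₁ θ₀) x / J) 2 (Measure.pi fun _ : Fin M => μ) := by
      simp_rw [div_eq_inv_mul]
      exact (memLp_empMean hm₁ hb₁ hM).const_mul J⁻¹
    exact ((hest M hM).memLp.sub (memLp_const θ₀)).sub h1
  have hlin : ∀ M, 1 ≤ M → MemLp (fun x => empMean (q₁ θ₀) x / J) 2
      (Measure.pi fun _ : Fin M => μ) := fun M hM => by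
    simp_rw [div_eq_inv_mul]
    exact (memLp_empMean hm₁ hb₁ hM).const_mul J⁻¹
  constructor
  · refine squeeze_zero_norm' (a := fun M : ℕ => √B * (√(M : ℝ))⁻¹) ?_ (by
      simpa using tendsto_inv_sqrt_natCast.const_mul (√B))
    filter_upwards [eventually_ge_atTop 1] with M hM
    have hM' : (0 : ℝ) < M := by exact_mod_cast hM
    have heq : ∫ x, est M x ∂(Measure.pi fun _ : Fin M => μ) - θ₀ =
        ∫ x, (est M x - θ₀ - empMean (q₁ θ₀) x / J) ∂(Measure.pi fun _ : Fin M => μ) := by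
      rw [integral_sub, integral_sub, integral_div, integral_empMean hm₁ hb₁ hM, hscore]
      · simp
      · exact (hest M hM).memLp.integrable le_rfl
      · exact integrable_const _
      · exact ((hest M hM).memLp.integrable le_rfl).sub (integrable_const _)
      · exact (hlin M hM).integrable one_le_two
    have h1 := (sq_integral_le_integral_sq (hrem M hM)).trans (hBM M hM _ (hest M hM))
    rw [← heq] at h1
    have h2 := Real.abs_le_sqrt h1
    rw [Real.sqrt_div hB, Real.sqrt_sq hM'.le] at h2
    rw [Real.norm_eq_abs, abs_mul, abs_of_nonneg (Real.sqrt_nonneg _)]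
    calc √(M : ℝ) * _ ≤ √(M : ℝ) * (√B / M) := by gcongr
      _ = _ := by
        have h3 := Real.mul_self_sqrt hM'.le
        have h4 : √(M : ℝ) ≠ 0 := (Real.sqrt_pos.2 hM').ne'
        field_simp
        rw [sq, h3]; ring
  · rw [tendsto_iff_norm_sub_tendsto_zero]
    refine squeeze_zero_norm' (a := fun M : ℕ => (V / J ^ 2 + B) * (√(M : ℝ))⁻¹ +
        B * ((√(M : ℝ))⁻¹ * (√(M : ℝ))⁻¹)) ?_ ?_
    · filter_upwards [eventually_ge_atTop 1] with M hM
      have hM' : (0 : ℝ) < M := by exact_mod_cast hM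
      have hsM : 0 < √(M : ℝ) := Real.sqrt_pos.2 hM'
      set ν := Measure.pi fun _ : Fin M => μ with hν
      set l := fun x : Fin M → ℝ => empMean (q₁ θ₀) x / J with hl
      set R := fun x : Fin M → ℝ => est M x - θ₀ - l x with hR
      have iR : Integrable (fun x => R x ^ 2) ν := (hrem M hM).integrable_sq
      have il : Integrable (fun x => l x ^ 2) ν := (hlin M hM).integrable_sq
      have id : Integrable (fun x => (est M x - θ₀) ^ 2) ν := (hest M hM).integrable_pow hθI 2
      have el : ∫ x, l x ^ 2 ∂ν = V / J ^ 2 / M := by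
        simp only [hl, div_pow]
        rw [integral_div, integral_empMean_sq hm₁ hb₁ hscore hM]
        ring
      have eR : ∫ x, R x ^ 2 ∂ν ≤ B / M ^ 2 := hBM M hM _ (hest M hM)
      have hdiff : |∫ x, (est M x - θ₀) ^ 2 ∂ν - ∫ x, l x ^ 2 ∂ν| ≤
          (√(M : ℝ))⁻¹ * ∫ x, l x ^ 2 ∂ν + (√(M : ℝ) + 1) * ∫ x, R x ^ 2 ∂ν := by
        rw [← integral_sub id il, ← integral_const_mul, ← integral_const_mul,
          ← integral_add (il.const_mul _) (iR.const_mul _), ← Real.norm_eq_abs]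
        refine norm_integral_le_of_norm_le ((il.const_mul _).add (iR.const_mul _))
          (ae_of_all _ fun x => ?_)
        rw [Real.norm_eq_abs]
        have hd : est M x - θ₀ = l x + R x := by simp [hR]
        set s := √(M : ℝ)
        have hs : s * s⁻¹ = 1 := mul_inv_cancel₀ hsM.ne'
        have hcross : 2 * |l x * R x| ≤ s⁻¹ * l x ^ 2 + s * R x ^ 2 := by
          rw [abs_mul]
          have h1 : 0 ≤ s⁻¹ * (|l x| - s * |R x|) ^ 2 := by positivity
          have h2 : s⁻¹ * (|l x| - s * |R x|) ^ 2 =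
              s⁻¹ * |l x| ^ 2 + s * |R x| ^ 2 - 2 * (|l x| * |R x|) := by field_simp; ring
          rw [h2, sq_abs, sq_abs] at h1
          linarith
        rw [hd, show (l x + R x) ^ 2 - l x ^ 2 = 2 * (l x * R x) + R x ^ 2 by ring]
        refine (abs_add_le _ _).trans ?_
        rw [abs_mul, abs_of_pos (zero_lt_two' ℝ), abs_of_nonneg (sq_nonneg (R x))]
        linarith
      have hMl : (M : ℝ) * ∫ x, l x ^ 2 ∂ν = V / J ^ 2 := by rw [el]; field_simp
      rw [norm_norm, Real.norm_eq_abs, ← hMl, ← mul_sub, abs_mul, abs_of_pos hM']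
      calc (M : ℝ) * |∫ x, (est M x - θ₀) ^ 2 ∂ν - ∫ x, l x ^ 2 ∂ν|
          ≤ M * ((√(M : ℝ))⁻¹ * (V / J ^ 2 / M) + (√(M : ℝ) + 1) * (B / M ^ 2)) := by
            gcongr; rw [← el]; refine hdiff.trans ?_; gcongr
        _ = _ := by
          rw [hMl]
          have h3 : (M : ℝ) = √(M : ℝ) ^ 2 := (Real.sq_sqrt hM'.le).symm
          set s := √(M : ℝ)
          rw [h3]
          field_simp
          ring
    · have h1 := tendsto_inv_sqrt_natCast
      simpa using (h1.const_mul (V / J ^ 2 + B)).add ((h1.mul h1).const_mul B)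

end RegularCriterion

/-- If the bias around `φ₁` is `o(M^{-1/2})` and the mean square error around `φ₁` is `v / M` to
leading order, then the root mean square error around `φ₀` is `√((φ₁ - φ₀)² + v / M)`. -/
theorem Experiment.hasAsymptoticError (E : Experiment) [IsProbabilityMeasure E.filteredLaw]
    {est : (M : ℕ) → (Fin M → ℝ) → ℝ} {φ₁ v : ℝ} (hv : 0 < v)
    (hL : ∀ M, 1 ≤ M → MemLp (est M) 2 (E.samplesLaw M))
    (h1 : Tendsto (fun M : ℕ => √(M : ℝ) * (∫ x, est M x ∂E.samplesLaw M - φ₁)) atTop (𝓝 0))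
    (h2 : Tendsto (fun M : ℕ => (M : ℝ) * ∫ x, (est M x - φ₁) ^ 2 ∂E.samplesLaw M)
      atTop (𝓝 v)) :
    E.HasAsymptoticError est (φ₁ - E.φ₀) v := by
  have : ∀ M, IsProbabilityMeasure (E.samplesLaw M) := fun M => by
    unfold Experiment.samplesLaw; infer_instance
  set β := fun M : ℕ => ∫ x, est M x ∂E.samplesLaw M - φ₁ with hβ
  have hinv : Tendsto (fun M : ℕ => ((M : ℝ))⁻¹) atTop (𝓝 0) := tendsto_inv_atTop_nhds_zero_nat
  have hβ0 : Tendsto β atTop (𝓝 0) := by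
    have := tendsto_inv_sqrt_natCast.mul h1
    rw [mul_zero] at this
    refine this.congr' ?_
    filter_upwards [eventually_ge_atTop 1] with M hM
    have hM' : (0 : ℝ) < √(M : ℝ) := Real.sqrt_pos.2 (by exact_mod_cast hM)
    field_simp; rfl
  have hMβ : Tendsto (fun M : ℕ => (M : ℝ) * β M ^ 2) atTop (𝓝 0) := by
    have := h1.mul h1
    rw [mul_zero] at this
    refine this.congr fun M => ?_
    have h3 : √(M : ℝ) * √(M : ℝ) = M := Real.mul_self_sqrt (Nat.cast_nonneg M)
    linear_combination (β M ^ 2) * h3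
  have hm : Tendsto (fun M : ℕ => ∫ x, (est M x - φ₁) ^ 2 ∂E.samplesLaw M) atTop (𝓝 0) := by
    have := hinv.mul h2
    rw [zero_mul] at this
    refine this.congr' ?_
    filter_upwards [eventually_ge_atTop 1] with M hM
    have hM' : (0 : ℝ) < M := by exact_mod_cast hM
    field_simp
  refine ⟨?_, ?_, ?_⟩
  · have := hβ0.add_const (φ₁ - E.φ₀)
    rw [zero_add] at this
    refine this.congr fun M => ?_
    simp only [hβ]; ring
  · have := h2.sub hMβ
    rw [sub_zero] at this
    refine this.congr' ?_
    filter_upwards [eventually_ge_atTop 1] with M hM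
    have hL' : MemLp (fun x => est M x - φ₁) 2 (E.samplesLaw M) := (hL M hM).sub (memLp_const φ₁)
    have h4 := variance_sub_const (hL M hM).1 φ₁
    rw [← h4, variance_eq_sub hL', integral_sub ((hL M hM).integrable one_le_two)
      (integrable_const _)]
    simp [hβ, mul_sub]
  · have key : ∀ M : ℕ, 1 ≤ M → ∫ x, (est M x - E.φ₀) ^ 2 ∂E.samplesLaw M =
        (φ₁ - E.φ₀) ^ 2 + 2 * (φ₁ - E.φ₀) * β M +
          ∫ x, (est M x - φ₁) ^ 2 ∂E.samplesLaw M := by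
      intro M hM
      have hL' : MemLp (fun x => est M x - φ₁) 2 (E.samplesLaw M) := (hL M hM).sub (memLp_const φ₁)
      have i1 : Integrable (fun x => est M x - φ₁) (E.samplesLaw M) := hL'.integrable one_le_two
      have e1 : ∫ x, (est M x - φ₁) ∂E.samplesLaw M = β M := by
        rw [integral_sub ((hL M hM).integrable one_le_two) (integrable_const _)]; simp [hβ]
      have : ∀ x, (est M x - E.φ₀) ^ 2 = (φ₁ - E.φ₀) ^ 2 +
          2 * (φ₁ - E.φ₀) * (est M x - φ₁) + (est M x - φ₁) ^ 2 := fun x => by ring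
      simp_rw [this]
      have i2 : Integrable (fun x => (φ₁ - E.φ₀) ^ 2 + 2 * (φ₁ - E.φ₀) * (est M x - φ₁))
          (E.samplesLaw M) := (integrable_const _).add (i1.const_mul _)
      rw [integral_add i2 hL'.integrable_sq,
        integral_add (integrable_const _) (i1.const_mul _), integral_const_mul, e1]
      simp
    have hratio : Tendsto (fun M : ℕ => (∫ x, (est M x - E.φ₀) ^ 2 ∂E.samplesLaw M) /
        ((φ₁ - E.φ₀) ^ 2 + v / M)) atTop (𝓝 1) := by
      by_cases hb : φ₁ - E.φ₀ = 0
      · have := h2.div_const v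
        rw [div_self hv.ne'] at this
        refine this.congr' ?_
        filter_upwards [eventually_ge_atTop 1] with M hM
        have hM' : (0 : ℝ) < M := by exact_mod_cast hM
        rw [key M hM, hb]
        field_simp
        ring
      · have hn : Tendsto (fun M : ℕ => (φ₁ - E.φ₀) ^ 2 + 2 * (φ₁ - E.φ₀) * β M +
          ∫ x, (est M x - φ₁) ^ 2 ∂E.samplesLaw M) atTop (𝓝 ((φ₁ - E.φ₀) ^ 2)) := by
          simpa using ((hβ0.const_mul (2 * (φ₁ - E.φ₀))).const_add ((φ₁ - E.φ₀) ^ 2)).add hm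
        have hd : Tendsto (fun M : ℕ => (φ₁ - E.φ₀) ^ 2 + v / M) atTop
            (𝓝 ((φ₁ - E.φ₀) ^ 2)) := by
          simpa [div_eq_mul_inv] using (hinv.const_mul v).const_add ((φ₁ - E.φ₀) ^ 2)
        have := hn.div hd (by positivity)
        rw [div_self (by positivity)] at this
        refine this.congr' ?_
        filter_upwards [eventually_ge_atTop 1] with M hM
        simp only [Pi.div_apply]
        rw [key M hM]
    have := (Real.continuous_sqrt.tendsto 1).comp hratio
    rw [Real.sqrt_one] at this
    refine this.congr fun M => ?_
    simp only [Function.comp, Experiment.rmse]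
    rw [Real.sqrt_div (integral_nonneg fun x => sq_nonneg _)]

end QPE

namespace QPE

/-! ### Number of shots until `M` outcomes are accepted -/

theorem pi_ncard_lt_eq (μ : Measure ℝ) [IsProbabilityMeasure μ] {D : Set ℝ}
    (hD : MeasurableSet D) (m M : ℕ) :
    (Measure.pi fun _ : Fin m => μ) {x | {i | x i ∈ D}.ncard < M} =
      ∑ k ∈ Finset.range M, (m.choose k : ℝ≥0∞) * (μ D ^ k * μ Dᶜ ^ (m - k)) := by
  classical
  set S : Finset (Finset (Fin m)) := Finset.univ.filter fun s => s.card < M with hS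
  set box : Finset (Fin m) → Set (Fin m → ℝ) := fun s =>
    Set.pi Set.univ fun i => if i ∈ s then D else Dᶜ with hbox
  have hmem : ∀ s x, x ∈ box s ↔ ∀ i, (x i ∈ D ↔ i ∈ s) := by
    intro s x
    simp only [hbox, Set.mem_univ_pi]
    refine forall_congr' fun i => ?_
    by_cases hi : i ∈ s <;> simp [hi]
  have hset : {x : Fin m → ℝ | {i | x i ∈ D}.ncard < M} = ⋃ s ∈ S, box s := by
    ext x
    simp only [Set.mem_ofPred_eq, Set.mem_iUnion, exists_prop]
    have hcard : {i | x i ∈ D}.ncard = (Finset.univ.filter fun i => x i ∈ D).card := by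
      rw [← Set.ncard_coe_finset]; congr 1; ext i; simp
    constructor
    · intro h
      exact ⟨Finset.univ.filter fun i => x i ∈ D, by simpa [hS, ← hcard] using h,
        (hmem _ _).2 fun i => by simp⟩
    · rintro ⟨s, hs, hx⟩
      have : (Finset.univ.filter fun i => x i ∈ D) = s := by
        ext i; simpa using (hmem s x).1 hx i
      rw [hcard, this]; simpa [hS] using hs
  have hdisj : Set.PairwiseDisjoint (↑S) box := by
    intro s _ s' _ hne
    rw [Function.onFun, Set.disjoint_left]
    intro x hx hx'
    apply hne
    ext i
    rw [← (hmem s x).1 hx i, (hmem s' x).1 hx' i]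
  have hbm : ∀ s ∈ S, MeasurableSet (box s) := fun s _ =>
    MeasurableSet.univ_pi fun i => by split_ifs <;> [exact hD; exact hD.compl]
  have hval : ∀ s : Finset (Fin m), (Measure.pi fun _ : Fin m => μ) (box s) =
      μ D ^ s.card * μ Dᶜ ^ (m - s.card) := by
    intro s
    rw [hbox, Measure.pi_pi]
    have : ∀ i, μ (if i ∈ s then D else Dᶜ) = if i ∈ s then μ D else μ Dᶜ := fun i => by
      split_ifs <;> rfl
    simp_rw [this]
    rw [Finset.prod_ite]
    simp only [Finset.prod_const]
    congr 2
    · congr 1; ext i; simp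
    · have : (Finset.univ.filter fun i => i ∉ s) = sᶜ := by ext i; simp
      rw [this, Finset.card_compl, Fintype.card_fin]
  rw [hset, measure_biUnion_finset hdisj hbm]
  simp_rw [hval]
  rw [← Finset.sum_fiberwise_of_maps_to (s := S) (t := Finset.range M)
    (g := fun s : Finset (Fin m) => s.card) (fun s hs => by simpa [hS] using hs)]
  refine Finset.sum_congr rfl fun k hk => ?_
  have hfil : S.filter (fun s => s.card = k) = Finset.powersetCard k Finset.univ := by
    ext s
    simp only [hS, Finset.mem_filter, Finset.mem_univ, true_and, Finset.mem_powersetCard,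
      Finset.subset_univ]
    have := Finset.mem_range.1 hk
    constructor
    · exact fun h => h.2
    · exact fun h => ⟨by omega, h⟩
  rw [hfil, Finset.sum_congr rfl (g := fun _ => μ D ^ k * μ Dᶜ ^ (m - k)) fun s hs => by
    rw [(Finset.mem_powersetCard.1 hs).2]]
  simp [Finset.card_powersetCard]

theorem hasSum_negBinomial {p : ℝ} (hp : 0 < p) (hp1 : p ≤ 1) (k : ℕ) :
    HasSum (fun m : ℕ => (m.choose k : ℝ) * (p ^ k * (1 - p) ^ (m - k))) p⁻¹ := by
  have hr : ‖1 - p‖ < 1 := by rw [Real.norm_eq_abs, abs_of_nonneg (by linarith)]; linarith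
  have h := (hasSum_choose_mul_geometric_of_norm_lt_one k hr).mul_left (p ^ k)
  rw [← hasSum_nat_add_iff' k]
  have hz : ∑ i ∈ Finset.range k, ((i.choose k : ℝ) * (p ^ k * (1 - p) ^ (i - k))) = 0 :=
    Finset.sum_eq_zero fun i hi => by
      rw [Nat.choose_eq_zero_of_lt (Finset.mem_range.1 hi)]; simp
  rw [hz, sub_zero]
  have hf : (fun n : ℕ => ((n + k).choose k : ℝ) * (p ^ k * (1 - p) ^ (n + k - k))) =
      fun n : ℕ => p ^ k * (((n + k).choose k : ℝ) * (1 - p) ^ n) := by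
    funext n; rw [Nat.add_sub_cancel]; ring
  have hv : p ^ k * (1 / (1 - (1 - p)) ^ (k + 1)) = p⁻¹ := by
    rw [sub_sub_cancel, pow_succ]; field_simp
  rw [hf, ← hv]
  exact h

theorem tsum_pi_ncard_lt (μ : Measure ℝ) [IsProbabilityMeasure μ] {D : Set ℝ}
    (hD : MeasurableSet D) {p : ℝ} (hp : 0 < p) (hpD : μ D = ENNReal.ofReal p) (M : ℕ) :
    ∑' m : ℕ, (Measure.pi fun _ : Fin m => μ) {x | {i | x i ∈ D}.ncard < M} =
      ENNReal.ofReal (M / p) := by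
  have hp1 : p ≤ 1 := by
    have := prob_le_one (μ := μ) (s := D)
    rw [hpD] at this
    exact ENNReal.ofReal_le_one.1 this
  have hq : μ Dᶜ = ENNReal.ofReal (1 - p) := by
    rw [prob_compl_eq_one_sub hD, hpD, ENNReal.ofReal_sub _ hp.le, ENNReal.ofReal_one]
  simp_rw [pi_ncard_lt_eq μ hD]
  rw [Summable.tsum_finsetSum fun _ _ => ENNReal.summable]
  have hk : ∀ k, ∑' m : ℕ, (m.choose k : ℝ≥0∞) * (μ D ^ k * μ Dᶜ ^ (m - k)) =
      ENNReal.ofReal p⁻¹ := by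
    intro k
    have hs := hasSum_negBinomial hp hp1 k
    have hnn : ∀ m : ℕ, 0 ≤ (m.choose k : ℝ) * (p ^ k * (1 - p) ^ (m - k)) := fun m => by
      have : 0 ≤ 1 - p := by linarith
      positivity
    rw [← hs.tsum_eq, ENNReal.ofReal_tsum_of_nonneg hnn hs.summable]
    refine tsum_congr fun m => ?_
    rw [hpD, hq, ENNReal.ofReal_mul (by positivity), ENNReal.ofReal_mul (by positivity),
      ENNReal.ofReal_pow hp.le, ENNReal.ofReal_pow (by linarith), ENNReal.ofReal_natCast]
  simp_rw [hk]
  rw [Finset.sum_const, Finset.card_range, nsmul_eq_mul, div_eq_mul_inv,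
    ENNReal.ofReal_mul (by positivity), ENNReal.ofReal_natCast]

/-! ### Measurable maximisers -/

theorem exists_measurable_argmax {X : Type*} [MeasurableSpace X] {a b : ℝ} (hab : a ≤ b)
    {f : X → ℝ → ℝ} (hm : ∀ s, Measurable fun x => f x s) (hc : ∀ x, Continuous (f x)) :
    ∃ est : X → ℝ, Measurable est ∧
      ∀ x, est x ∈ Set.Icc a b ∧ ∀ s ∈ Set.Icc a b, f x s ≤ f x (est x) := by
  set A : X → Set ℝ := fun x => {t ∈ Set.Icc a b | ∀ s ∈ Set.Icc a b, f x s ≤ f x t} with hA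
  have hne : ∀ x, (A x).Nonempty := fun x => by
    obtain ⟨t, ht, hmax⟩ := isCompact_Icc.exists_isMaxOn (Set.nonempty_Icc.2 hab)
      (hc x).continuousOn
    exact ⟨t, ht, fun s hs => hmax hs⟩
  have hbdd : ∀ x, BddBelow (A x) := fun x => ⟨a, fun t ht => ht.1.1⟩
  have hclosed : ∀ x, IsClosed (A x) := fun x => by
    have : A x = Set.Icc a b ∩ ⋂ s ∈ Set.Icc a b, {t | f x s ≤ f x t} := by
      ext t; simp [hA]
    rw [this]
    exact isClosed_Icc.inter (isClosed_biInter fun s _ => isClosed_le continuous_const (hc x))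
  have hinf : ∀ x, sInf (A x) ∈ A x := fun x => (hclosed x).csInf_mem (hne x) (hbdd x)
  refine ⟨fun x => sInf (A x), ?_, fun x => ⟨(hinf x).1, (hinf x).2⟩⟩
  have key : ∀ c ∈ Set.Icc a b, MeasurableSet {x | sInf (A x) ≤ c} := by
    intro c hcI
    have : Nonempty (Set.Icc a b) := ⟨⟨c, hcI⟩⟩
    have : Nonempty (Set.Icc a c) := ⟨⟨c, hcI.1, le_rfl⟩⟩
    have heq : {x | sInf (A x) ≤ c} = ⋂ (n : ℕ) (i : ℕ), ⋃ j : ℕ,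
        {x | f x (TopologicalSpace.denseSeq (Set.Icc a b) i) ≤
          f x (TopologicalSpace.denseSeq (Set.Icc a c) j) + 1 / (n + 1)} := by
      ext x
      simp only [Set.mem_ofPred_eq, Set.mem_iInter, Set.mem_iUnion]
      constructor
      · intro hx n i
        have hpos : (0 : ℝ) < 1 / (n + 1) := by positivity
        have hop : IsOpen {t : Set.Icc a c | f x (sInf (A x)) - 1 / (n + 1) < f x t} :=
          isOpen_lt continuous_const ((hc x).comp continuous_subtype_val)
        obtain ⟨j, hj⟩ := (TopologicalSpace.denseRange_denseSeq (Set.Icc a c)).exists_mem_open hop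
          ⟨⟨sInf (A x), (hinf x).1.1, hx⟩, by simp only [Set.mem_ofPred_eq]; linarith⟩
        refine ⟨j, ?_⟩
        have h1 := (hinf x).2 _ (TopologicalSpace.denseSeq (Set.Icc a b) i).2
        simp only [Set.mem_ofPred_eq] at hj
        linarith
      · intro hx
        obtain ⟨t, ht, hmax⟩ := isCompact_Icc.exists_isMaxOn (Set.nonempty_Icc.2 hcI.1)
          (hc x).continuousOn
        have h1 : ∀ i, f x (TopologicalSpace.denseSeq (Set.Icc a b) i) ≤ f x t := by
          intro i
          refine le_of_forall_pos_le_add fun δ hδ => ?_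
          obtain ⟨n, hn⟩ := exists_nat_one_div_lt hδ
          obtain ⟨j, hj⟩ := hx n i
          have h2 := hmax (TopologicalSpace.denseSeq (Set.Icc a c) j).2
          simp only [Set.mem_ofPred_eq] at h2
          linarith
        have h3 : ∀ s : Set.Icc a b, f x s ≤ f x t := fun s =>
          (TopologicalSpace.denseRange_denseSeq (Set.Icc a b)).induction_on
            (p := fun s : Set.Icc a b => f x s ≤ f x t) s
            (isClosed_le ((hc x).comp continuous_subtype_val) continuous_const) h1
        exact (csInf_le (hbdd x) ⟨⟨ht.1, ht.2.trans hcI.2⟩, fun s hs => h3 ⟨s, hs⟩⟩).trans ht.2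
    rw [heq]
    exact MeasurableSet.iInter fun n => MeasurableSet.iInter fun i => MeasurableSet.iUnion
      fun j => measurableSet_le (hm _) ((hm _).add_const _)
  refine measurable_of_Iic fun c => ?_
  rcases lt_or_ge c a with h | h
  · convert MeasurableSet.empty
    ext x
    simp only [Set.mem_preimage, Set.mem_Iic, Set.mem_empty_iff_false, iff_false, not_le]
    exact h.trans_le (hinf x).1.1
  · convert key (min c b) ⟨le_min h hab, min_le_right _ _⟩ using 1
    ext x
    simp only [Set.mem_preimage, Set.mem_Iic, Set.mem_ofPred_eq, le_min_iff]
    exact ⟨fun hx => ⟨hx, (hinf x).1.2⟩, fun hx => hx.1⟩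

end QPE

namespace QPE

/-! ### The rescaled model -/

noncomputable section

/-- The unnormalised Gaussian `exp(-u²/2)`. -/
def bell (u : ℝ) : ℝ := Real.exp (-u ^ 2 / 2)

theorem bell_pos (u : ℝ) : 0 < bell u := Real.exp_pos _

theorem bell_le_one (u : ℝ) : bell u ≤ 1 := by
  rw [bell, Real.exp_le_one_iff]; nlinarith [sq_nonneg u]

theorem bell_neg (u : ℝ) : bell (-u) = bell u := by simp [bell]

theorem bell_le_bell {u v : ℝ} (h : |u| ≤ |v|) : bell v ≤ bell u := by
  rw [bell, bell, Real.exp_le_exp]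
  have := sq_le_sq.2 h
  linarith

theorem contDiff_bell {n : WithTop ℕ∞} : ContDiff ℝ n bell := by
  unfold bell; fun_prop

theorem continuous_bell : Continuous bell := contDiff_bell.continuous (n := 0)

theorem hasDerivAt_bell (u : ℝ) : HasDerivAt bell (-u * bell u) u := by
  have h : HasDerivAt (fun u : ℝ => -u ^ 2 / 2) (-u) u := by
    have := ((hasDerivAt_pow 2 u).neg).div_const 2
    refine this.congr_deriv ?_
    simp; ring
  exact h.exp.congr_deriv (by rw [bell]; ring)

theorem hasDerivAt_bell_sub (y θ : ℝ) :
    HasDerivAt (fun θ => bell (y - θ)) ((y - θ) * bell (y - θ)) θ := by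
  have := (hasDerivAt_bell (y - θ)).comp θ ((hasDerivAt_id θ).const_sub y)
  exact this.congr_deriv (by ring)

theorem bell_div_le {β : ℝ} (hβ : 0 ≤ β) (u : ℝ) : bell u / (bell u + β) ≤ 1 / (1 + β) := by
  have h1 := bell_pos u
  have h2 := bell_le_one u
  rw [div_le_div_iff₀ (by linarith) (by linarith)]
  nlinarith

/-- The normalisation of the rescaled model on `[-A, B]`. -/
def mass (A B β θ : ℝ) : ℝ := (∫ y in (-A)..B, bell (y - θ)) + (A + B) * β

/-- The derivative of `mass` in the parameter. -/
def mass₁ (A B θ : ℝ) : ℝ := bell (A + θ) - bell (B - θ)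

/-- The second derivative of `mass` in the parameter. -/
def mass₂ (A B θ : ℝ) : ℝ := -((A + θ) * bell (A + θ)) - (B - θ) * bell (B - θ)

/-- The log-density of the rescaled model. -/
def crit (A B β θ y : ℝ) : ℝ := Real.log (bell (y - θ) + β) - Real.log (mass A B β θ)

/-- The score of the rescaled model. -/
def crit₁ (A B β θ y : ℝ) : ℝ :=
  (y - θ) * bell (y - θ) / (bell (y - θ) + β) - mass₁ A B θ / mass A B β θ

/-- The contribution of the numerator to the second derivative of the log-density. -/
def curv (β u : ℝ) : ℝ := ((u ^ 2 - 1) * bell u * β - bell u ^ 2) / (bell u + β) ^ 2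

/-- The second derivative of the log-density of the rescaled model. -/
def crit₂ (A B β θ y : ℝ) : ℝ :=
  curv β (y - θ) - (mass₂ A B θ / mass A B β θ - (mass₁ A B θ / mass A B β θ) ^ 2)

variable {A B β : ℝ}

theorem hasDerivAt_mass (θ : ℝ) : HasDerivAt (mass A B β) (mass₁ A B θ) θ := by
  have hsub : ∀ θ, ∫ y in (-A)..B, bell (y - θ) =
      (∫ u in (0 : ℝ)..(B - θ), bell u) - ∫ u in (0 : ℝ)..(-A - θ), bell u := fun θ => by
    rw [intervalIntegral.integral_comp_sub_right (fun u => bell u) θ,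
      intervalIntegral.integral_interval_sub_left] <;>
    exact continuous_bell.intervalIntegrable _ _
  have hF : ∀ x, HasDerivAt (fun x => ∫ u in (0 : ℝ)..x, bell u) (bell x) x := fun x =>
    intervalIntegral.integral_hasDerivAt_right (continuous_bell.intervalIntegrable _ _)
      (continuous_bell.stronglyMeasurableAtFilter _ _) continuous_bell.continuousAt
  have h1 := (hF (B - θ)).comp θ ((hasDerivAt_id θ).const_sub B)
  have h2 := (hF (-A - θ)).comp θ ((hasDerivAt_id θ).const_sub (-A))
  have h3 := (h1.sub h2).add_const ((A + B) * β)
  have hfun : mass A B β = fun θ => (∫ u in (0 : ℝ)..(B - θ), bell u) -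
      (∫ u in (0 : ℝ)..(-A - θ), bell u) + (A + B) * β := by
    funext θ; rw [mass, hsub]
  rw [hfun]
  refine h3.congr_deriv ?_
  rw [mass₁, ← bell_neg (A + θ), show -(A + θ) = -A - θ by ring]
  ring

theorem hasDerivAt_mass₁ (θ : ℝ) : HasDerivAt (mass₁ A B) (mass₂ A B θ) θ := by
  have h1 := (hasDerivAt_bell (A + θ)).comp θ ((hasDerivAt_id θ).const_add A)
  have h2 := hasDerivAt_bell_sub B θ
  exact (h1.sub h2).congr_deriv (by rw [mass₂]; ring)

theorem contDiff_mass₁ {n : WithTop ℕ∞} : ContDiff ℝ n (mass₁ A B) := by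
  have h := contDiff_bell (n := n)
  unfold mass₁; fun_prop

theorem contDiff_mass₂ {n : WithTop ℕ∞} : ContDiff ℝ n (mass₂ A B) := by
  have h := contDiff_bell (n := n)
  unfold mass₂; fun_prop

theorem contDiff_mass : ContDiff ℝ 1 (mass A B β) := by
  rw [contDiff_one_iff_deriv]
  refine ⟨fun θ => (hasDerivAt_mass θ).differentiableAt, ?_⟩
  have : deriv (mass A B β) = mass₁ A B := by funext θ; exact (hasDerivAt_mass θ).deriv
  rw [this]
  exact contDiff_mass₁.continuous (n := 0)

theorem mass_pos (hAB : -A < B) (hβ : 0 ≤ β) (θ : ℝ) : 0 < mass A B β θ := by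
  have h1 : 0 < ∫ y in (-A)..B, bell (y - θ) :=
    intervalIntegral.intervalIntegral_pos_of_pos
      ((continuous_bell.comp (continuous_id.sub continuous_const)).intervalIntegrable _ _)
      (fun y => bell_pos _) hAB
  have h2 : 0 ≤ (A + B) * β := mul_nonneg (by linarith) hβ
  rw [mass]; linarith

theorem bell_add_pos (hβ : 0 ≤ β) (u : ℝ) : 0 < bell u + β := by have := bell_pos u; linarith

theorem hasDerivAt_crit (hAB : -A < B) (hβ : 0 ≤ β) (θ y : ℝ) :
    HasDerivAt (fun θ => crit A B β θ y) (crit₁ A B β θ y) θ := by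
  have h1 := ((hasDerivAt_bell_sub y θ).add_const β).log (bell_add_pos hβ _).ne'
  have h2 := (hasDerivAt_mass (A := A) (B := B) (β := β) θ).log (mass_pos hAB hβ θ).ne'
  exact h1.sub h2

theorem hasDerivAt_crit₁ (hAB : -A < B) (hβ : 0 ≤ β) (θ y : ℝ) :
    HasDerivAt (fun θ => crit₁ A B β θ y) (crit₂ A B β θ y) θ := by
  have hw := hasDerivAt_bell_sub y θ
  have h1 := (((hasDerivAt_id θ).const_sub y).mul hw).div (hw.add_const β) (bell_add_pos hβ _).ne'
  have h2 := (hasDerivAt_mass₁ (A := A) (B := B) θ).div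
    (hasDerivAt_mass (A := A) (B := B) (β := β) θ) (mass_pos hAB hβ θ).ne'
  refine (h1.sub h2).congr_deriv ?_
  have hb := (bell_add_pos hβ (y - θ)).ne'
  have hm := (mass_pos hAB hβ θ).ne'
  rw [crit₂, curv]
  simp only [id, Pi.mul_apply]
  congr 1
  · congr 1; ring
  · field_simp

theorem continuous_crit (hAB : -A < B) (hβ : 0 ≤ β) :
    Continuous (Function.uncurry (crit A B β)) := by
  have h1 := continuous_bell
  have h2 := (contDiff_mass (A := A) (B := B) (β := β)).continuous
  have h3 : ∀ z : ℝ × ℝ, bell (z.2 - z.1) + β ≠ 0 := fun z => (bell_add_pos hβ _).ne'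
  have h4 : ∀ z : ℝ × ℝ, mass A B β z.1 ≠ 0 := fun z => (mass_pos hAB hβ _).ne'
  unfold Function.uncurry crit
  fun_prop (disch := assumption)

theorem continuous_crit₁ (hAB : -A < B) (hβ : 0 ≤ β) :
    Continuous (Function.uncurry (crit₁ A B β)) := by
  have h1 := continuous_bell
  have h2 := (contDiff_mass (A := A) (B := B) (β := β)).continuous
  have h2' := (contDiff_mass₁ (A := A) (B := B) (n := 0)).continuous
  have h3 : ∀ z : ℝ × ℝ, bell (z.2 - z.1) + β ≠ 0 := fun z => (bell_add_pos hβ _).ne'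
  have h4 : ∀ z : ℝ × ℝ, mass A B β z.1 ≠ 0 := fun z => (mass_pos hAB hβ _).ne'
  unfold Function.uncurry crit₁
  fun_prop (disch := assumption)

theorem contDiff_curv (hβ : 0 ≤ β) {n : WithTop ℕ∞} : ContDiff ℝ n (curv β) := by
  have h1 := contDiff_bell (n := n)
  exact ((((contDiff_id.pow 2).sub contDiff_const).mul h1).mul contDiff_const |>.sub
    (h1.pow 2)).div ((h1.add contDiff_const).pow 2)
    fun u => pow_ne_zero 2 (bell_add_pos hβ u).ne'

theorem contDiff_crit₂ (hAB : -A < B) (hβ : 0 ≤ β) :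
    ContDiff ℝ 1 (Function.uncurry (crit₂ A B β)) := by
  have h1 : ContDiff ℝ 1 fun z : ℝ × ℝ => curv β (z.2 - z.1) :=
    (contDiff_curv hβ).comp (contDiff_snd.sub contDiff_fst)
  have hm : ∀ θ, mass A B β θ ≠ 0 := fun θ => (mass_pos hAB hβ _).ne'
  have h2 : ContDiff ℝ 1 fun θ => mass₂ A B θ / mass A B β θ -
      (mass₁ A B θ / mass A B β θ) ^ 2 :=
    (contDiff_mass₂.div contDiff_mass hm).sub ((contDiff_mass₁.div contDiff_mass hm).pow 2)
  exact h1.sub (h2.comp contDiff_fst)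

theorem continuous_crit₂ (hAB : -A < B) (hβ : 0 ≤ β) :
    Continuous (Function.uncurry (crit₂ A B β)) :=
  (contDiff_crit₂ hAB hβ).continuous

theorem exists_crit_bound (hAB : -A < B) (hβ : 0 ≤ β) {Y : Set ℝ} (hY : IsCompact Y) :
    ∃ K, 0 < K ∧ ∀ y ∈ Y, ∀ θ ∈ Set.Icc (-A - 1) (B + 1), |crit A B β θ y| ≤ K ∧
      |crit₁ A B β θ y| ≤ K ∧ |crit₂ A B β θ y| ≤ K ∧ ∀ θ' ∈ Set.Icc (-A - 1) (B + 1),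
        |crit₂ A B β θ y - crit₂ A B β θ' y| ≤ K * |θ - θ'| := by
  have hS : IsCompact (Set.Icc (-A - 1) (B + 1) ×ˢ Y) := isCompact_Icc.prod hY
  have h2c := contDiff_crit₂ hAB hβ
  obtain ⟨K₀, hK₀⟩ := hS.exists_bound_of_continuousOn (continuous_crit hAB hβ).continuousOn
  obtain ⟨K₁, hK₁⟩ := hS.exists_bound_of_continuousOn (continuous_crit₁ hAB hβ).continuousOn
  obtain ⟨K₂, hK₂⟩ := hS.exists_bound_of_continuousOn h2c.continuous.continuousOn
  obtain ⟨K₃, hK₃⟩ := hS.exists_bound_of_continuousOn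
    (h2c.continuous_fderiv one_ne_zero).continuousOn
  obtain ⟨K, hK, hm0, hm1, hm2, hm3⟩ :
      ∃ K, 0 < K ∧ K₀ ≤ K ∧ K₁ ≤ K ∧ K₂ ≤ K ∧ K₃ ≤ K := by
    refine ⟨1 + |K₀| + |K₁| + |K₂| + |K₃|, by positivity, ?_⟩
    refine ⟨?_, ?_, ?_, ?_⟩ <;>
      linarith [le_abs_self K₀, le_abs_self K₁, le_abs_self K₂, le_abs_self K₃, abs_nonneg K₀,
        abs_nonneg K₁, abs_nonneg K₂, abs_nonneg K₃]
  refine ⟨K, hK, fun y hy θ hθ => ⟨(hK₀ (θ, y) ⟨hθ, hy⟩).trans hm0,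
    (hK₁ (θ, y) ⟨hθ, hy⟩).trans hm1, (hK₂ (θ, y) ⟨hθ, hy⟩).trans hm2, fun θ' hθ' => ?_⟩⟩
  have hder : ∀ t ∈ Set.Icc (-A - 1) (B + 1), HasDerivWithinAt (fun t => crit₂ A B β t y)
      (fderiv ℝ (Function.uncurry (crit₂ A B β)) (t, y) (1, 0))
      (Set.Icc (-A - 1) (B + 1)) t := by
    intro t _
    have h1 := (h2c.differentiable one_ne_zero (t, y)).hasFDerivAt
    have h2 : HasDerivAt (fun t : ℝ => ((t, y) : ℝ × ℝ)) (1, 0) t :=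
      (hasDerivAt_id t).prodMk (hasDerivAt_const t _)
    exact (h1.comp_hasDerivAt t h2).hasDerivWithinAt
  have hbd : ∀ t ∈ Set.Icc (-A - 1) (B + 1),
      ‖fderiv ℝ (Function.uncurry (crit₂ A B β)) (t, y) (1, 0)‖ ≤ K := by
    intro t ht
    refine (ContinuousLinearMap.le_opNorm _ _).trans ?_
    have h1 : ‖((1, 0) : ℝ × ℝ)‖ = 1 := by simp [Prod.norm_def]
    rw [h1, mul_one]
    exact (hK₃ (t, y) ⟨ht, hy⟩).trans hm3
  exact (convex_Icc (-A - 1) (B + 1)).norm_image_sub_le_of_norm_hasDerivWithin_le hder hbd hθ' hθ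

theorem continuous_uncurry_standardize {f : ℝ → ℝ → ℝ} (hf : Continuous (Function.uncurry f))
    (x₀ s : ℝ) : Continuous (Function.uncurry fun θ x => f θ ((x - x₀) / s)) :=
  hf.comp (by fun_prop : Continuous fun z : ℝ × ℝ => ((z.1, (z.2 - x₀) / s) : ℝ × ℝ))

/-- The rescaled log-density, evaluated at the standardised outcome `(x - x₀) / s`, is a regular
criterion for every law supported on a compact interval. -/
theorem exists_regularCriterion_crit (hAB : -A < B) (hβ : 0 ≤ β) {μ : Measure ℝ} {l r : ℝ}
    (hμ : ∀ᵐ x ∂μ, x ∈ Set.Icc l r) (x₀ s : ℝ) :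
    ∃ K, RegularCriterion μ (-A) B K (fun θ x => crit A B β θ ((x - x₀) / s))
      (fun θ x => crit₁ A B β θ ((x - x₀) / s)) (fun θ x => crit₂ A B β θ ((x - x₀) / s)) := by
  obtain ⟨K, hK, hb⟩ := exists_crit_bound hAB hβ
    (isCompact_Icc.image (f := fun x => (x - x₀) / s) (s := Set.Icc l r) (by fun_prop))
  refine ⟨K, ?_⟩
  constructor
  case pos => exact hK
  case cont => exact continuous_uncurry_standardize (continuous_crit hAB hβ) x₀ s
  case cont₁ => exact continuous_uncurry_standardize (continuous_crit₁ hAB hβ) x₀ s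
  case cont₂ => exact continuous_uncurry_standardize (continuous_crit₂ hAB hβ) x₀ s
  case deriv₁ => exact fun θ x => hasDerivAt_crit hAB hβ θ _
  case deriv₂ => exact fun θ x => hasDerivAt_crit₁ hAB hβ θ _
  case bound => exact hμ.mono fun x hx => hb _ (Set.mem_image_of_mem _ hx)

end

end QPE

namespace QPE

/-! ### Bounds on the rescaled population criterion -/

noncomputable section

/-- A rescaled estimation problem: outcomes in `[-A, B]` have a density proportional to
`exp(-y²/2) + β + r(y)`, where the contamination `r` is uniformly small. -/
structure Rescaled (A B R β ρ : ℝ) (r : ℝ → ℝ) : Prop where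
  two_le : 2 ≤ R
  le_A : R ≤ A
  A_le : A ≤ 5 * R
  le_B : R ≤ B
  B_le : B ≤ 5 * R
  add_eq : A + B = 6 * R
  β_nonneg : 0 ≤ β
  r_int : IntervalIntegrable r volume (-A) B
  r_nonneg : ∀ y ∈ Set.Icc (-A) B, 0 ≤ r y
  r_le : ∀ y ∈ Set.Icc (-A) B, r y ≤ ρ
  small : (1 + β) * R ^ 3 * (bell (R - 1) + ρ) ≤ 1 / 10 ^ 30

/-- The unnormalised density of the rescaled outcomes. -/
def dens (β : ℝ) (r : ℝ → ℝ) (y : ℝ) : ℝ := bell y + β + r y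

theorem integral_exp_neg_mul_sub_sq_le {c : ℝ} {a b : ℝ} (hab : a ≤ b) (θ : ℝ) (hc : 0 < c) :
    ∫ y in a..b, Real.exp (-c * (y - θ) ^ 2) ≤ √(π / c) := by
  rw [intervalIntegral.integral_comp_sub_right (fun u => Real.exp (-c * u ^ 2)) θ,
    intervalIntegral.integral_of_le (by linarith), ← integral_gaussian]
  exact setIntegral_le_integral (integrable_exp_neg_mul_sq hc)
    (ae_of_all _ fun u => (Real.exp_pos _).le)

theorem mul_le_integral_of_le {f : ℝ → ℝ} {a b p q m : ℝ} (hap : a ≤ p) (hpq : p ≤ q)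
    (hqb : q ≤ b) (hf : Continuous f) (h0 : ∀ y, 0 ≤ f y)
    (hm : ∀ y ∈ Set.Icc p q, m ≤ f y) : (q - p) * m ≤ ∫ y in a..b, f y := by
  have h1 : ∫ _ in p..q, m ≤ ∫ y in p..q, f y :=
    intervalIntegral.integral_mono_on hpq (by simp) (hf.intervalIntegrable _ _) hm
  have h2 : ∫ y in p..q, f y ≤ ∫ y in a..b, f y :=
    intervalIntegral.integral_mono_interval hap hpq hqb (ae_of_all _ h0)
      (hf.intervalIntegrable _ _)
  simp only [intervalIntegral.integral_const, smul_eq_mul] at h1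
  exact h1.trans h2

theorem continuous_bell_sub (θ : ℝ) : Continuous fun y => bell (y - θ) :=
  continuous_bell.comp (continuous_id.sub continuous_const)

theorem three_fifths_le_bell {u : ℝ} (hu : |u| ≤ 1) : 3 / 5 ≤ bell u := by
  refine le_trans ?_ (bell_le_bell (v := 1) (by simpa using hu))
  have h1 : Real.exp (1 / 2) ^ 2 = Real.exp 1 := by rw [← Real.exp_nat_mul]; norm_num
  have h2 := Real.exp_one_lt_d9
  have h3 : Real.exp (1 / 2) ≤ 5 / 3 := by nlinarith [Real.exp_pos (1 / 2)]
  rw [bell, show -(1 : ℝ) ^ 2 / 2 = -(1 / 2) by norm_num, Real.exp_neg,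
    le_inv_comm₀ (by norm_num) (Real.exp_pos _)]
  linarith

theorem integral_bell_sub_le {a b : ℝ} (hab : a ≤ b) (θ : ℝ) :
    ∫ y in a..b, bell (y - θ) ≤ 3 := by
  have h := integral_exp_neg_mul_sub_sq_le hab θ (c := 1 / 2) (by norm_num)
  have h2 : √(π / (1 / 2)) ≤ 3 := by
    rw [Real.sqrt_le_left (by norm_num)]; linarith [Real.pi_lt_d2]
  refine le_trans (le_of_eq ?_) (h.trans h2)
  congr 1; funext y; rw [bell]; congr 1; ring

theorem integral_sq_mul_bell_le {a b : ℝ} (hab : a ≤ b) (θ : ℝ) :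
    ∫ y in a..b, (y - θ) ^ 2 * bell (y - θ) ≤ 16 := by
  have h := integral_exp_neg_mul_sub_sq_le hab θ (c := 1 / 4) (by norm_num)
  have h2 : √(π / (1 / 4)) ≤ 4 := by
    rw [Real.sqrt_le_left (by norm_num)]; linarith [Real.pi_lt_d2]
  have h3 : ∫ y in a..b, (y - θ) ^ 2 * bell (y - θ) ≤
      ∫ y in a..b, 4 * Real.exp (-(1 / 4) * (y - θ) ^ 2) := by
    refine intervalIntegral.integral_mono_on hab ?_ ?_ fun y _ => ?_
    · exact (((continuous_id.sub continuous_const).pow 2).mul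
        (continuous_bell_sub θ)).intervalIntegrable _ _
    · exact Continuous.intervalIntegrable (by fun_prop) _ _
    · have h4 : (y - θ) ^ 2 ≤ 4 * Real.exp (1 / 4 * (y - θ) ^ 2) := by
        linarith [Real.add_one_le_exp (1 / 4 * (y - θ) ^ 2)]
      calc (y - θ) ^ 2 * bell (y - θ)
          ≤ 4 * Real.exp (1 / 4 * (y - θ) ^ 2) * bell (y - θ) := by
            gcongr; exact (bell_pos _).le
        _ = _ := by rw [bell, mul_assoc, ← Real.exp_add]; congr 2; ring
  rw [intervalIntegral.integral_const_mul] at h3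
  linarith

theorem integral_exp_sixteenth_le {a b : ℝ} (hab : a ≤ b) :
    ∫ y in a..b, Real.exp (-(1 / 16) * y ^ 2) ≤ 8 := by
  have h := integral_exp_neg_mul_sub_sq_le hab 0 (c := 1 / 16) (by norm_num)
  have h2 : √(π / (1 / 16)) ≤ 8 := by
    rw [Real.sqrt_le_left (by norm_num)]; linarith [Real.pi_lt_d2]
  simp only [sub_zero] at h
  exact h.trans h2

theorem abs_bell_sub_bell_le {y θ : ℝ} (hθ : |θ| ≤ 1) :
    |bell y - bell (y - θ)| * (1 + (y - θ) ^ 2) ≤ 48 * |θ| * Real.exp (-(1 / 16) * y ^ 2) := by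
  have hθ' := abs_le.1 hθ
  have hder : ∀ ξ ∈ Set.uIcc (y - θ) y, ‖-ξ * bell ξ‖ ≤ 4 / 3 * Real.exp (-(1 / 8) * y ^ 2) := by
    intro ξ hξ
    have hs : |y - ξ| ≤ 1 := by
      have := Set.abs_sub_right_of_mem_uIcc hξ
      rw [sub_sub_cancel] at this
      exact this.trans hθ
    have hs' := abs_le.1 hs
    have h1 : y ^ 2 ≤ 2 * ξ ^ 2 + 2 := by nlinarith [sq_nonneg (y - 2 * ξ)]
    have h2 : |ξ| ≤ Real.exp (1 / 4 * ξ ^ 2) := by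
      have := Real.add_one_le_exp (1 / 4 * ξ ^ 2)
      nlinarith [sq_abs ξ, sq_nonneg (|ξ| - 2)]
    have h3 : Real.exp (1 / 4) ≤ 4 / 3 := by
      have h4 : Real.exp (1 / 4) ^ 4 = Real.exp 1 := by rw [← Real.exp_nat_mul]; norm_num
      by_contra hcon
      push Not at hcon
      have h5 : (4 / 3 : ℝ) ^ 4 < Real.exp (1 / 4) ^ 4 :=
        pow_lt_pow_left₀ hcon (by norm_num) (by norm_num)
      rw [h4] at h5
      have := Real.exp_one_lt_d9
      norm_num at h5
      linarith
    rw [Real.norm_eq_abs, abs_mul, abs_neg, abs_of_pos (bell_pos ξ)]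
    calc |ξ| * bell ξ ≤ Real.exp (1 / 4 * ξ ^ 2) * bell ξ := by gcongr; exact (bell_pos _).le
      _ = Real.exp (-(1 / 4) * ξ ^ 2) := by rw [bell, ← Real.exp_add]; congr 1; ring
      _ ≤ Real.exp (1 / 4 + -(1 / 8) * y ^ 2) := by
        rw [Real.exp_le_exp]; linarith
      _ ≤ _ := by rw [Real.exp_add]; gcongr
  have hmv := (convex_uIcc (y - θ) y).norm_image_sub_le_of_norm_hasDerivWithin_le
    (f := bell) (fun ξ _ => (hasDerivAt_bell ξ).hasDerivWithinAt) hder Set.left_mem_uIcc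
    Set.right_mem_uIcc
  rw [sub_sub_cancel, Real.norm_eq_abs, Real.norm_eq_abs] at hmv
  have hquad : 1 + (y - θ) ^ 2 ≤ 32 * Real.exp (1 / 16 * y ^ 2) := by
    have h1 := Real.add_one_le_exp (1 / 16 * y ^ 2)
    nlinarith [sq_nonneg (y + θ)]
  calc |bell y - bell (y - θ)| * (1 + (y - θ) ^ 2)
      ≤ (4 / 3 * Real.exp (-(1 / 8) * y ^ 2) * |θ|) * (32 * Real.exp (1 / 16 * y ^ 2)) := by
        gcongr
    _ = 128 / 3 * |θ| * (Real.exp (-(1 / 8) * y ^ 2) * Real.exp (1 / 16 * y ^ 2)) := by ring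
    _ = 128 / 3 * |θ| * Real.exp (-(1 / 16) * y ^ 2) := by
        rw [← Real.exp_add]; congr 2; ring
    _ ≤ _ := by gcongr; norm_num

theorem abs_curv_le {β : ℝ} (hβ : 0 ≤ β) (u : ℝ) : |curv β u| ≤ (1 + u ^ 2) * (1 / (1 + β)) := by
  have hw := bell_pos u
  have hwβ := bell_add_pos hβ u
  have h1 : curv β u = bell u / (bell u + β) * (u ^ 2 * (β / (bell u + β)) - 1) := by
    rw [curv]; field_simp
    ring
  have h2 : 0 ≤ β / (bell u + β) := by positivity
  have h3 : β / (bell u + β) ≤ 1 := by rw [div_le_one hwβ]; linarith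
  have h4 : |u ^ 2 * (β / (bell u + β)) - 1| ≤ 1 + u ^ 2 := by
    rw [abs_le]; constructor <;> nlinarith [sq_nonneg u, mul_nonneg (sq_nonneg u) h2]
  have h5 := bell_div_le hβ u
  have h6 : 0 ≤ bell u / (bell u + β) := by positivity
  rw [h1, abs_mul, abs_of_nonneg h6, mul_comm]
  gcongr

theorem bell_add_mul_curv {β : ℝ} (hβ : 0 ≤ β) (u : ℝ) :
    (bell u + β) * curv β u = (u ^ 2 - 1) * bell u - u ^ 2 * bell u ^ 2 / (bell u + β) := by
  have hwβ := (bell_add_pos hβ u).ne'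
  rw [curv]; field_simp
  ring

theorem sq_mul_bell_sq_le {β : ℝ} (hβ : 0 ≤ β) (u : ℝ) :
    1 / (1 + β) * (u ^ 2 * bell u ^ 2) ≤ u ^ 2 * bell u ^ 2 / (bell u + β) := by
  have hwβ := bell_add_pos hβ u
  have h1 := bell_le_one u
  rw [one_div_mul_eq_div]
  exact div_le_div_of_nonneg_left (by positivity) hwβ (by linarith)

theorem integral_sq_sub_one_mul_bell (A B θ : ℝ) :
    ∫ y in (-A)..B, ((y - θ) ^ 2 - 1) * bell (y - θ) = mass₂ A B θ := by
  have hd : ∀ y ∈ Set.uIcc (-A) B, HasDerivAt (fun y => -((y - θ) * bell (y - θ)))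
      (((y - θ) ^ 2 - 1) * bell (y - θ)) y := by
    intro y _
    have h1 : HasDerivAt (fun y => y - θ) 1 y := (hasDerivAt_id y).sub_const θ
    have h2 := (hasDerivAt_bell (y - θ)).comp y h1
    refine ((h1.mul h2).neg).congr_deriv ?_
    simp only [Function.comp]; ring
  rw [intervalIntegral.integral_eq_sub_of_hasDerivAt hd]
  · rw [mass₂, ← bell_neg (A + θ), show -(A + θ) = -A - θ by ring]; ring
  · exact ((((continuous_id.sub continuous_const).pow 2).sub continuous_const).mul
      (continuous_bell_sub θ)).intervalIntegrable _ _

theorem integral_mul_bell (A B : ℝ) : ∫ y in (-A)..B, y * bell y = mass₁ A B 0 := by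
  have hd : ∀ y ∈ Set.uIcc (-A) B, HasDerivAt (fun y => -bell y) (y * bell y) y := by
    intro y _
    exact (hasDerivAt_bell y).neg.congr_deriv (by ring)
  rw [intervalIntegral.integral_eq_sub_of_hasDerivAt hd
    ((continuous_id.mul continuous_bell).intervalIntegrable _ _), bell_neg, mass₁]
  ring_nf

end

end QPE

namespace QPE

noncomputable section

theorem continuous_section {f : ℝ → ℝ → ℝ} (hf : Continuous (Function.uncurry f)) (θ : ℝ) :
    Continuous (f θ) :=
  hf.comp (Continuous.prodMk_right θ)

namespace Rescaled

variable {A B R β ρ : ℝ} {r : ℝ → ℝ}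

theorem neg_lt (H : Rescaled A B R β ρ r) : -A < B := by
  linarith [H.two_le, H.le_A, H.le_B]

theorem zero_mem (H : Rescaled A B R β ρ r) : (0 : ℝ) ∈ Set.Icc (-A) B := by
  constructor <;> linarith [H.two_le, H.le_A, H.le_B]

theorem ρ_nonneg (H : Rescaled A B R β ρ r) : 0 ≤ ρ :=
  (H.r_nonneg 0 H.zero_mem).trans (H.r_le 0 H.zero_mem)

theorem pow_mul_ρ_le (H : Rescaled A B R β ρ r) : R ^ 3 * ρ * (1 + β) ≤ 1 / 10 ^ 30 := by
  have h1 := H.small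
  have h2 := H.β_nonneg
  have h3 := H.two_le
  have h4 : 0 ≤ (1 + β) * R ^ 3 * bell (R - 1) := by have := bell_pos (R - 1); positivity
  nlinarith

theorem mul_bell_le (H : Rescaled A B R β ρ r) :
    R * bell (R - 1) * (1 + β) ≤ 1 / 10 ^ 30 := by
  have h1 := H.small
  have h2 := H.β_nonneg
  have h3 := H.two_le
  have h5 := H.ρ_nonneg
  have hb := bell_pos (R - 1)
  have h4 : 0 ≤ (1 + β) * R ^ 3 * ρ := by positivity
  have h6 : R ≤ R ^ 3 := le_self_pow₀ (by linarith) (by norm_num)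
  have h7 : R * (bell (R - 1) * (1 + β)) ≤ R ^ 3 * (bell (R - 1) * (1 + β)) := by gcongr
  nlinarith

theorem pow_mul_ρ_le' (H : Rescaled A B R β ρ r) : R ^ 3 * ρ ≤ 1 / 10 ^ 30 := by
  have h1 := H.pow_mul_ρ_le
  have h2 : 0 ≤ R ^ 3 * ρ := by have := H.two_le; have := H.ρ_nonneg; positivity
  nlinarith [H.β_nonneg]

theorem abs_le_of_mem (H : Rescaled A B R β ρ r) {y : ℝ} (hy : y ∈ Set.Icc (-A) B) :
    |y| ≤ 5 * R := abs_le.2 ⟨by linarith [hy.1, H.A_le], by linarith [hy.2, H.B_le]⟩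

theorem integrable_dens_mul (H : Rescaled A B R β ρ r) {f : ℝ → ℝ} (hf : Continuous f) :
    IntervalIntegrable (fun y => dens β r y * f y) volume (-A) B := by
  have h1 : IntervalIntegrable (dens β r) volume (-A) B :=
    ((continuous_bell.add continuous_const).intervalIntegrable _ _).add H.r_int
  exact h1.mul_continuousOn hf.continuousOn

theorem integrable_r_mul (H : Rescaled A B R β ρ r) {f : ℝ → ℝ} (hf : Continuous f) :
    IntervalIntegrable (fun y => r y * f y) volume (-A) B :=
  H.r_int.mul_continuousOn hf.continuousOn

theorem integral_dens_mul (H : Rescaled A B R β ρ r) {f : ℝ → ℝ} (hf : Continuous f) :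
    ∫ y in (-A)..B, dens β r y * f y =
      (∫ y in (-A)..B, (bell y + β) * f y) + ∫ y in (-A)..B, r y * f y := by
  rw [← intervalIntegral.integral_add _ (H.integrable_r_mul hf)]
  · congr 1; funext y; rw [dens]; ring
  · exact ((continuous_bell.add continuous_const).mul hf).intervalIntegrable _ _

theorem abs_integral_r_mul_le (H : Rescaled A B R β ρ r) {f : ℝ → ℝ} {K : ℝ}
    (hK : ∀ y ∈ Set.Icc (-A) B, |f y| ≤ K) :
    |∫ y in (-A)..B, r y * f y| ≤ 6 * R * ρ * K := by
  have h := intervalIntegral.norm_integral_le_of_norm_le_const (a := -A) (b := B)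
    (f := fun y => r y * f y) (C := ρ * K) (fun y hy => ?_)
  · rw [Real.norm_eq_abs, abs_of_pos (show 0 < B - -A by linarith [H.neg_lt])] at h
    have : B - -A = 6 * R := by linarith [H.add_eq]
    rw [this] at h
    linarith
  · rw [Set.uIoc_of_le H.neg_lt.le] at hy
    have hy' := Set.Ioc_subset_Icc_self hy
    rw [Real.norm_eq_abs, abs_mul, abs_of_nonneg (H.r_nonneg y hy')]
    exact mul_le_mul (H.r_le y hy') (hK y hy') (abs_nonneg _) H.ρ_nonneg

theorem mass_eq_integral (_H : Rescaled A B R β ρ r) (θ : ℝ) :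
    ∫ y in (-A)..B, (bell (y - θ) + β) = mass A B β θ := by
  rw [intervalIntegral.integral_add ((continuous_bell_sub θ).intervalIntegrable _ _) (by simp),
    mass]
  simp; left; ring

theorem integral_dens_bounds (H : Rescaled A B R β ρ r) :
    mass A B β 0 ≤ ∫ y in (-A)..B, dens β r y ∧
      ∫ y in (-A)..B, dens β r y ≤ mass A B β 0 + 1 := by
  have h := H.integral_dens_mul (f := fun _ => 1) continuous_const
  have h1 := H.mass_eq_integral 0
  simp only [sub_zero] at h1
  simp only [mul_one] at h
  rw [h, h1]
  have h2 : 0 ≤ ∫ y in (-A)..B, r y :=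
    intervalIntegral.integral_nonneg H.neg_lt.le fun y hy => H.r_nonneg y hy
  have h3 := H.abs_integral_r_mul_le (f := fun _ => 1) (K := 1) (by simp)
  simp only [mul_one] at h3
  have h4 := (abs_le.1 h3).2
  have h5 := H.pow_mul_ρ_le'
  have h6 : R ≤ R ^ 3 := le_self_pow₀ (by linarith [H.two_le]) (by norm_num)
  have h7 := mul_le_mul_of_nonneg_right h6 H.ρ_nonneg
  constructor
  · linarith
  · norm_num at h5; linarith

theorem mass_lower (H : Rescaled A B R β ρ r) {θ : ℝ} (hθ : |θ| ≤ 1) :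
    1 + 6 * R * β ≤ mass A B β θ := by
  have hθ' := abs_le.1 hθ
  have h := mul_le_integral_of_le (f := fun y => bell (y - θ)) (a := -A) (b := B) (p := θ - 1)
    (q := θ + 1) (m := 3 / 5) (by linarith [H.two_le, H.le_A]) (by linarith)
    (by linarith [H.two_le, H.le_B]) (continuous_bell_sub θ) (fun y => (bell_pos _).le)
    (fun y hy => three_fifths_le_bell (abs_le.2 ⟨by linarith [hy.1], by linarith [hy.2]⟩))
  rw [mass, H.add_eq]
  linarith

theorem mass_lower_of_mem (H : Rescaled A B R β ρ r) {θ : ℝ} (hθ : θ ∈ Set.Icc (-A) B) :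
    1 / 2 + 6 * R * β ≤ mass A B β θ := by
  have h : 3 / 5 ≤ ∫ y in (-A)..B, bell (y - θ) := by
    rcases le_total θ 0 with h0 | h0
    · have := mul_le_integral_of_le (f := fun y => bell (y - θ)) (a := -A) (b := B) (p := θ)
        (q := θ + 1) (m := 3 / 5) hθ.1 (by linarith)
        (by linarith [H.two_le, H.le_B]) (continuous_bell_sub θ) (fun y => (bell_pos _).le)
        (fun y hy => three_fifths_le_bell (abs_le.2 ⟨by linarith [hy.1], by linarith [hy.2]⟩))
      linarith
    · have := mul_le_integral_of_le (f := fun y => bell (y - θ)) (a := -A) (b := B) (p := θ - 1)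
        (q := θ) (m := 3 / 5) (by linarith [H.two_le, H.le_A]) (by linarith)
        hθ.2 (continuous_bell_sub θ) (fun y => (bell_pos _).le)
        (fun y hy => three_fifths_le_bell (abs_le.2 ⟨by linarith [hy.1], by linarith [hy.2]⟩))
      linarith
  rw [mass, H.add_eq]
  linarith

theorem mass_upper (H : Rescaled A B R β ρ r) (θ : ℝ) : mass A B β θ ≤ 3 + 6 * R * β := by
  rw [mass, H.add_eq]
  linarith [integral_bell_sub_le H.neg_lt.le θ]

theorem bell_edges (H : Rescaled A B R β ρ r) {θ : ℝ} (hθ : |θ| ≤ 1) :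
    bell (A + θ) ≤ bell (R - 1) ∧ bell (B - θ) ≤ bell (R - 1) := by
  have hθ' := abs_le.1 hθ
  have := H.two_le; have := H.le_A; have := H.le_B
  constructor <;> apply bell_le_bell <;> rw [abs_of_nonneg (by linarith), abs_of_nonneg (by linarith)]
    <;> linarith

theorem abs_mass₁_le (H : Rescaled A B R β ρ r) {θ : ℝ} (hθ : |θ| ≤ 1) :
    |mass₁ A B θ| ≤ bell (R - 1) := by
  obtain ⟨h1, h2⟩ := H.bell_edges hθ
  rw [mass₁, abs_le]
  constructor <;> linarith [bell_pos (A + θ), bell_pos (B - θ)]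

theorem abs_mass₂_le (H : Rescaled A B R β ρ r) {θ : ℝ} (hθ : |θ| ≤ 1) :
    |mass₂ A B θ| ≤ 6 * R * bell (R - 1) := by
  obtain ⟨h1, h2⟩ := H.bell_edges hθ
  have hθ' := abs_le.1 hθ
  have hA : 0 ≤ A + θ := by linarith [H.two_le, H.le_A]
  have hB : 0 ≤ B - θ := by linarith [H.two_le, H.le_B]
  have h3 : (A + θ) * bell (A + θ) ≤ (A + θ) * bell (R - 1) := by gcongr
  have h4 : (B - θ) * bell (B - θ) ≤ (B - θ) * bell (R - 1) := by gcongr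
  have h5 : 0 ≤ (A + θ) * bell (A + θ) := mul_nonneg hA (bell_pos _).le
  have h6 : 0 ≤ (B - θ) * bell (B - θ) := mul_nonneg hB (bell_pos _).le
  have h7 : (A + θ) * bell (R - 1) + (B - θ) * bell (R - 1) = 6 * R * bell (R - 1) := by
    rw [← H.add_eq]; ring
  rw [mass₂, abs_le]
  constructor <;> linarith

theorem integral_dens_le_mul_mass (H : Rescaled A B R β ρ r) {θ : ℝ} (hθ : |θ| ≤ 1) :
    ∫ y in (-A)..B, dens β r y ≤ 4 * mass A B β θ := by
  have h1 := H.integral_dens_bounds.2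
  have h2 := H.mass_upper 0
  have h3 := H.mass_lower hθ
  have h4 : 0 ≤ R * β := mul_nonneg (by linarith [H.two_le]) H.β_nonneg
  linarith

theorem integral_sq_mul_bell_sq_ge (H : Rescaled A B R β ρ r) {θ : ℝ} (hθ : |θ| ≤ 1 / 2) :
    1 / 25 ≤ ∫ y in (-A)..B, (y - θ) ^ 2 * bell (y - θ) ^ 2 := by
  have hθ' := abs_le.1 hθ
  have h := mul_le_integral_of_le (f := fun y => (y - θ) ^ 2 * bell (y - θ) ^ 2) (a := -A) (b := B)
    (p := θ + 1 / 2) (q := θ + 1) (m := 2 / 25) (by linarith [H.two_le, H.le_A]) (by linarith)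
    (by linarith [H.two_le, H.le_B])
    (((continuous_id.sub continuous_const).pow 2).mul ((continuous_bell_sub θ).pow 2))
    (fun y => by positivity) (fun y hy => ?_)
  · linarith
  · have h1 : 1 / 2 ≤ y - θ := by linarith [hy.1]
    have h2 : 3 / 5 ≤ bell (y - θ) :=
      three_fifths_le_bell (abs_le.2 ⟨by linarith, by linarith [hy.2]⟩)
    have h3 : (1 / 2 : ℝ) ^ 2 ≤ (y - θ) ^ 2 := by gcongr
    have h4 : (3 / 5 : ℝ) ^ 2 ≤ bell (y - θ) ^ 2 := by gcongr
    calc (2 / 25 : ℝ) ≤ (1 / 2) ^ 2 * (3 / 5) ^ 2 := by norm_num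
      _ ≤ _ := by gcongr

theorem one_add_sq_le (H : Rescaled A B R β ρ r) {θ y : ℝ} (hθ : |θ| ≤ 1)
    (hy : y ∈ Set.Icc (-A) B) : 1 + (y - θ) ^ 2 ≤ 37 * R ^ 2 := by
  have h1 : |y - θ| ≤ 6 * R := by
    have := abs_sub y θ
    linarith [H.abs_le_of_mem hy, H.two_le]
  have h2 : (y - θ) ^ 2 ≤ (6 * R) ^ 2 := by rw [← sq_abs]; gcongr
  nlinarith [H.two_le]

theorem continuous_crit_right (H : Rescaled A B R β ρ r) (θ : ℝ) : Continuous (crit A B β θ) :=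
  continuous_section (continuous_crit H.neg_lt H.β_nonneg) θ

theorem continuous_crit₁_right (H : Rescaled A B R β ρ r) (θ : ℝ) :
    Continuous (crit₁ A B β θ) :=
  continuous_section (continuous_crit₁ H.neg_lt H.β_nonneg) θ

theorem continuous_curv_sub (H : Rescaled A B R β ρ r) (θ : ℝ) :
    Continuous fun y => curv β (y - θ) := by
  have h : Continuous (curv β) := (contDiff_curv H.β_nonneg (n := 0)).continuous
  exact h.comp (continuous_id.sub continuous_const)

theorem integral_dens_mul_curv_le (H : Rescaled A B R β ρ r) {θ : ℝ} (hθ : |θ| ≤ 1 / 2) :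
    ∫ y in (-A)..B, dens β r y * curv β (y - θ) ≤
      mass₂ A B θ + 1 / (1 + β) * (-(1 / 25) + 384 * |θ| + 222 * R ^ 3 * ρ) := by
  have hβ := H.β_nonneg
  have hθ1 : |θ| ≤ 1 := by linarith
  have hab := H.neg_lt.le
  have c1 : Continuous fun y => ((y - θ) ^ 2 - 1) * bell (y - θ) :=
    (((continuous_id.sub continuous_const).pow 2).sub continuous_const).mul (continuous_bell_sub θ)
  have c2 : Continuous fun y => (y - θ) ^ 2 * bell (y - θ) ^ 2 :=
    ((continuous_id.sub continuous_const).pow 2).mul ((continuous_bell_sub θ).pow 2)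
  have c3 : Continuous fun y : ℝ => 48 * |θ| * Real.exp (-(1 / 16) * y ^ 2) := by fun_prop
  have c4 : Continuous fun y => -((y - θ) ^ 2 * bell (y - θ) ^ 2) +
      48 * |θ| * Real.exp (-(1 / 16) * y ^ 2) := c2.neg.add c3
  have c5 : Continuous fun y => 1 / (1 + β) * (-((y - θ) ^ 2 * bell (y - θ) ^ 2) +
      48 * |θ| * Real.exp (-(1 / 16) * y ^ 2) + ρ * (37 * R ^ 2)) :=
    continuous_const.mul (c4.add continuous_const)
  have hle : ∫ y in (-A)..B, dens β r y * curv β (y - θ) ≤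
      ∫ y in (-A)..B, (((y - θ) ^ 2 - 1) * bell (y - θ) +
        1 / (1 + β) * (-((y - θ) ^ 2 * bell (y - θ) ^ 2) +
          48 * |θ| * Real.exp (-(1 / 16) * y ^ 2) + ρ * (37 * R ^ 2))) := by
    refine intervalIntegral.integral_mono_on hab (H.integrable_dens_mul (H.continuous_curv_sub θ))
      ((c1.add c5).intervalIntegrable _ _) fun y hy => ?_
    have hk : 0 < 1 / (1 + β) := by positivity
    have e1 := bell_add_mul_curv hβ (y - θ)
    have e2 := sq_mul_bell_sq_le hβ (y - θ)
    have e3 : (bell y - bell (y - θ)) * curv β (y - θ) ≤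
        1 / (1 + β) * (48 * |θ| * Real.exp (-(1 / 16) * y ^ 2)) := by
      refine (le_abs_self _).trans ?_
      rw [abs_mul]
      calc |bell y - bell (y - θ)| * |curv β (y - θ)|
          ≤ |bell y - bell (y - θ)| * ((1 + (y - θ) ^ 2) * (1 / (1 + β))) := by
            gcongr; exact abs_curv_le hβ _
        _ = 1 / (1 + β) * (|bell y - bell (y - θ)| * (1 + (y - θ) ^ 2)) := by ring
        _ ≤ _ := mul_le_mul_of_nonneg_left (abs_bell_sub_bell_le hθ1) hk.le
    have e4 : r y * curv β (y - θ) ≤ 1 / (1 + β) * (ρ * (37 * R ^ 2)) := by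
      calc r y * curv β (y - θ) ≤ r y * ((1 + (y - θ) ^ 2) * (1 / (1 + β))) := by
            gcongr
            · exact H.r_nonneg y hy
            · exact (le_abs_self _).trans (abs_curv_le hβ _)
        _ ≤ ρ * ((37 * R ^ 2) * (1 / (1 + β))) := by
            have := H.r_le y hy; have := H.one_add_sq_le hθ1 hy; have := H.ρ_nonneg
            gcongr
        _ = _ := by ring
    have e5 : dens β r y * curv β (y - θ) = (bell (y - θ) + β) * curv β (y - θ) +
        (bell y - bell (y - θ)) * curv β (y - θ) + r y * curv β (y - θ) := by
      rw [dens]; ring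
    rw [e5, e1]
    linarith
  refine hle.trans ?_
  rw [intervalIntegral.integral_add (c1.intervalIntegrable _ _)
    (c5.intervalIntegrable _ _),
    integral_sq_sub_one_mul_bell, intervalIntegral.integral_const_mul,
    intervalIntegral.integral_add (c4.intervalIntegrable _ _) (by simp),
    intervalIntegral.integral_add (c2.fun_neg.intervalIntegrable _ _) (c3.intervalIntegrable _ _),
    intervalIntegral.integral_neg, intervalIntegral.integral_const_mul]
  have f1 := H.integral_sq_mul_bell_sq_ge hθ
  have f2 := integral_exp_sixteenth_le hab
  have f3 : 48 * |θ| * ∫ y in (-A)..B, Real.exp (-(1 / 16) * y ^ 2) ≤ 48 * |θ| * 8 := by gcongr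
  have hk : 0 < 1 / (1 + β) := by positivity
  refine add_le_add le_rfl (mul_le_mul_of_nonneg_left ?_ hk.le)
  simp only [intervalIntegral.integral_const, smul_eq_mul]
  have f4 : (B - -A) * (ρ * (37 * R ^ 2)) = 222 * R ^ 3 * ρ := by
    rw [show B - -A = 6 * R by linarith [H.add_eq]]; ring
  rw [f4]
  linarith

/-- Near the target the population criterion is uniformly concave. -/
theorem integral_dens_mul_crit₂_le (H : Rescaled A B R β ρ r) {θ : ℝ}
    (hθ : |θ| ≤ 1 / 40000) :
    ∫ y in (-A)..B, dens β r y * crit₂ A B β θ y ≤ -(1 / 50 * (1 / (1 + β))) := by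
  have hβ := H.β_nonneg
  have hθ1 : |θ| ≤ 1 := by linarith
  set T := ∫ y in (-A)..B, dens β r y with hT
  set N := mass A B β θ with hN
  have hNpos : 0 < N := mass_pos H.neg_lt hβ θ
  have hN1 : 1 ≤ N := by
    have := H.mass_lower hθ1
    have h4 : 0 ≤ R * β := mul_nonneg (by linarith [H.two_le]) H.β_nonneg
    linarith
  have hT4 : T ≤ 4 * N := H.integral_dens_le_mul_mass hθ1
  have hTnn : 0 ≤ T := (mass_pos H.neg_lt hβ 0).le.trans H.integral_dens_bounds.1
  set κ := mass₂ A B θ / N - (mass₁ A B θ / N) ^ 2 with hκ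
  have hsplit : ∫ y in (-A)..B, dens β r y * crit₂ A B β θ y =
      (∫ y in (-A)..B, dens β r y * curv β (y - θ)) - T * κ := by
    have : ∀ y, dens β r y * crit₂ A B β θ y = dens β r y * curv β (y - θ) - dens β r y * κ :=
      fun y => by rw [crit₂, mul_sub]
    simp_rw [this]
    rw [intervalIntegral.integral_sub (H.integrable_dens_mul (H.continuous_curv_sub θ))
      (H.integrable_dens_mul continuous_const), intervalIntegral.integral_mul_const]
  set τ := bell (R - 1) with hτ
  have hτpos : 0 < τ := bell_pos _
  have hR := H.two_le
  have m1 := H.abs_mass₁_le hθ1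
  have m2 := H.abs_mass₂_le hθ1
  rw [← hτ] at m1 m2
  have hτ1 : τ ≤ 1 := bell_le_one _
  have hκ' : |T * κ| ≤ 4 * (6 * R * τ + τ) := by
    have h1 : |κ| ≤ (6 * R * τ + τ) / N := by
      calc |κ| ≤ |mass₂ A B θ / N| + |(mass₁ A B θ / N) ^ 2| := abs_sub _ _
        _ = |mass₂ A B θ| / N + |mass₁ A B θ| ^ 2 / N ^ 2 := by
          rw [abs_div, abs_of_pos hNpos, abs_pow, abs_div, abs_of_pos hNpos, div_pow]
        _ ≤ 6 * R * τ / N + τ / N := by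
          gcongr
          · calc |mass₁ A B θ| ^ 2 ≤ τ ^ 2 := by gcongr
              _ ≤ τ := by nlinarith
          · exact le_self_pow₀ hN1 (by norm_num)
        _ = _ := by ring
    rw [abs_mul, abs_of_nonneg hTnn]
    calc T * |κ| ≤ 4 * N * ((6 * R * τ + τ) / N) := by gcongr
      _ = _ := by field_simp
  have hcurv := H.integral_dens_mul_curv_le (θ := θ) (by linarith)
  have hk : 0 < 1 / (1 + β) := by positivity
  have hkβ : 1 / (1 + β) * (1 + β) = 1 := by field_simp
  have hτk : R * τ ≤ 1 / 10 ^ 30 * (1 / (1 + β)) := by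
    have := mul_le_mul_of_nonneg_right H.mul_bell_le hk.le
    calc R * τ = R * τ * (1 + β) * (1 / (1 + β)) := by rw [mul_assoc, mul_comm (1 + β), hkβ, mul_one]
      _ ≤ _ := this
  have hρ := H.pow_mul_ρ_le'
  have h1 := (abs_le.1 hκ').1
  have h2 := (abs_le.1 m2).2
  rw [hsplit]
  have hτR : τ ≤ R * τ := by nlinarith
  have h3 : 1 / (1 + β) * (-(1 / 25) + 384 * |θ| + 222 * R ^ 3 * ρ) ≤
      1 / (1 + β) * (-(3 / 100)) := by
    gcongr
    norm_num at hρ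
    linarith
  have h4 := hcurv.trans (add_le_add le_rfl h3)
  have h5 : 1 / 10 ^ 30 * (1 / (1 + β)) ≤ 1 / 10 ^ 6 * (1 / (1 + β)) :=
    mul_le_mul_of_nonneg_right (by norm_num) hk.le
  generalize 1 / (1 + β) = k at *
  linarith

theorem abs_integral_dens_mul_crit₁_zero_le (H : Rescaled A B R β ρ r) :
    |∫ y in (-A)..B, dens β r y * crit₁ A B β 0 y| ≤ 36 * R ^ 2 * ρ := by
  have hβ := H.β_nonneg
  have hN : 1 ≤ mass A B β 0 := by
    have := H.mass_lower (θ := 0) (by simp)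
    have h4 : 0 ≤ R * β := mul_nonneg (by linarith [H.two_le]) H.β_nonneg
    linarith
  have hN0 : mass A B β 0 ≠ 0 := by linarith
  have hzero : ∫ y in (-A)..B, (bell y + β) * crit₁ A B β 0 y = 0 := by
    have : ∀ y, (bell y + β) * crit₁ A B β 0 y =
        y * bell y - (bell y + β) * (mass₁ A B 0 / mass A B β 0) := fun y => by
      have := (bell_add_pos hβ y).ne'
      rw [crit₁, sub_zero, mul_sub, mul_div_cancel₀ _ this]
    simp_rw [this]
    have hm := H.mass_eq_integral 0
    simp only [sub_zero] at hm
    have c1 : Continuous fun y => y * bell y := continuous_id.mul continuous_bell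
    have c2 : Continuous fun y => (bell y + β) * (mass₁ A B 0 / mass A B β 0) :=
      (continuous_bell.add continuous_const).mul continuous_const
    rw [intervalIntegral.integral_sub (c1.intervalIntegrable _ _) (c2.intervalIntegrable _ _),
      intervalIntegral.integral_mul_const, hm, integral_mul_bell, mul_div_cancel₀ _ hN0, sub_self]
  rw [H.integral_dens_mul (H.continuous_crit₁_right 0), hzero, zero_add]
  refine (H.abs_integral_r_mul_le (K := 6 * R) fun y hy => ?_).trans (le_of_eq (by ring))
  have h1 : |y * bell y / (bell y + β)| ≤ 5 * R := by
    rw [mul_div_assoc, abs_mul, abs_of_nonneg (div_nonneg (bell_pos y).le (bell_add_pos hβ y).le)]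
    calc |y| * (bell y / (bell y + β)) ≤ 5 * R * 1 := by
          have h3 : bell y / (bell y + β) ≤ 1 := by
            rw [div_le_one (bell_add_pos hβ y)]; linarith
          have h4 := H.two_le
          exact mul_le_mul (H.abs_le_of_mem hy) h3
            (div_nonneg (bell_pos y).le (bell_add_pos hβ y).le) (by linarith)
      _ = _ := mul_one _
  have h2 : |mass₁ A B 0 / mass A B β 0| ≤ 1 := by
    rw [abs_div, abs_of_pos (by linarith : 0 < mass A B β 0), div_le_one (by linarith)]
    exact (H.abs_mass₁_le (by simp)).trans ((bell_le_one _).trans hN)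
  rw [crit₁, sub_zero]
  refine (abs_sub _ _).trans ?_
  linarith [H.two_le]

theorem integral_dens_mul_crit₁_sq_le (H : Rescaled A B R β ρ r) {θ : ℝ}
    (hθ : |θ| ≤ 1 / 40000) :
    ∫ y in (-A)..B, dens β r y * crit₁ A B β θ y ^ 2 ≤ 40 * (1 / (1 + β)) := by
  have hβ := H.β_nonneg
  have hθ1 : |θ| ≤ 1 := by linarith
  have hab := H.neg_lt.le
  set T := ∫ y in (-A)..B, dens β r y with hT
  set N := mass A B β θ with hN
  have hNpos : 0 < N := mass_pos H.neg_lt hβ θ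
  have hN1 : 1 ≤ N := by
    have := H.mass_lower hθ1
    have h4 : 0 ≤ R * β := mul_nonneg (by linarith [H.two_le]) H.β_nonneg
    linarith
  have hT4 : T ≤ 4 * N := H.integral_dens_le_mul_mass hθ1
  have hk : 0 < 1 / (1 + β) := by positivity
  have hk1 : 1 / (1 + β) ≤ 1 := by rw [div_le_one (by linarith)]; linarith
  set κ := mass₁ A B θ / N with hκ
  have c1 : Continuous fun y => (y - θ) ^ 2 * bell (y - θ) :=
    ((continuous_id.sub continuous_const).pow 2).mul (continuous_bell_sub θ)
  have c3 : Continuous fun y : ℝ => 48 * |θ| * Real.exp (-(1 / 16) * y ^ 2) := by fun_prop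
  have c2 : Continuous fun y => (y - θ) ^ 2 * bell (y - θ) +
      48 * |θ| * Real.exp (-(1 / 16) * y ^ 2) := c1.add c3
  have c4 : IntervalIntegrable (fun y => 2 * κ ^ 2 * dens β r y) volume (-A) B := by
    have := H.integrable_dens_mul (f := fun _ => 2 * κ ^ 2) continuous_const
    simpa only [mul_comm] using this
  have c5 : IntervalIntegrable (fun y => 2 * (1 / (1 + β)) * ((y - θ) ^ 2 * bell (y - θ) +
      48 * |θ| * Real.exp (-(1 / 16) * y ^ 2) + ρ * (37 * R ^ 2))) volume (-A) B :=
    (continuous_const.mul (c2.add continuous_const)).intervalIntegrable _ _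
  have hle : ∫ y in (-A)..B, dens β r y * crit₁ A B β θ y ^ 2 ≤
      ∫ y in (-A)..B, (2 * (1 / (1 + β)) * ((y - θ) ^ 2 * bell (y - θ) +
          48 * |θ| * Real.exp (-(1 / 16) * y ^ 2) + ρ * (37 * R ^ 2)) +
        2 * κ ^ 2 * dens β r y) := by
    refine intervalIntegral.integral_mono_on hab
      (H.integrable_dens_mul ((H.continuous_crit₁_right θ).pow 2)) (c5.add c4) fun y hy => ?_
    set u := y - θ with hu
    have hw := bell_pos u
    have hwβ := bell_add_pos hβ u
    set g := bell u / (bell u + β) with hg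
    have hg0 : 0 ≤ g := by positivity
    have hgk : g ≤ 1 / (1 + β) := bell_div_le hβ u
    have hg2 : g ^ 2 ≤ 1 / (1 + β) := by nlinarith
    have hd0 : 0 ≤ dens β r y := by
      rw [dens]; linarith [bell_pos y, H.r_nonneg y hy]
    have e0 : crit₁ A B β θ y ^ 2 ≤ 2 * (u * g) ^ 2 + 2 * κ ^ 2 := by
      rw [crit₁, ← hu, ← hN, ← hκ, mul_div_assoc, ← hg]
      nlinarith [sq_nonneg (u * g + κ)]
    have e1 : (bell u + β) * (u * g) ^ 2 ≤ 1 / (1 + β) * (u ^ 2 * bell u) := by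
      have : (bell u + β) * (u * g) ^ 2 = g * (u ^ 2 * bell u) := by
        rw [hg]; field_simp
      rw [this]; gcongr
    have e3 : (bell y - bell u) * (u * g) ^ 2 ≤
        1 / (1 + β) * (48 * |θ| * Real.exp (-(1 / 16) * y ^ 2)) := by
      calc (bell y - bell u) * (u * g) ^ 2 ≤ |bell y - bell u| * ((1 + u ^ 2) * (1 / (1 + β))) := by
            rw [mul_pow]
            gcongr
            · exact le_abs_self _
            · linarith
        _ = 1 / (1 + β) * (|bell y - bell u| * (1 + u ^ 2)) := by ring
        _ ≤ _ := mul_le_mul_of_nonneg_left (abs_bell_sub_bell_le hθ1) hk.le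
    have e4 : r y * (u * g) ^ 2 ≤ 1 / (1 + β) * (ρ * (37 * R ^ 2)) := by
      have h1 := H.one_add_sq_le hθ1 hy
      have h2 : u ^ 2 ≤ 37 * R ^ 2 := by rw [← hu] at h1; linarith
      have h3 := H.r_le y hy
      have h4 := H.r_nonneg y hy
      have h5 := H.ρ_nonneg
      calc r y * (u * g) ^ 2 = r y * (u ^ 2 * g ^ 2) := by rw [mul_pow]
        _ ≤ ρ * ((37 * R ^ 2) * (1 / (1 + β))) := by gcongr
        _ = _ := by ring
    have e5 : dens β r y * (u * g) ^ 2 = (bell u + β) * (u * g) ^ 2 +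
        (bell y - bell u) * (u * g) ^ 2 + r y * (u * g) ^ 2 := by rw [dens]; ring
    calc dens β r y * crit₁ A B β θ y ^ 2 ≤ dens β r y * (2 * (u * g) ^ 2 + 2 * κ ^ 2) := by gcongr
      _ = 2 * (dens β r y * (u * g) ^ 2) + 2 * κ ^ 2 * dens β r y := by ring
      _ ≤ _ := by rw [e5]; linarith
  refine hle.trans ?_
  rw [intervalIntegral.integral_add c5 c4, intervalIntegral.integral_const_mul,
    intervalIntegral.integral_const_mul,
    intervalIntegral.integral_add (c2.intervalIntegrable _ _) (by simp),
    intervalIntegral.integral_add (c1.intervalIntegrable _ _) (c3.intervalIntegrable _ _),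
    intervalIntegral.integral_const_mul, ← hT]
  have f1 := integral_sq_mul_bell_le hab θ
  have f2 := integral_exp_sixteenth_le hab
  have f3 : 48 * |θ| * ∫ y in (-A)..B, Real.exp (-(1 / 16) * y ^ 2) ≤ 48 * |θ| * 8 := by gcongr
  simp only [intervalIntegral.integral_const, smul_eq_mul]
  have f4 : (B - -A) * (ρ * (37 * R ^ 2)) = 222 * (R ^ 3 * ρ) := by
    rw [show B - -A = 6 * R by linarith [H.add_eq]]; ring
  rw [f4]
  have hρ := H.pow_mul_ρ_le'
  have f5 : 2 * κ ^ 2 * T ≤ 1 / (1 + β) := by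
    set τ := bell (R - 1) with hτ
    have hτpos : 0 < τ := bell_pos _
    have hτ1 : τ ≤ 1 := bell_le_one _
    have m1 := H.abs_mass₁_le hθ1
    have h1 : κ ^ 2 ≤ τ / N := by
      rw [hκ, div_pow, ← sq_abs]
      calc |mass₁ A B θ| ^ 2 / N ^ 2 ≤ τ ^ 2 / N ^ 2 := by gcongr
        _ ≤ τ / N := by
          gcongr
          · nlinarith
          · exact le_self_pow₀ hN1 (by norm_num)
    have h2 : 2 * κ ^ 2 * T ≤ 8 * τ := by
      calc 2 * κ ^ 2 * T ≤ 2 * (τ / N) * (4 * N) := by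
            gcongr
            exact (mass_pos H.neg_lt hβ 0).le.trans H.integral_dens_bounds.1
        _ = 8 * τ := by field_simp; ring
    have h3 := H.mul_bell_le
    rw [le_div_iff₀ (by linarith)]
    have h4 : τ * (1 + β) ≤ R * τ * (1 + β) := by
      have : τ ≤ R * τ := by nlinarith [H.two_le]
      gcongr
    norm_num at h3
    have h5 := mul_le_mul_of_nonneg_right h2 (by linarith : 0 ≤ 1 + β)
    linarith
  have f6 : 2 * (1 / (1 + β)) * ((∫ y in (-A)..B, (y - θ) ^ 2 * bell (y - θ)) +
      48 * |θ| * (∫ y in (-A)..B, Real.exp (-(1 / 16) * y ^ 2)) + 222 * (R ^ 3 * ρ)) ≤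
      2 * (1 / (1 + β)) * 19 := by
    gcongr
    norm_num at hρ
    linarith
  linarith

theorem integral_dens_mul_crit₁_sq_pos (H : Rescaled A B R β ρ r) {θ : ℝ} (hθ : |θ| ≤ 1 / 2) :
    0 < ∫ y in (-A)..B, dens β r y * crit₁ A B β θ y ^ 2 := by
  have hβ := H.β_nonneg
  have hθ' := abs_le.1 hθ
  have hc : Continuous fun y => bell y * crit₁ A B β θ y ^ 2 :=
    continuous_bell.mul ((H.continuous_crit₁_right θ).pow 2)
  have hpos : 0 < ∫ y in (-A)..B, bell y * crit₁ A B β θ y ^ 2 := by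
    refine intervalIntegral.integral_pos H.neg_lt hc.continuousOn
      (fun y _ => mul_nonneg (bell_pos y).le (sq_nonneg _)) ?_
    by_cases h0 : mass₁ A B θ / mass A B β θ = 0
    · refine ⟨θ + 1, ⟨by linarith [H.two_le, H.le_A], by linarith [H.two_le, H.le_B]⟩, ?_⟩
      have : crit₁ A B β θ (θ + 1) = bell 1 / (bell 1 + β) := by
        rw [crit₁, h0]; simp
      rw [this]
      have := bell_pos (θ + 1); have := bell_pos 1; have := bell_add_pos hβ 1
      positivity
    · refine ⟨θ, ⟨by linarith [H.two_le, H.le_A], by linarith [H.two_le, H.le_B]⟩, ?_⟩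
      have : crit₁ A B β θ θ = -(mass₁ A B θ / mass A B β θ) := by rw [crit₁]; simp
      rw [this, neg_sq]
      exact mul_pos (bell_pos θ) (by positivity)
  refine hpos.trans_le (intervalIntegral.integral_mono_on H.neg_lt.le (hc.intervalIntegrable _ _)
    (H.integrable_dens_mul ((H.continuous_crit₁_right θ).pow 2)) fun y hy => ?_)
  have := H.r_nonneg y hy
  gcongr
  rw [dens]; linarith

end Rescaled

end

end QPE

namespace QPE

noncomputable section

theorem sub_add_sq_sqrt_sub_le {p q : ℝ} (hp : 0 < p) (hq : 0 < q) :
    p - q + (√p - √q) ^ 2 ≤ p * (Real.log p - Real.log q) := by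
  have hsp := Real.sqrt_pos.2 hp
  have hsq := Real.sqrt_pos.2 hq
  have ep := Real.sq_sqrt hp.le
  have eq := Real.sq_sqrt hq.le
  have h1 : Real.log p - Real.log q = -(2 * Real.log (√q / √p)) := by
    rw [Real.log_div hsq.ne' hsp.ne', Real.log_sqrt hp.le, Real.log_sqrt hq.le]; ring
  have h2 := Real.log_le_sub_one_of_pos (div_pos hsq hsp)
  rw [h1]
  calc p - q + (√p - √q) ^ 2 = p * -(2 * (√q / √p - 1)) := by
        have : √q / √p * p = √q * √p := by
          rw [div_mul_eq_mul_div, div_eq_iff hsp.ne']; linear_combination (-√q) * ep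
        linear_combination ep + eq + 2 * this
    _ ≤ _ := by gcongr

theorem sq_div_le_sq_sqrt_sub {p q δ s : ℝ} (hp : 0 ≤ p) (hδ : 0 ≤ δ) (hpq : p + δ ≤ q)
    (hqs : q ≤ s) (hs : 0 < s) : δ ^ 2 / (4 * s) ≤ (√p - √q) ^ 2 := by
  have hq : 0 ≤ q := by linarith
  have ep := Real.sq_sqrt hp
  have eq := Real.sq_sqrt hq
  have hle : √p ≤ √q := Real.sqrt_le_sqrt (by linarith)
  have hp0 := Real.sqrt_nonneg p
  rw [div_le_iff₀ (by positivity)]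
  have h1 : δ ≤ (√q - √p) * (√q + √p) := by nlinarith
  have h2 : (√q + √p) ^ 2 ≤ 4 * s := by nlinarith
  calc δ ^ 2 ≤ ((√q - √p) * (√q + √p)) ^ 2 := by gcongr
    _ = (√p - √q) ^ 2 * (√q + √p) ^ 2 := by ring
    _ ≤ _ := by gcongr

theorem bell_gap : (1 / 12800000000 : ℝ) ≤ bell (1 / 160000) - bell (3 / 160000) := by
  have h1 : 1 - (1 / 160000 : ℝ) ^ 2 / 2 ≤ bell (1 / 160000) := by
    rw [bell]
    have := Real.add_one_le_exp (-(1 / 160000 : ℝ) ^ 2 / 2)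
    linarith
  have h2 : bell (3 / 160000) ≤ 1 / (1 + (3 / 160000 : ℝ) ^ 2 / 2) := by
    rw [bell, neg_div, Real.exp_neg, ← one_div]
    apply one_div_le_one_div_of_le (by positivity)
    linarith [Real.add_one_le_exp ((3 / 160000 : ℝ) ^ 2 / 2)]
  norm_num at h1 h2 ⊢
  linarith

namespace Rescaled

variable {A B R β ρ : ℝ} {r : ℝ → ℝ}

theorem mass_sub_mass_le (H : Rescaled A B R β ρ r) {θ : ℝ} (hθ : θ ∈ Set.Icc (-A) B) :
    mass A B β θ - mass A B β 0 ≤ 5 * R * bell (R - 1) := by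
  have hA := H.le_A; have hB := H.le_B; have hR := H.two_le
  have hA' := H.A_le; have hB' := H.B_le
  have hinteg : ∀ a b : ℝ, IntervalIntegrable bell volume a b := fun a b =>
    continuous_bell.intervalIntegrable a b
  have hsub : mass A B β θ - mass A B β 0 =
      (∫ u in (-A - θ)..(-A), bell u) - ∫ u in (B - θ)..B, bell u := by
    have h1 : ∫ y in (-A)..B, bell (y - θ) = ∫ u in (-A - θ)..(B - θ), bell u :=
      intervalIntegral.integral_comp_sub_right (fun u => bell u) θ
    have h2 := intervalIntegral.integral_add_adjacent_intervals (hinteg (-A - θ) (-A)) (hinteg (-A) B)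
    have h3 := intervalIntegral.integral_add_adjacent_intervals (hinteg (-A - θ) (B - θ))
      (hinteg (B - θ) B)
    simp only [mass, sub_zero, h1]
    linarith
  have hedge : ∀ {a b : ℝ}, a ≤ b → b - a ≤ 5 * R → (∀ u ∈ Set.Icc a b, R - 1 ≤ |u|) →
      ∫ u in a..b, bell u ≤ 5 * R * bell (R - 1) := by
    intro a b hab hlen hu
    have h1 : ∫ u in a..b, bell u ≤ ∫ _ in a..b, bell (R - 1) :=
      intervalIntegral.integral_mono_on hab (hinteg a b) (by simp) fun u hu' =>
        bell_le_bell (by rw [abs_of_nonneg (by linarith : 0 ≤ R - 1)]; exact hu u hu')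
    simp only [intervalIntegral.integral_const, smul_eq_mul] at h1
    exact h1.trans (mul_le_mul_of_nonneg_right hlen (bell_pos _).le)
  have hnn : ∀ {a b : ℝ}, a ≤ b → 0 ≤ ∫ u in a..b, bell u := fun hab =>
    intervalIntegral.integral_nonneg hab fun u _ => (bell_pos u).le
  rw [hsub]
  rcases le_total 0 θ with h0 | h0
  · have h1 := hedge (a := -A - θ) (b := -A) (by linarith) (by linarith [hθ.2])
      (fun u hu => by rw [abs_of_nonpos (by linarith [hu.2])]; linarith [hu.2])
    have h2 := hnn (a := B - θ) (b := B) (by linarith)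
    linarith
  · have h1 := hedge (a := B) (b := B - θ) (by linarith) (by linarith [hθ.1])
      (fun u hu => by rw [abs_of_nonneg (by linarith [hu.1])]; linarith [hu.1])
    have h2 := hnn (a := -A) (b := -A - θ) (by linarith)
    rw [intervalIntegral.integral_symm, intervalIntegral.integral_symm B]
    linarith

theorem model_gap (H : Rescaled A B R β ρ r) {θ y : ℝ} (hθ : θ ∈ Set.Icc (-A) B)
    (h1 : |y - θ| ≤ 1 / 160000) (h2 : 3 / 160000 ≤ |y|) :
    (bell y + β) / mass A B β 0 + 1 / 25600000000 / mass A B β θ ≤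
      (bell (y - θ) + β) / mass A B β θ := by
  have hβ := H.β_nonneg
  have hN0 : 1 ≤ mass A B β 0 := by
    have := H.mass_lower (θ := 0) (by simp)
    have h4 : 0 ≤ R * β := mul_nonneg (by linarith [H.two_le]) H.β_nonneg
    linarith
  have hNθ : 0 < mass A B β θ := mass_pos H.neg_lt hβ θ
  have hdiff := H.mass_sub_mass_le hθ
  have hsmall := H.mul_bell_le
  have hb1 : bell (1 / 160000) ≤ bell (y - θ) :=
    bell_le_bell (by rwa [abs_of_pos (by norm_num : (0 : ℝ) < 1 / 160000)])
  have hb2 : bell y ≤ bell (3 / 160000) :=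
    bell_le_bell (by rwa [abs_of_pos (by norm_num : (0 : ℝ) < 3 / 160000)])
  have hgap := bell_gap
  set N₀ := mass A B β 0
  set N := mass A B β θ
  have hkey : N * (bell y + β) + 1 / 25600000000 * N₀ ≤ N₀ * (bell (y - θ) + β) := by
    have e1 : N₀ * (1 / 12800000000) ≤ N₀ * (bell (y - θ) - bell y) := by gcongr; linarith
    have e2 : (N - N₀) * (bell y + β) ≤ 5 * R * bell (R - 1) * (1 + β) := by
      calc (N - N₀) * (bell y + β) ≤ 5 * R * bell (R - 1) * (bell y + β) := by
            gcongr; exact (bell_add_pos hβ y).le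
        _ ≤ _ := by
          have := H.two_le; have := bell_pos (R - 1); have := bell_le_one y
          gcongr
    norm_num at hsmall
    nlinarith
  have hN0' : 0 < N₀ := by linarith
  rw [div_add_div _ _ hN0'.ne' hNθ.ne', div_le_div_iff₀ (by positivity) hNθ]
  nlinarith

theorem integral_mul_crit_sub_ge (H : Rescaled A B R β ρ r) {θ : ℝ} (hθ : θ ∈ Set.Icc (-A) B)
    (hfar : 1 / 40000 ≤ |θ|) :
    1 / 10 ^ 27 / 2 * (1 / (1 + β)) ≤
      ∫ y in (-A)..B, (bell y + β) * (crit A B β 0 y - crit A B β θ y) := by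
  have hβ := H.β_nonneg
  have hR := H.two_le
  have hRβ : 0 ≤ R * β := mul_nonneg (by linarith) hβ
  have hN0 := H.mass_lower (θ := 0) (by simp)
  have hNθ : 0 < mass A B β θ := mass_pos H.neg_lt hβ θ
  have hNθ' := H.mass_upper θ
  have hm0 := H.mass_eq_integral 0
  have hmθ := H.mass_eq_integral θ
  simp only [sub_zero] at hm0
  set N₀ := mass A B β 0 with hN₀
  set N := mass A B β θ with hN
  have hN0' : 0 < N₀ := by linarith
  set p : ℝ → ℝ := fun y => (bell y + β) / N₀ with hp
  set q : ℝ → ℝ := fun y => (bell (y - θ) + β) / N with hq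
  have hppos : ∀ y, 0 < p y := fun y => div_pos (bell_add_pos hβ y) hN0'
  have hqpos : ∀ y, 0 < q y := fun y => div_pos (bell_add_pos hβ _) hNθ
  have cp : Continuous p := (continuous_bell.add continuous_const).div_const _
  have cq : Continuous q := ((continuous_bell_sub θ).add continuous_const).div_const _
  have ip : ∫ y in (-A)..B, p y = 1 := by
    simp only [hp]; rw [intervalIntegral.integral_div, hm0, div_self hN0'.ne']
  have iq : ∫ y in (-A)..B, q y = 1 := by
    simp only [hq]; rw [intervalIntegral.integral_div, hmθ, div_self hNθ.ne']
  have ch : Continuous fun y => (√(p y) - √(q y)) ^ 2 := (cp.sqrt.sub cq.sqrt).pow 2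
  have hcrit : ∀ y, (bell y + β) * (crit A B β 0 y - crit A B β θ y) =
      N₀ * (p y * (Real.log (p y) - Real.log (q y))) := by
    intro y
    have e1 : Real.log (p y) = crit A B β 0 y := by
      rw [hp, crit, Real.log_div (bell_add_pos hβ y).ne' hN0'.ne', sub_zero]
    have e2 : Real.log (q y) = crit A B β θ y := by
      rw [hq, crit, Real.log_div (bell_add_pos hβ _).ne' hNθ.ne']
    rw [e1, e2, ← mul_assoc]
    congr 1
    simp only [hp]; field_simp
  have hcont : Continuous fun y => (bell y + β) * (crit A B β 0 y - crit A B β θ y) :=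
    (continuous_bell.add continuous_const).mul
      ((H.continuous_crit_right 0).sub (H.continuous_crit_right θ))
  have hpq : ∫ y in (-A)..B, (p y - q y) = 0 := by
    rw [intervalIntegral.integral_sub (cp.intervalIntegrable _ _) (cq.intervalIntegrable _ _), ip,
      iq, sub_self]
  have hkl : N₀ * ∫ y in (-A)..B, (√(p y) - √(q y)) ^ 2 ≤
      ∫ y in (-A)..B, (bell y + β) * (crit A B β 0 y - crit A B β θ y) := by
    have cpq : Continuous fun y => p y - q y := cp.sub cq
    have h1 : ∫ y in (-A)..B, N₀ * ((p y - q y) + (√(p y) - √(q y)) ^ 2) ≤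
        ∫ y in (-A)..B, (bell y + β) * (crit A B β 0 y - crit A B β θ y) := by
      refine intervalIntegral.integral_mono_on H.neg_lt.le
        ((continuous_const.mul (cpq.add ch)).intervalIntegrable _ _)
        (hcont.intervalIntegrable _ _) fun y _ => ?_
      rw [hcrit]
      exact mul_le_mul_of_nonneg_left (sub_add_sq_sqrt_sub_le (hppos y) (hqpos y)) hN0'.le
    rwa [intervalIntegral.integral_const_mul, intervalIntegral.integral_add
      (cpq.intervalIntegrable _ _) (ch.intervalIntegrable _ _), hpq, zero_add] at h1
  have hwin : ∀ y, |y - θ| ≤ 1 / 160000 → 3 / 160000 ≤ |y| →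
      (1 / 25600000000 / N) ^ 2 / (4 * ((1 + β) / N)) ≤ (√(p y) - √(q y)) ^ 2 := by
    intro y h1 h2
    refine sq_div_le_sq_sqrt_sub (hppos y).le (by positivity) (H.model_gap hθ h1 h2) ?_
      (by positivity)
    have := bell_le_one (y - θ)
    simp only [hq]
    gcongr
  have hinteg : (1 / 160000) * ((1 / 25600000000 / N) ^ 2 / (4 * ((1 + β) / N))) ≤
      ∫ y in (-A)..B, (√(p y) - √(q y)) ^ 2 := by
    rcases le_total 0 θ with h0 | h0
    · rw [abs_of_nonneg h0] at hfar
      have := mul_le_integral_of_le (a := -A) (b := B) (p := θ - 1 / 160000) (q := θ)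
        (by linarith [H.le_A]) (by linarith) hθ.2 ch (fun y => sq_nonneg _)
        (fun y hy => hwin y (abs_le.2 ⟨by linarith [hy.1], by linarith [hy.2]⟩)
          (by rw [abs_of_nonneg (by linarith [hy.1])]; linarith [hy.1]))
      linarith
    · rw [abs_of_nonpos h0] at hfar
      have := mul_le_integral_of_le (a := -A) (b := B) (p := θ) (q := θ + 1 / 160000)
        hθ.1 (by linarith) (by linarith [H.le_B]) ch (fun y => sq_nonneg _)
        (fun y hy => hwin y (abs_le.2 ⟨by linarith [hy.1], by linarith [hy.2]⟩)
          (by rw [abs_of_nonpos (by linarith [hy.2])]; linarith [hy.2]))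
      linarith
  refine le_trans ?_ hkl
  have h3 : N ≤ 3 * N₀ := by linarith
  have hval : (1 / 160000) * ((1 / 25600000000 / N) ^ 2 / (4 * ((1 + β) / N))) =
      1 / 160000 * (1 / 25600000000) ^ 2 / 4 * (1 / (1 + β)) * (1 / N) := by
    have : (1 + β) ≠ 0 := by positivity
    field_simp
  rw [hval] at hinteg
  calc 1 / 10 ^ 27 / 2 * (1 / (1 + β))
      ≤ (1 / 160000 * (1 / 25600000000) ^ 2 / 4 * (1 / 3)) * (1 / (1 + β)) := by
        gcongr; norm_num
    _ ≤ (1 / 160000 * (1 / 25600000000) ^ 2 / 4 * (N₀ * (1 / N))) * (1 / (1 + β)) := by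
        have : 1 / 3 ≤ N₀ * (1 / N) := by
          rw [mul_one_div, div_le_div_iff₀ (by norm_num) hNθ]; linarith
        gcongr
    _ = N₀ * (1 / 160000 * (1 / 25600000000) ^ 2 / 4 * (1 / (1 + β)) * (1 / N)) := by ring
    _ ≤ _ := by gcongr

/-- Away from the target the population criterion is strictly smaller than at the target. -/
theorem integral_dens_mul_crit_lt (H : Rescaled A B R β ρ r) {θ : ℝ} (hθ : θ ∈ Set.Icc (-A) B)
    (hfar : 1 / 40000 ≤ |θ|) :
    ∫ y in (-A)..B, dens β r y * crit A B β θ y < ∫ y in (-A)..B, dens β r y * crit A B β 0 y := by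
  have hβ := H.β_nonneg
  have hR := H.two_le
  have hRβ : 0 ≤ R * β := mul_nonneg (by linarith) hβ
  have hc : Continuous fun y => crit A B β 0 y - crit A B β θ y :=
    (H.continuous_crit_right 0).sub (H.continuous_crit_right θ)
  have hk : 0 < 1 / (1 + β) := by positivity
  have h1 := H.integral_mul_crit_sub_ge hθ hfar
  have h2 := H.integral_dens_mul hc
  have h3 : ∫ y in (-A)..B, dens β r y * (crit A B β 0 y - crit A B β θ y) =
      (∫ y in (-A)..B, dens β r y * crit A B β 0 y) -
        ∫ y in (-A)..B, dens β r y * crit A B β θ y := by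
    rw [← intervalIntegral.integral_sub (H.integrable_dens_mul (H.continuous_crit_right 0))
      (H.integrable_dens_mul (H.continuous_crit_right θ))]
    simp_rw [mul_sub]
  have hpt : ∀ y ∈ Set.Icc (-A) B, -(19 * R ^ 2) ≤ crit A B β 0 y - crit A B β θ y := by
    intro y hy
    have hb := bell_pos y
    have hbθ := bell_pos (y - θ)
    have e1 : Real.log (bell y) ≤ Real.log (bell y + β) - Real.log (bell (y - θ) + β) := by
      rw [← Real.log_div (bell_add_pos hβ y).ne' (bell_add_pos hβ _).ne']
      apply Real.log_le_log hb
      rw [le_div_iff₀ (bell_add_pos hβ _)]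
      have := bell_le_one y; have := bell_le_one (y - θ)
      nlinarith
    have e2 : -(25 / 2 * R ^ 2) ≤ Real.log (bell y) := by
      rw [bell, Real.log_exp]
      have : y ^ 2 ≤ (5 * R) ^ 2 := by
        rw [← sq_abs]; exact pow_le_pow_left₀ (abs_nonneg _) (H.abs_le_of_mem hy) 2
      nlinarith
    have hNθ : 0 < mass A B β θ := mass_pos H.neg_lt hβ θ
    have hN0 : 0 < mass A B β 0 := mass_pos H.neg_lt hβ 0
    have e3 : Real.log (mass A B β 0) - Real.log (mass A B β θ) ≤ 6 := by
      rw [← Real.log_div hN0.ne' hNθ.ne']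
      refine (Real.log_le_self (by positivity)).trans ?_
      rw [div_le_iff₀ hNθ]
      linarith [H.mass_upper 0, H.mass_lower_of_mem hθ]
    simp only [crit, sub_zero]
    nlinarith
  have h4 : -(114 * (R ^ 3 * ρ)) ≤ ∫ y in (-A)..B, r y * (crit A B β 0 y - crit A B β θ y) := by
    have : ∫ y in (-A)..B, -(19 * R ^ 2) * ρ ≤
        ∫ y in (-A)..B, r y * (crit A B β 0 y - crit A B β θ y) := by
      refine intervalIntegral.integral_mono_on H.neg_lt.le (by simp) (H.integrable_r_mul hc)
        fun y hy => ?_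
      have f1 := H.r_nonneg y hy
      have f2 := H.r_le y hy
      have f3 := hpt y hy
      calc -(19 * R ^ 2) * ρ ≤ -(19 * R ^ 2) * r y := by
            have : 0 ≤ 19 * R ^ 2 := by positivity
            nlinarith
        _ ≤ _ := by nlinarith
    simp only [intervalIntegral.integral_const, smul_eq_mul] at this
    rw [show B - -A = 6 * R by linarith [H.add_eq]] at this
    linarith
  have h5 : R ^ 3 * ρ ≤ 1 / 10 ^ 30 * (1 / (1 + β)) := by
    rw [mul_one_div, le_div_iff₀ (by linarith)]; exact H.pow_mul_ρ_le
  have h6 : 114 * (1 / 10 ^ 30 * (1 / (1 + β))) < 1 / 10 ^ 27 / 2 * (1 / (1 + β)) := by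
    rw [← mul_assoc]; exact mul_lt_mul_of_pos_right (by norm_num) hk
  linarith

end Rescaled

/-- A function that is strongly concave near `0` and smaller than its value at `0` elsewhere has
a unique maximiser, with a quadratic lower bound on the loss. -/
theorem exists_quadratic_max {L L₁ L₂ : ℝ → ℝ} {a b η m : ℝ} (ha : a < -η) (hb : η < b)
    (hη : 0 < η) (hm : 0 < m) (h₁ : ∀ θ ∈ Set.Icc a b, HasDerivAt L (L₁ θ) θ)
    (h₂ : ∀ θ ∈ Set.Icc a b, HasDerivAt L₁ (L₂ θ) θ) (hconc : ∀ θ, |θ| ≤ η → L₂ θ ≤ -m)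
    (hsep : ∀ θ ∈ Set.Icc a b, η ≤ |θ| → L θ < L 0) :
    ∃ θ₀, |θ₀| ≤ η ∧ L₁ θ₀ = 0 ∧ m * |θ₀| ≤ |L₁ 0| ∧
      ∃ c, 0 < c ∧ ∀ θ ∈ Set.Icc a b, c * (θ - θ₀) ^ 2 ≤ L θ₀ - L θ := by
  have hcont : ContinuousOn L (Set.Icc a b) := fun θ hθ => (h₁ θ hθ).continuousAt.continuousWithinAt
  have h0 : (0 : ℝ) ∈ Set.Icc a b := ⟨by linarith, by linarith⟩
  obtain ⟨θ₀, hθ₀, hmax⟩ := isCompact_Icc.exists_isMaxOn ⟨0, h0⟩ hcont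
  have hin : |θ₀| < η := by
    by_contra hcon
    push Not at hcon
    have h1 := hsep θ₀ hθ₀ hcon
    have h2 : L 0 ≤ L θ₀ := hmax h0
    linarith
  have hin' := abs_lt.1 hin
  have hz : L₁ θ₀ = 0 := by
    have hloc : IsLocalMax L θ₀ := by
      filter_upwards [Ioo_mem_nhds (by linarith : a < θ₀) (by linarith : θ₀ < b)] with s hs
      exact hmax (Set.Ioo_subset_Icc_self hs)
    exact hloc.hasDerivAt_eq_zero (h₁ θ₀ hθ₀)
  have hsub : Set.Icc (-η) η ⊆ Set.Icc a b := Set.Icc_subset_Icc ha.le hb.le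
  have hanti : AntitoneOn (fun θ => L₁ θ + m * (θ - θ₀)) (Set.Icc (-η) η) := by
    have hd : ∀ θ ∈ Set.Icc (-η) η, HasDerivAt (fun θ => L₁ θ + m * (θ - θ₀)) (L₂ θ + m) θ :=
      fun θ hθ => ((h₂ θ (hsub hθ)).add
        (((hasDerivAt_id θ).sub_const θ₀).const_mul m)).congr_deriv (by simp)
    refine antitoneOn_of_deriv_nonpos (convex_Icc _ _)
      (fun θ hθ => (hd θ hθ).continuousAt.continuousWithinAt)
      (fun θ hθ => (hd θ (interior_subset hθ)).differentiableAt.differentiableWithinAt)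
      fun θ hθ => ?_
    have hθ' := interior_subset hθ
    rw [(hd θ hθ').deriv]
    linarith [hconc θ (abs_le.2 hθ')]
  have hθ₀' : θ₀ ∈ Set.Icc (-η) η := ⟨hin'.1.le, hin'.2.le⟩
  have h0' : (0 : ℝ) ∈ Set.Icc (-η) η := ⟨by linarith, hη.le⟩
  refine ⟨θ₀, hin.le, hz, ?_, ?_⟩
  · rcases le_total 0 θ₀ with h | h
    · have := hanti h0' hθ₀' h
      simp only [hz, sub_self, mul_zero, add_zero] at this
      rw [abs_of_nonneg h]
      linarith [le_abs_self (L₁ 0)]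
    · have := hanti hθ₀' h0' h
      simp only [hz, sub_self, mul_zero, add_zero] at this
      rw [abs_of_nonpos h]
      linarith [neg_abs_le (L₁ 0)]
  · have hd : ∀ θ ∈ Set.Icc (-η) η, HasDerivAt (fun θ => L θ + m / 2 * (θ - θ₀) ^ 2)
        (L₁ θ + m * (θ - θ₀)) θ := fun θ hθ => by
      refine ((h₁ θ (hsub hθ)).add
        ((((hasDerivAt_id θ).sub_const θ₀).pow 2).const_mul (m / 2))).congr_deriv ?_
      simp; ring
    have hnear : ∀ θ ∈ Set.Icc (-η) η, m / 2 * (θ - θ₀) ^ 2 ≤ L θ₀ - L θ := by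
      intro θ hθ
      rcases le_total θ θ₀ with h | h
      · have hs : Set.Icc θ θ₀ ⊆ Set.Icc (-η) η := Set.Icc_subset_Icc hθ.1 hθ₀'.2
        have hmono : MonotoneOn (fun θ => L θ + m / 2 * (θ - θ₀) ^ 2) (Set.Icc θ θ₀) := by
          refine monotoneOn_of_deriv_nonneg (convex_Icc _ _)
            (fun s hs' => (hd s (hs hs')).continuousAt.continuousWithinAt)
            (fun s hs' => (hd s (hs (interior_subset hs'))).differentiableAt.differentiableWithinAt)
            fun s hs' => ?_
          have hs'' := interior_subset hs'
          rw [(hd s (hs hs'')).deriv]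
          have := hanti (hs hs'') hθ₀' hs''.2
          simpa [hz] using this
        have := hmono (Set.left_mem_Icc.2 h) (Set.right_mem_Icc.2 h) h
        simp only [sub_self] at this
        linarith
      · have hs : Set.Icc θ₀ θ ⊆ Set.Icc (-η) η := Set.Icc_subset_Icc hθ₀'.1 hθ.2
        have hmono : AntitoneOn (fun θ => L θ + m / 2 * (θ - θ₀) ^ 2) (Set.Icc θ₀ θ) := by
          refine antitoneOn_of_deriv_nonpos (convex_Icc _ _)
            (fun s hs' => (hd s (hs hs')).continuousAt.continuousWithinAt)
            (fun s hs' => (hd s (hs (interior_subset hs'))).differentiableAt.differentiableWithinAt)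
            fun s hs' => ?_
          have hs'' := interior_subset hs'
          rw [(hd s (hs hs'')).deriv]
          have := hanti hθ₀' (hs hs'') hs''.1
          simpa [hz] using this
        have := hmono (Set.left_mem_Icc.2 h) (Set.right_mem_Icc.2 h) h
        simp only [sub_self] at this
        linarith
    have hcomp : IsCompact (Set.Icc a b ∩ {θ | η ≤ |θ|}) :=
      isCompact_Icc.inter_right (isClosed_le continuous_const continuous_abs)
    have hne : (Set.Icc a b ∩ {θ | η ≤ |θ|}).Nonempty :=
      ⟨a, ⟨le_rfl, by linarith⟩, by
        simp only [Set.mem_ofPred_eq]; rw [abs_of_neg (by linarith)]; linarith⟩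
    obtain ⟨θ₁, hθ₁, hmax₁⟩ := hcomp.exists_isMaxOn hne (hcont.mono Set.inter_subset_left)
    set g := L θ₀ - L θ₁ with hg
    have hgpos : 0 < g := by
      have h1 := hsep θ₁ hθ₁.1 hθ₁.2
      have h2 : L 0 ≤ L θ₀ := hmax h0
      linarith
    have hba : 0 < b - a := by linarith
    refine ⟨min (m / 2) (g / (b - a) ^ 2), by positivity, fun θ hθ => ?_⟩
    by_cases hθη : |θ| ≤ η
    · refine le_trans ?_ (hnear θ (abs_le.1 hθη))
      gcongr
      exact min_le_left _ _
    · push Not at hθη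
      have h1 : L θ ≤ L θ₁ := hmax₁ ⟨hθ, hθη.le⟩
      have h2 : (θ - θ₀) ^ 2 ≤ (b - a) ^ 2 := by
        rw [← sq_abs]
        refine pow_le_pow_left₀ (abs_nonneg _) (abs_le.2 ⟨?_, ?_⟩) 2 <;>
          linarith [hθ.1, hθ.2, hθ₀.1, hθ₀.2]
      calc min (m / 2) (g / (b - a) ^ 2) * (θ - θ₀) ^ 2
          ≤ g / (b - a) ^ 2 * (b - a) ^ 2 := by
            gcongr
            exact min_le_right _ _
        _ = g := by field_simp
        _ ≤ _ := by linarith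

end

end QPE

namespace QPE

/-! ### The kernel and the laws of the outcomes -/

noncomputable section

/-- The normalisation of the Gaussian kernel. -/
def kernelMass (σ : ℝ) : ℝ := ∫ y in (-π)..π, Real.exp (-y ^ 2 / (2 * σ ^ 2))

theorem kernelMass_pos (σ : ℝ) : 0 < kernelMass σ :=
  intervalIntegral.intervalIntegral_pos_of_pos
    (Continuous.intervalIntegrable (by fun_prop) _ _) (fun _ => Real.exp_pos _)
    (by linarith [Real.pi_pos])

theorem exp_eq_bell {σ : ℝ} (x : ℝ) : Real.exp (-x ^ 2 / (2 * σ ^ 2)) = bell (x / σ) := by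
  rw [bell]; congr 1
  rw [div_pow, neg_div, neg_div, div_div, mul_comm]

theorem kernelMass_le {σ : ℝ} (hσ : 0 < σ) : kernelMass σ ≤ 3 * σ := by
  have h1 : kernelMass σ = σ * ∫ u in (-π / σ)..(π / σ), bell u := by
    rw [kernelMass]
    simp_rw [exp_eq_bell]
    rw [intervalIntegral.integral_comp_div _ hσ.ne', smul_eq_mul]
  have h2 := integral_bell_sub_le (a := -π / σ) (b := π / σ)
    (by gcongr; linarith [Real.pi_pos]) 0
  simp only [sub_zero] at h2
  rw [h1]
  nlinarith

theorem measurable_gaussianKernel (σ : ℝ) : Measurable (gaussianKernel σ) := by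
  unfold gaussianKernel
  have : Measurable fun x : ℝ => toIocMod Real.two_pi_pos (-π) x := by
    simp_rw [toIocMod_eq_sub_fract_mul]
    exact measurable_const.sub ((measurable_fract.comp (by fun_prop)).mul_const _)
  fun_prop

theorem gaussianKernel_nonneg (σ x : ℝ) : 0 ≤ gaussianKernel σ x :=
  div_nonneg (Real.exp_pos _).le (kernelMass_pos σ).le

theorem gaussianKernel_le (σ x : ℝ) : gaussianKernel σ x ≤ 1 / kernelMass σ := by
  have h := kernelMass_pos σ
  unfold gaussianKernel
  rw [← kernelMass]
  gcongr
  rw [Real.exp_le_one_iff, neg_div]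
  have : 0 ≤ (toIocMod Real.two_pi_pos (-π) x) ^ 2 / (2 * σ ^ 2) := by positivity
  linarith

theorem gaussianKernel_of_abs_le {σ x : ℝ} (hx : |x| ≤ π) :
    gaussianKernel σ x = bell (x / σ) / kernelMass σ := by
  have hsq : (toIocMod Real.two_pi_pos (-π) x) ^ 2 = x ^ 2 := by
    obtain ⟨h1, h2⟩ := abs_le.1 hx
    rcases h1.eq_or_lt with h | h
    · have : toIocMod Real.two_pi_pos (-π) x = π := by
        rw [toIocMod_eq_iff]
        exact ⟨⟨by linarith [Real.pi_pos], by linarith⟩, -1, by simp; linarith⟩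
      rw [this, ← h, neg_sq]
    · rw [(toIocMod_eq_self Real.two_pi_pos).2 ⟨h, by linarith⟩]
  rw [gaussianKernel, hsq, exp_eq_bell, kernelMass]

theorem gaussianKernel_periodic (σ : ℝ) : Function.Periodic (gaussianKernel σ) (2 * π) := by
  intro x
  unfold gaussianKernel
  rw [toIocMod_add_right]

theorem intervalIntegrable_gaussianKernel (σ c a b : ℝ) :
    IntervalIntegrable (fun x => gaussianKernel σ (x - c)) volume a b := by
  rw [intervalIntegrable_iff, Set.uIoc]
  refine Integrable.of_bound (C := 1 / kernelMass σ)
    ((measurable_gaussianKernel σ).comp (measurable_id.sub_const c)).aestronglyMeasurable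
    (ae_of_all _ fun x => ?_)
  rw [Real.norm_eq_abs, abs_of_nonneg (gaussianKernel_nonneg _ _)]
  exact gaussianKernel_le _ _

theorem integral_gaussianKernel (σ c : ℝ) :
    ∫ x in (0 : ℝ)..(2 * π), gaussianKernel σ (x - c) = 1 := by
  rw [intervalIntegral.integral_comp_sub_right (gaussianKernel σ) c]
  have h := (gaussianKernel_periodic σ).intervalIntegral_add_eq (0 - c) (-π)
  rw [show 0 - c + 2 * π = 2 * π - c by ring, show -π + 2 * π = π by ring] at h
  rw [h]
  have h2 : ∫ x in (-π)..π, gaussianKernel σ x =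
      ∫ x in (-π)..π, Real.exp (-x ^ 2 / (2 * σ ^ 2)) / kernelMass σ := by
    refine intervalIntegral.integral_congr fun x hx => ?_
    rw [Set.uIcc_of_le (by linarith [Real.pi_pos])] at hx
    rw [gaussianKernel_of_abs_le (abs_le.2 hx), exp_eq_bell]
  rw [h2, intervalIntegral.integral_div, ← kernelMass, div_self (kernelMass_pos σ).ne']

theorem PhaseProblem.sum_weight (S : PhaseProblem) : ∑ j, S.weight j = 1 := by
  have h := S.eigvec.sum_sq_norm_inner_right S.ψ
  rw [S.norm_ψ, one_pow] at h
  exact h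

theorem PhaseProblem.weight_nonneg (S : PhaseProblem) (j : Fin S.n) : 0 ≤ S.weight j :=
  sq_nonneg _

/-- The standing assumptions on the phase problem, the guess and the noise. -/
structure Experiment.Admissible (E : Experiment) : Prop where
  Δ_pos : 0 < E.Δ
  Δ_le : E.Δ ≤ π
  gap : ∀ j, j ≠ E.target → E.Δ < |E.phase j - E.φ₀|
  guess_close : |E.φ₀ - E.guess| < E.Δ / 3
  D_subset : E.D ⊆ Set.Ico (E.Δ / 6) (2 * π - E.Δ / 6)
  a_pos : 0 < E.a₀
  F_pos : 0 < E.F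
  F_le : E.F ≤ 1
  σ_pos : 0 < E.σ

theorem continuous_empMean_standardize {f : ℝ → ℝ → ℝ} (hf : Continuous (Function.uncurry f))
    (c s : ℝ) {M : ℕ} (x : Fin M → ℝ) :
    Continuous fun φ => empMean (fun z => f ((φ - c) / s) ((z - c) / s)) x := by
  unfold empMean
  refine continuous_const.mul (continuous_finsetSum _ fun i _ => ?_)
  exact hf.comp (by fun_prop : Continuous fun φ : ℝ => (((φ - c) / s, (x i - c) / s) : ℝ × ℝ))

namespace Experiment

variable {E : Experiment}

/-- The probability that a shot is accepted. -/
def acceptance (E : Experiment) : ℝ := ∫ y in E.D, E.noisyDensity y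

/-- The relative weight of the uniform background in rescaled coordinates. -/
def background (E : Experiment) : ℝ :=
  (1 - E.F) * (1 / (2 * π)) * kernelMass E.σ / (E.F * E.a₀)

/-- The rescaled contribution of the phases other than the target. -/
def contamination (E : Experiment) (y : ℝ) : ℝ :=
  ∑ j ∈ Finset.univ.erase E.target, E.weight j / E.a₀ *
    Real.exp (-(toIocMod Real.two_pi_pos (-π) (E.φ₀ + E.σ * y - E.phase j)) ^ 2 / (2 * E.σ ^ 2))

/-- The rescaled distance from the target to the left end of the filtering interval. -/
def leftEnd (E : Experiment) : ℝ := (E.φ₀ - (E.guess - E.Δ / 2)) / E.σ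

/-- The rescaled distance from the target to the right end of the filtering interval. -/
def rightEnd (E : Experiment) : ℝ := (E.guess + E.Δ / 2 - E.φ₀) / E.σ

/-- The rescaled guaranteed distance of the target from the ends of the filtering interval. -/
def margin (E : Experiment) : ℝ := E.Δ / (6 * E.σ)

theorem measurable_noisyDensity (E : Experiment) : Measurable E.noisyDensity := by
  unfold noisyDensity
  refine ((Finset.measurable_sum _ fun j _ => ?_).const_mul _).add_const _
  exact ((measurable_gaussianKernel E.σ).comp (measurable_id.sub_const _)).const_mul _

theorem measurableSet_D (E : Experiment) : MeasurableSet E.D := measurableSet_Icc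

namespace Admissible

theorem noisyDensity_nonneg (hE : E.Admissible) (x : ℝ) : 0 ≤ E.noisyDensity x := by
  have h1 := hE.F_pos
  have h2 := hE.F_le
  have h3 : 0 ≤ ∑ j, E.weight j * gaussianKernel E.σ (x - E.phase j) :=
    Finset.sum_nonneg fun j _ => mul_nonneg (E.weight_nonneg j) (gaussianKernel_nonneg _ _)
  have h4 : 0 ≤ (1 - E.F) * (1 / (2 * π)) := mul_nonneg (by linarith) (by positivity)
  unfold noisyDensity
  positivity

theorem intervalIntegrable_noisyDensity (E : Experiment) (a b : ℝ) :
    IntervalIntegrable E.noisyDensity volume a b := by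
  unfold noisyDensity
  refine IntervalIntegrable.add (IntervalIntegrable.const_mul ?_ _) (by simp)
  have h : (fun x => ∑ j, E.weight j * gaussianKernel E.σ (x - E.phase j)) =
      ∑ j, fun x => E.weight j * gaussianKernel E.σ (x - E.phase j) := by
    funext x; simp
  rw [h]
  exact IntervalIntegrable.sum _ fun j _ =>
    (intervalIntegrable_gaussianKernel E.σ (E.phase j) a b).const_mul _

theorem integral_noisyDensity (E : Experiment) :
    ∫ x in (0 : ℝ)..(2 * π), E.noisyDensity x = 1 := by
  unfold noisyDensity
  have hi : ∀ j ∈ Finset.univ, IntervalIntegrable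
      (fun x => E.weight j * gaussianKernel E.σ (x - E.phase j)) volume 0 (2 * π) := fun j _ =>
    (intervalIntegrable_gaussianKernel E.σ (E.phase j) _ _).const_mul _
  have hs : IntervalIntegrable
      (fun x => ∑ j, E.weight j * gaussianKernel E.σ (x - E.phase j)) volume 0 (2 * π) := by
    have h : (fun x => ∑ j, E.weight j * gaussianKernel E.σ (x - E.phase j)) =
        ∑ j, fun x => E.weight j * gaussianKernel E.σ (x - E.phase j) := by
      funext x; simp
    rw [h]
    exact IntervalIntegrable.sum _ hi
  rw [intervalIntegral.integral_add (hs.const_mul _) (by simp),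
    intervalIntegral.integral_const_mul, intervalIntegral.integral_finsetSum hi]
  simp_rw [intervalIntegral.integral_const_mul, integral_gaussianKernel, mul_one]
  rw [E.sum_weight]
  simp only [intervalIntegral.integral_const, smul_eq_mul]
  have := Real.pi_pos
  field_simp
  ring

theorem shotLaw_apply (hE : E.Admissible) {s : Set ℝ} (hs : MeasurableSet s)
    (hsub : s ⊆ Set.Ico 0 (2 * π)) :
    E.shotLaw s = ENNReal.ofReal (∫ x in s, E.noisyDensity x) := by
  have hinteg : IntegrableOn E.noisyDensity (Set.Ico 0 (2 * π)) := by
    rw [integrableOn_Ico_iff_integrableOn_Ioo, ← integrableOn_Ioc_iff_integrableOn_Ioo]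
    exact (intervalIntegrable_noisyDensity E 0 (2 * π)).1
  rw [shotLaw, withDensity_apply _ hs, Measure.restrict_restrict hs,
    Set.inter_eq_self_of_subset_left hsub,
    ofReal_integral_eq_lintegral_ofReal (hinteg.mono_set hsub)
      (ae_of_all _ fun x => hE.noisyDensity_nonneg x)]

theorem isProbabilityMeasure_shotLaw (hE : E.Admissible) : IsProbabilityMeasure E.shotLaw := by
  constructor
  have h1 : E.shotLaw Set.univ = E.shotLaw (Set.Ico 0 (2 * π)) := by
    rw [shotLaw, withDensity_apply _ MeasurableSet.univ, withDensity_apply _ measurableSet_Ico,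
      Measure.restrict_univ, Measure.restrict_restrict measurableSet_Ico, Set.inter_self]
  rw [h1, hE.shotLaw_apply measurableSet_Ico subset_rfl, integral_Ico_eq_integral_Ioo,
    ← integral_Ioc_eq_integral_Ioo, ← intervalIntegral.integral_of_le Real.two_pi_pos.le,
    integral_noisyDensity, ENNReal.ofReal_one]

theorem D_subset' (hE : E.Admissible) : E.D ⊆ Set.Ico 0 (2 * π) := fun x hx => by
  have h1 := hE.D_subset hx
  have h2 := hE.Δ_pos
  exact ⟨by linarith [h1.1], by linarith [h1.2]⟩

theorem expectedCalls_eq (hE : E.Admissible) (hp : 0 < E.acceptance) (t M : ℕ) :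
    E.expectedCalls t M = ENNReal.ofReal (t * (M / E.acceptance)) := by
  have := hE.isProbabilityMeasure_shotLaw
  rw [expectedCalls, expectedShots, tsum_pi_ncard_lt E.shotLaw E.measurableSet_D hp
    (hE.shotLaw_apply E.measurableSet_D hE.D_subset'), ENNReal.ofReal_mul (by positivity),
    ENNReal.ofReal_natCast]

theorem abs_sub_lt_of_mem (hE : E.Admissible) {x : ℝ} (hx : x ∈ E.D) :
    |x - E.φ₀| < 5 * E.Δ / 6 := by
  obtain ⟨h1, h2⟩ := hx
  obtain ⟨h3, h4⟩ := abs_lt.1 hE.guess_close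
  rw [abs_lt]; constructor <;> linarith

theorem abs_sub_le_pi (hE : E.Admissible) {x φ : ℝ} (hx : x ∈ E.D) (hφ : φ ∈ E.D) :
    |x - φ| ≤ π := by
  obtain ⟨h1, h2⟩ := hx
  obtain ⟨h3, h4⟩ := hφ
  have := hE.Δ_le
  rw [abs_le]; constructor <;> linarith

theorem φ₀_mem (hE : E.Admissible) : E.φ₀ ∈ E.D := by
  obtain ⟨h3, h4⟩ := abs_lt.1 hE.guess_close
  have := hE.Δ_pos
  constructor <;> linarith

theorem noisyDensity_eq (hE : E.Admissible) {x : ℝ} (hx : x ∈ E.D) :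
    E.noisyDensity x = E.F * E.a₀ / kernelMass E.σ *
      dens E.background E.contamination ((x - E.φ₀) / E.σ) := by
  have hZ := (kernelMass_pos E.σ).ne'
  have hF := hE.F_pos.ne'
  have ha := hE.a_pos.ne'
  have hσ := hE.σ_pos.ne'
  rw [noisyDensity, ← Finset.add_sum_erase _ _ (Finset.mem_univ E.target), dens, background,
    contamination]
  have h1 : gaussianKernel E.σ (x - E.phase E.target) =
      bell ((x - E.φ₀) / E.σ) / kernelMass E.σ :=
    gaussianKernel_of_abs_le (hE.abs_sub_le_pi hx hE.φ₀_mem)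
  have h2 : ∀ j, E.weight j * gaussianKernel E.σ (x - E.phase j) =
      E.a₀ / kernelMass E.σ * (E.weight j / E.a₀ * Real.exp (-(toIocMod Real.two_pi_pos (-π)
        (E.φ₀ + E.σ * ((x - E.φ₀) / E.σ) - E.phase j)) ^ 2 / (2 * E.σ ^ 2))) := fun j => by
    rw [mul_div_cancel₀ _ hσ, add_sub_cancel, gaussianKernel, ← kernelMass]
    field_simp
  rw [Finset.sum_congr rfl fun j _ => h2 j, ← Finset.mul_sum, h1]
  change E.F * (E.a₀ * _ + _) + _ = _
  field_simp
  ring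

theorem D_nonempty (hE : E.Admissible) : E.guess - E.Δ / 2 ≤ E.guess + E.Δ / 2 := by
  linarith [hE.Δ_pos]

theorem setIntegral_D_comp (hE : E.Admissible) (h : ℝ → ℝ) :
    ∫ x in E.D, h ((x - E.φ₀) / E.σ) = E.σ * ∫ y in (-E.leftEnd)..E.rightEnd, h y := by
  have hσ := hE.σ_pos.ne'
  rw [D, integral_Icc_eq_integral_Ioc, ← intervalIntegral.integral_of_le hE.D_nonempty]
  have h1 : ∀ x, h ((x - E.φ₀) / E.σ) = h (x / E.σ - E.φ₀ / E.σ) := fun x => by rw [sub_div]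
  simp_rw [h1]
  rw [intervalIntegral.integral_comp_div_sub _ hσ, smul_eq_mul, leftEnd, rightEnd]
  congr 2
  · ring
  · ring

theorem setIntegral_noisyDensity_mul (hE : E.Admissible) (h : ℝ → ℝ) :
    ∫ x in E.D, E.noisyDensity x * h ((x - E.φ₀) / E.σ) =
      E.F * E.a₀ / kernelMass E.σ * E.σ *
        ∫ y in (-E.leftEnd)..E.rightEnd, dens E.background E.contamination y * h y := by
  rw [mul_assoc, ← hE.setIntegral_D_comp, ← integral_const_mul]
  refine setIntegral_congr_fun E.measurableSet_D fun x hx => ?_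
  rw [hE.noisyDensity_eq hx, mul_assoc]

theorem acceptance_eq (hE : E.Admissible) :
    E.acceptance = E.F * E.a₀ / kernelMass E.σ * E.σ *
      ∫ y in (-E.leftEnd)..E.rightEnd, dens E.background E.contamination y := by
  have := hE.setIntegral_noisyDensity_mul fun _ => 1
  simpa only [mul_one, acceptance] using this

theorem isProbabilityMeasure_filteredLaw (hE : E.Admissible) (hp : 0 < E.acceptance) :
    IsProbabilityMeasure E.filteredLaw := by
  constructor
  have hinteg : IntegrableOn E.noisyDensity E.D := by
    rw [D, integrableOn_Icc_iff_integrableOn_Ioc]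
    exact (intervalIntegrable_noisyDensity E _ _).1
  rw [filteredLaw, ← acceptance, withDensity_apply _ MeasurableSet.univ, Measure.restrict_univ,
    ← ofReal_integral_eq_lintegral_ofReal (hinteg.div_const _)
      (ae_of_all _ fun x => div_nonneg (hE.noisyDensity_nonneg x) hp.le), integral_div,
    ← acceptance, div_self hp.ne', ENNReal.ofReal_one]

theorem ae_mem_D (E : Experiment) : ∀ᵐ x ∂E.filteredLaw, x ∈ E.D :=
  (withDensity_absolutelyContinuous _ _).ae_le (ae_restrict_mem E.measurableSet_D)

theorem integral_filteredLaw (hE : E.Admissible) (hp : 0 < E.acceptance) (h : ℝ → ℝ) :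
    ∫ x, h ((x - E.φ₀) / E.σ) ∂E.filteredLaw =
      (∫ y in (-E.leftEnd)..E.rightEnd, dens E.background E.contamination y * h y) /
        ∫ y in (-E.leftEnd)..E.rightEnd, dens E.background E.contamination y := by
  have hm : Measurable fun x => E.noisyDensity x / E.acceptance :=
    E.measurable_noisyDensity.div_const _
  have hc : E.F * E.a₀ / kernelMass E.σ * E.σ ≠ 0 := by
    have := hE.F_pos; have := hE.a_pos; have := kernelMass_pos E.σ; have := hE.σ_pos
    positivity
  rw [filteredLaw, ← acceptance,
    integral_withDensity_eq_integral_toReal_smul hm.ennreal_ofReal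
      (ae_of_all _ fun x => ENNReal.ofReal_lt_top)]
  have h1 : ∀ x, (ENNReal.ofReal (E.noisyDensity x / E.acceptance)).toReal •
      h ((x - E.φ₀) / E.σ) = E.noisyDensity x * h ((x - E.φ₀) / E.σ) / E.acceptance := fun x => by
    rw [ENNReal.toReal_ofReal (div_nonneg (hE.noisyDensity_nonneg x) hp.le), smul_eq_mul]
    ring
  simp_rw [h1]
  rw [integral_div, hE.setIntegral_noisyDensity_mul, hE.acceptance_eq,
    mul_div_mul_left _ _ hc]

theorem leftEnd_add_rightEnd (hE : E.Admissible) : E.σ * (E.leftEnd + E.rightEnd) = E.Δ := by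
  have := hE.σ_pos
  rw [leftEnd, rightEnd]; field_simp; ring

theorem mem_D_iff (hE : E.Admissible) {φ : ℝ} :
    φ ∈ E.D ↔ (φ - E.φ₀) / E.σ ∈ Set.Icc (-E.leftEnd) E.rightEnd := by
  have hσ := hE.σ_pos
  rw [D, Set.mem_Icc, Set.mem_Icc, leftEnd, rightEnd, ← neg_div, div_le_div_iff_of_pos_right hσ,
    div_le_div_iff_of_pos_right hσ]
  constructor <;> rintro ⟨h1, h2⟩ <;> constructor <;> linarith

theorem log_model_eq (hE : E.Admissible) (hβ : 0 ≤ E.background)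
    (hlr : -E.leftEnd < E.rightEnd) {φ x : ℝ} (hφ : φ ∈ E.D) (hx : x ∈ E.D) :
    Real.log (E.model φ x) = crit E.leftEnd E.rightEnd E.background ((φ - E.φ₀) / E.σ)
      ((x - E.φ₀) / E.σ) - Real.log E.σ := by
  have hZ := kernelMass_pos E.σ
  have hF := hE.F_pos
  have ha := hE.a_pos
  have hσ := hE.σ_pos
  set θ := (φ - E.φ₀) / E.σ with hθ
  set y := (x - E.φ₀) / E.σ with hy
  have hsub : ∀ z, (z - φ) / E.σ = (z - E.φ₀) / E.σ - θ := fun z => by rw [hθ]; ring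
  have hnum : E.F * E.a₀ * gaussianKernel E.σ (x - φ) + (1 - E.F) * (1 / (2 * π)) =
      E.F * E.a₀ / kernelMass E.σ * (bell (y - θ) + E.background) := by
    rw [gaussianKernel_of_abs_le (hE.abs_sub_le_pi hx hφ), hsub, background, ← hy]
    field_simp
  have hden : E.F * E.a₀ * (∫ z in E.D, gaussianKernel E.σ (z - φ)) +
      (1 - E.F) * (E.Δ / (2 * π)) = E.F * E.a₀ / kernelMass E.σ *
        (mass E.leftEnd E.rightEnd E.background θ * E.σ) := by
    have h1 : ∫ z in E.D, gaussianKernel E.σ (z - φ) =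
        E.σ * ∫ u in (-E.leftEnd)..E.rightEnd, bell (u - θ) / kernelMass E.σ := by
      rw [← hE.setIntegral_D_comp fun u => bell (u - θ) / kernelMass E.σ]
      refine setIntegral_congr_fun E.measurableSet_D fun z hz => ?_
      rw [gaussianKernel_of_abs_le (hE.abs_sub_le_pi hz hφ), hsub]
    rw [h1, intervalIntegral.integral_div, mass]
    have h2 : (1 - E.F) * (E.Δ / (2 * π)) =
        E.F * E.a₀ / kernelMass E.σ * (E.background * E.Δ) := by
      rw [background]; field_simp
    rw [h2, ← hE.leftEnd_add_rightEnd]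
    field_simp
  have hm := mass_pos hlr hβ θ
  have hc : E.F * E.a₀ / kernelMass E.σ ≠ 0 := by positivity
  rw [model, hnum, hden, mul_div_mul_left _ _ hc,
    Real.log_div (bell_add_pos hβ _).ne' (by positivity), Real.log_mul hm.ne' hσ.ne', crit]
  ring

theorem logLikelihood_eq (hE : E.Admissible) (hβ : 0 ≤ E.background)
    (hlr : -E.leftEnd < E.rightEnd) {M : ℕ} {x : Fin M → ℝ} (hx : ∀ i, x i ∈ E.D) {φ : ℝ}
    (hφ : φ ∈ E.D) :
    E.logLikelihood x φ = empMean (fun x => crit E.leftEnd E.rightEnd E.background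
      ((φ - E.φ₀) / E.σ) ((x - E.φ₀) / E.σ)) x - (M : ℝ)⁻¹ * (M * Real.log E.σ) := by
  rw [logLikelihood, Finset.sum_congr rfl fun i _ => hE.log_model_eq hβ hlr hφ (hx i), empMean,
    Finset.sum_sub_distrib, mul_sub]
  simp

theorem exists_isFMPE (hE : E.Admissible) (hβ : 0 ≤ E.background)
    (hlr : -E.leftEnd < E.rightEnd) : ∃ est, E.IsFMPE est := by
  have key : ∀ M : ℕ, ∃ est : (Fin M → ℝ) → ℝ, Measurable est ∧
      ∀ x : Fin M → ℝ, est x ∈ Set.Icc (E.guess - E.Δ / 2) (E.guess + E.Δ / 2) ∧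
      ∀ φ ∈ Set.Icc (E.guess - E.Δ / 2) (E.guess + E.Δ / 2),
        empMean (fun z => crit E.leftEnd E.rightEnd E.background
          ((φ - E.φ₀) / E.σ) ((z - E.φ₀) / E.σ)) x ≤
        empMean (fun z => crit E.leftEnd E.rightEnd E.background
          ((est x - E.φ₀) / E.σ) ((z - E.φ₀) / E.σ)) x := by
    intro M
    have hc := continuous_crit hlr hβ
    refine exists_measurable_argmax hE.D_nonempty (f := fun x φ =>
      empMean (fun z => crit E.leftEnd E.rightEnd E.background
        ((φ - E.φ₀) / E.σ) ((z - E.φ₀) / E.σ)) x) (fun φ => ?_) fun x => ?_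
    · refine measurable_empMean ?_
      exact ((continuous_section hc _).comp (by fun_prop :
        Continuous fun x : ℝ => (x - E.φ₀) / E.σ)).measurable
    · exact continuous_empMean_standardize hc E.φ₀ E.σ x
  choose est hest using key
  refine ⟨est, fun M => ⟨(hest M).1, fun x hx => ⟨((hest M).2 x).1, fun φ hφ => ?_⟩⟩⟩
  rw [hE.logLikelihood_eq hβ hlr hx hφ, hE.logLikelihood_eq hβ hlr hx ((hest M).2 x).1]
  linarith [((hest M).2 x).2 φ hφ]

theorem isMaximizer_of_isFMPE (hE : E.Admissible) (hβ : 0 ≤ E.background)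
    (hlr : -E.leftEnd < E.rightEnd) (hp : 0 < E.acceptance)
    {est : (M : ℕ) → (Fin M → ℝ) → ℝ} (hest : E.IsFMPE est) (M : ℕ) :
    RegularCriterion.IsMaximizer E.filteredLaw (-E.leftEnd) E.rightEnd
      (fun θ x => crit E.leftEnd E.rightEnd E.background θ ((x - E.φ₀) / E.σ))
      fun x => (est M x - E.φ₀) / E.σ := by
  have := hE.isProbabilityMeasure_filteredLaw hp
  have hσ := hE.σ_pos
  refine ⟨((hest M).1.sub_const _).div_const _, ?_⟩
  filter_upwards [ae_pi_forall (ae_mem_D E) M] with x hx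
  obtain ⟨h1, h2⟩ := (hest M).2 x hx
  refine ⟨hE.mem_D_iff.1 h1, fun θ hθ => ?_⟩
  have hθ' : (E.φ₀ + E.σ * θ - E.φ₀) / E.σ = θ := by field_simp; ring
  have hmem : E.φ₀ + E.σ * θ ∈ E.D := hE.mem_D_iff.2 (by rwa [hθ'])
  have h3 := h2 _ hmem
  rw [hE.logLikelihood_eq hβ hlr hx hmem, hE.logLikelihood_eq hβ hlr hx h1, hθ'] at h3
  linarith

end Admissible

end Experiment

end

end QPE

namespace QPE

/-! ### The asymptotic error of the estimator -/

noncomputable section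

theorem le_abs_toIocMod {δ x : ℝ} (h1 : δ ≤ |x|) (h2 : |x| ≤ 2 * π - δ) :
    δ ≤ |toIocMod Real.two_pi_pos (-π) x| := by
  have hx := toIocMod_add_toIocDiv_zsmul Real.two_pi_pos (-π) x
  set τ := toIocMod Real.two_pi_pos (-π) x
  set k := toIocDiv Real.two_pi_pos (-π) x
  rw [zsmul_eq_mul] at hx
  have h2' := abs_le.1 h2
  have hπ := Real.pi_pos
  rcases lt_trichotomy k 0 with hk | hk | hk
  · have hk' : (k : ℝ) ≤ -1 := by exact_mod_cast Int.le_sub_one_of_lt hk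
    exact le_trans (by nlinarith) (le_abs_self τ)
  · rw [hk] at hx
    simp only [Int.cast_zero, zero_mul, add_zero] at hx
    rwa [hx]
  · have hk' : (1 : ℝ) ≤ k := by exact_mod_cast hk
    exact le_trans (by nlinarith) (neg_le_abs τ)

namespace Experiment

variable {E : Experiment}

theorem measurable_contamination (E : Experiment) : Measurable E.contamination := by
  unfold contamination
  have : Measurable fun x : ℝ => toIocMod Real.two_pi_pos (-π) x := by
    simp_rw [toIocMod_eq_sub_fract_mul]
    exact measurable_const.sub ((measurable_fract.comp (by fun_prop)).mul_const _)
  refine Finset.measurable_sum _ fun j _ => ?_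
  have h2 : Measurable fun y => toIocMod Real.two_pi_pos (-π) (E.φ₀ + E.σ * y - E.phase j) :=
    this.comp (by fun_prop)
  fun_prop

/-- The total mass of the rescaled density. -/
abbrev totalMass (E : Experiment) : ℝ :=
  ∫ y in (-E.leftEnd)..E.rightEnd, dens E.background E.contamination y

namespace Admissible

theorem contamination_nonneg (hE : E.Admissible) (y : ℝ) : 0 ≤ E.contamination y :=
  Finset.sum_nonneg fun j _ => mul_nonneg (div_nonneg (E.weight_nonneg j) hE.a_pos.le)
    (Real.exp_pos _).le

theorem contamination_le (hE : E.Admissible) {y : ℝ}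
    (hy : y ∈ Set.Icc (-E.leftEnd) E.rightEnd) :
    E.contamination y ≤ bell E.margin / E.a₀ := by
  have hσ := hE.σ_pos
  have ha := hE.a_pos
  have hΔ := hE.Δ_pos
  have hx : E.φ₀ + E.σ * y ∈ E.D := by
    rw [hE.mem_D_iff, show (E.φ₀ + E.σ * y - E.φ₀) / E.σ = y by field_simp; ring]
    exact hy
  set x := E.φ₀ + E.σ * y
  have hterm : ∀ j ∈ Finset.univ.erase E.target, E.weight j / E.a₀ *
      Real.exp (-(toIocMod Real.two_pi_pos (-π) (x - E.phase j)) ^ 2 / (2 * E.σ ^ 2)) ≤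
      E.weight j * (bell E.margin / E.a₀) := by
    intro j hj
    have hj' : j ≠ E.target := Finset.ne_of_mem_erase hj
    have h1 := hE.gap j hj'
    have h2 := hE.abs_sub_lt_of_mem hx
    have h3 := hE.D_subset hx
    have h4 := E.phase_mem j
    have h5 : E.Δ / 6 ≤ |x - E.phase j| := by
      have := abs_sub_le (E.phase j) x E.φ₀
      rw [abs_sub_comm (E.phase j) x] at this
      linarith
    have h6 : |x - E.phase j| ≤ 2 * π - E.Δ / 6 := by
      rw [abs_le]; constructor <;> linarith [h3.1, h3.2, h4.1, h4.2]
    have h7 := le_abs_toIocMod h5 h6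
    have h8 : Real.exp (-(toIocMod Real.two_pi_pos (-π) (x - E.phase j)) ^ 2 / (2 * E.σ ^ 2)) ≤
        bell E.margin := by
      rw [exp_eq_bell]
      refine bell_le_bell ?_
      rw [margin, abs_of_pos (show 0 < E.Δ / (6 * E.σ) by positivity), abs_div, abs_of_pos hσ,
        le_div_iff₀ hσ]
      refine le_trans (le_of_eq ?_) h7
      field_simp
    have h9 := E.weight_nonneg j
    calc _ ≤ E.weight j / E.a₀ * bell E.margin := by gcongr
      _ = _ := by ring
  refine (Finset.sum_le_sum hterm).trans ?_
  rw [← Finset.sum_mul]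
  have hw : ∑ j ∈ Finset.univ.erase E.target, E.weight j ≤ 1 := by
    rw [← E.sum_weight]
    exact Finset.sum_le_sum_of_subset_of_nonneg (Finset.erase_subset _ _)
      fun j _ _ => E.weight_nonneg j
  have := bell_pos E.margin
  exact mul_le_of_le_one_left (by positivity) hw

theorem background_nonneg (hE : E.Admissible) : 0 ≤ E.background := by
  have := kernelMass_pos E.σ
  have := hE.F_pos
  have := hE.a_pos
  have h1 : 0 ≤ 1 - E.F := by linarith [hE.F_le]
  have := Real.pi_pos
  rw [background]; positivity

theorem rescaled (hE : E.Admissible) (hR : 2 ≤ E.margin)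
    (hsmall : (1 + E.background) * E.margin ^ 3 * (bell (E.margin - 1) + bell E.margin / E.a₀) ≤
      1 / 10 ^ 30) :
    Rescaled E.leftEnd E.rightEnd E.margin E.background (bell E.margin / E.a₀)
      E.contamination := by
  have hσ := hE.σ_pos
  obtain ⟨h1, h2⟩ := abs_lt.1 hE.guess_close
  have hm : E.margin = E.Δ / 6 / E.σ := by rw [margin, div_div]
  refine ⟨hR, ?_, ?_, ?_, ?_, ?_, hE.background_nonneg, ?_, fun y _ => hE.contamination_nonneg y,
    fun y hy => hE.contamination_le hy, hsmall⟩
  · rw [hm, leftEnd, div_le_div_iff_of_pos_right hσ]; linarith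
  · rw [hm, leftEnd, ← mul_div_assoc, div_le_div_iff_of_pos_right hσ]; linarith
  · rw [hm, rightEnd, div_le_div_iff_of_pos_right hσ]; linarith
  · rw [hm, rightEnd, ← mul_div_assoc, div_le_div_iff_of_pos_right hσ]; linarith
  · rw [hm, leftEnd, rightEnd]; field_simp; ring
  · rw [intervalIntegrable_iff]
    rw [Set.uIoc]
    refine Measure.integrableOn_of_bounded (M := bell E.margin / E.a₀) measure_Ioc_lt_top.ne
      E.measurable_contamination.aestronglyMeasurable ?_
    refine (ae_restrict_mem measurableSet_Ioc).mono fun y hy => ?_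
    have hle : -E.leftEnd ≤ E.rightEnd := by
      rw [leftEnd, rightEnd, ← neg_div, div_le_div_iff_of_pos_right hσ]
      linarith [hE.Δ_pos]
    rw [min_eq_left hle, max_eq_right hle] at hy
    rw [Real.norm_eq_abs, abs_of_nonneg (hE.contamination_nonneg y)]
    exact hE.contamination_le (Set.Ioc_subset_Icc_self hy)

theorem one_le_totalMass {R ρ : ℝ}
    (H : Rescaled E.leftEnd E.rightEnd R E.background ρ E.contamination) :
    1 ≤ E.totalMass := by
  have h1 := H.integral_dens_bounds.1
  have h2 := H.mass_lower (θ := 0) (by simp)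
  have h4 : 0 ≤ R * E.background := mul_nonneg (by linarith [H.two_le]) H.β_nonneg
  linarith

theorem acceptance_pos (hE : E.Admissible) {R ρ : ℝ}
    (H : Rescaled E.leftEnd E.rightEnd R E.background ρ E.contamination) :
    0 < E.acceptance := by
  rw [hE.acceptance_eq]
  have := one_le_totalMass H
  have := hE.F_pos; have := hE.a_pos; have := kernelMass_pos E.σ; have := hE.σ_pos
  positivity

/-- The bias and the variance coefficient of the estimator exist and are bounded in terms of the
margin, the background and the contamination. -/
theorem exists_hasAsymptoticError (hE : E.Admissible) {R ρ : ℝ}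
    (H : Rescaled E.leftEnd E.rightEnd R E.background ρ E.contamination) :
    ∃ b v : ℝ, |b| ≤ E.σ * (1800 * R ^ 2 * ρ * (1 + E.background)) ∧ 0 < v ∧
      v ≤ E.σ ^ 2 * (100000 * (1 + E.background) * E.totalMass) ∧
      ∀ est, E.IsFMPE est → E.HasAsymptoticError est b v := by
  have hp := hE.acceptance_pos H
  have hprob := hE.isProbabilityMeasure_filteredLaw hp
  have hσ := hE.σ_pos
  have hβ := H.β_nonneg
  have hR := H.two_le
  have hT : 1 ≤ E.totalMass := one_le_totalMass H
  have hT0 : 0 < E.totalMass := by linarith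
  obtain ⟨K, hK⟩ := exists_regularCriterion_crit H.neg_lt hβ (ae_mem_D E) E.φ₀ E.σ
  set m : ℝ := 1 / 50 * (1 / (1 + E.background)) / E.totalMass with hm
  have hm0 : 0 < m := by positivity
  have hL : ∀ θ, ∫ x, crit E.leftEnd E.rightEnd E.background θ ((x - E.φ₀) / E.σ) ∂E.filteredLaw =
      (∫ y in (-E.leftEnd)..E.rightEnd, dens E.background E.contamination y *
        crit E.leftEnd E.rightEnd E.background θ y) / E.totalMass := fun θ =>
    hE.integral_filteredLaw hp (crit E.leftEnd E.rightEnd E.background θ)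
  have hL₁ : ∀ θ, ∫ x, crit₁ E.leftEnd E.rightEnd E.background θ ((x - E.φ₀) / E.σ)
      ∂E.filteredLaw = (∫ y in (-E.leftEnd)..E.rightEnd, dens E.background E.contamination y *
        crit₁ E.leftEnd E.rightEnd E.background θ y) / E.totalMass := fun θ =>
    hE.integral_filteredLaw hp (crit₁ E.leftEnd E.rightEnd E.background θ)
  have hL₂ : ∀ θ, ∫ x, crit₂ E.leftEnd E.rightEnd E.background θ ((x - E.φ₀) / E.σ)
      ∂E.filteredLaw = (∫ y in (-E.leftEnd)..E.rightEnd, dens E.background E.contamination y *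
        crit₂ E.leftEnd E.rightEnd E.background θ y) / E.totalMass := fun θ =>
    hE.integral_filteredLaw hp (crit₂ E.leftEnd E.rightEnd E.background θ)
  have hV : ∀ θ, ∫ x, crit₁ E.leftEnd E.rightEnd E.background θ ((x - E.φ₀) / E.σ) ^ 2
      ∂E.filteredLaw = (∫ y in (-E.leftEnd)..E.rightEnd, dens E.background E.contamination y *
        crit₁ E.leftEnd E.rightEnd E.background θ y ^ 2) / E.totalMass := fun θ =>
    hE.integral_filteredLaw hp (fun y => crit₁ E.leftEnd E.rightEnd E.background θ y ^ 2)
  have hconc : ∀ θ, |θ| ≤ 1 / 40000 →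
      ∫ x, crit₂ E.leftEnd E.rightEnd E.background θ ((x - E.φ₀) / E.σ) ∂E.filteredLaw ≤ -m := by
    intro θ hθ
    rw [hL₂, hm, ← neg_div, div_le_div_iff_of_pos_right hT0]
    exact H.integral_dens_mul_crit₂_le hθ
  obtain ⟨θ₀, hθ₀, hscore, hdrift, c, hc, hwell⟩ := exists_quadratic_max (η := 1 / 40000)
    (by linarith [H.le_A] : -E.leftEnd < -(1 / 40000)) (by linarith [H.le_B])
    (by norm_num) hm0 (fun θ hθ => hK.hasDerivAt_integral hθ)
    (fun θ hθ => hK.hasDerivAt_integral₁ hθ) hconc (fun θ hθ hfar => by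
      rw [hL, hL, div_lt_div_iff_of_pos_right hT0]
      exact H.integral_dens_mul_crit_lt hθ hfar)
  set J := -∫ x, crit₂ E.leftEnd E.rightEnd E.background θ₀ ((x - E.φ₀) / E.σ) ∂E.filteredLaw
    with hJ
  have hJm : m ≤ J := by linarith [hconc θ₀ hθ₀]
  have hJ0 : 0 < J := hm0.trans_le hJm
  set V := ∫ x, crit₁ E.leftEnd E.rightEnd E.background θ₀ ((x - E.φ₀) / E.σ) ^ 2 ∂E.filteredLaw
    with hVdef
  have hVpos : 0 < V := by
    rw [hVdef, hV]
    exact div_pos (H.integral_dens_mul_crit₁_sq_pos (by linarith)) hT0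
  have hVle : V ≤ 40 * (1 / (1 + E.background)) / E.totalMass := by
    rw [hVdef, hV, div_le_div_iff_of_pos_right hT0]
    exact H.integral_dens_mul_crit₁_sq_le hθ₀
  have hθIoo : θ₀ ∈ Set.Ioo (-E.leftEnd) E.rightEnd := by
    have := abs_le.1 hθ₀
    constructor <;> linarith [H.le_A, H.le_B]
  refine ⟨E.σ * θ₀, E.σ ^ 2 * (V / J ^ 2), ?_, by positivity, ?_, fun est hest => ?_⟩
  · rw [abs_mul, abs_of_pos hσ]
    refine mul_le_mul_of_nonneg_left ?_ hσ.le
    rw [hL₁, abs_div, abs_of_pos hT0] at hdrift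
    have h1 := H.abs_integral_dens_mul_crit₁_zero_le
    have h2 : m * |θ₀| ≤ 36 * R ^ 2 * ρ / E.totalMass :=
      hdrift.trans ((div_le_div_iff_of_pos_right hT0).2 h1)
    rw [mul_comm, ← le_div_iff₀ hm0] at h2
    refine h2.trans (le_of_eq ?_)
    rw [hm]; field_simp; ring
  · refine mul_le_mul_of_nonneg_left ?_ (by positivity)
    calc V / J ^ 2 ≤ (40 * (1 / (1 + E.background)) / E.totalMass) / m ^ 2 := by gcongr
      _ = 100000 * (1 + E.background) * E.totalMass := by rw [hm]; field_simp; ring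
  · have hmax := hE.isMaximizer_of_isFMPE hβ H.neg_lt hp hest
    obtain ⟨h1, h2⟩ := hK.tendsto_bias_and_mse hθIoo hc hwell hscore hJ0
      (by rw [hJ, neg_neg]) (fun M _ => hmax M)
    have hprobM : ∀ M, IsProbabilityMeasure (E.samplesLaw M) := fun M => by
      unfold Experiment.samplesLaw; infer_instance
    have hLp : ∀ M, MemLp (fun x => (est M x - E.φ₀) / E.σ) 2 (E.samplesLaw M) := fun M =>
      (hmax M).memLp
    have hest_eq : ∀ M x, est M x = E.σ * ((est M x - E.φ₀) / E.σ) + E.φ₀ := fun M x => by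
      field_simp; ring
    have hmean : ∀ M, ∫ x, est M x ∂E.samplesLaw M =
        E.σ * (∫ x, (est M x - E.φ₀) / E.σ ∂E.samplesLaw M) + E.φ₀ := fun M => by
      conv_lhs => enter [2, x]; rw [hest_eq]
      rw [integral_add (((hLp M).integrable (by norm_num)).const_mul _) (integrable_const _),
        integral_const_mul]
      simp
    have hb : E.σ * θ₀ = (E.φ₀ + E.σ * θ₀) - E.φ₀ := by ring
    rw [hb]
    refine E.hasAsymptoticError (by positivity) (fun M _ => ?_) ?_ ?_
    · have := ((hLp M).const_mul E.σ).add (memLp_const E.φ₀)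
      refine this.ae_eq (ae_of_all _ fun x => ?_)
      simp only [Pi.add_apply]
      exact (hest_eq M x).symm
    · have h3 := h1.const_mul E.σ
      rw [mul_zero] at h3
      refine h3.congr fun M => ?_
      rw [hmean, samplesLaw]; ring
    · refine (h2.const_mul (E.σ ^ 2)).congr fun M => ?_
      rw [samplesLaw, mul_left_comm, ← integral_const_mul]
      congr 2; funext x
      field_simp
      ring

end Admissible

end Experiment

end

end QPE

namespace QPE

/-! ### The number of samples and of calls -/

noncomputable section

namespace Experiment.Admissible

variable {E : Experiment}

theorem acceptance_le_one (hE : E.Admissible) : E.acceptance ≤ 1 := by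
  have := hE.isProbabilityMeasure_shotLaw
  have h := hE.shotLaw_apply E.measurableSet_D hE.D_subset'
  rw [← acceptance] at h
  have h1 : ENNReal.ofReal E.acceptance ≤ 1 := h ▸ prob_le_one
  rwa [ENNReal.ofReal_le_one] at h1

theorem totalMass_le (hE : E.Admissible) {R ρ : ℝ}
    (H : Rescaled E.leftEnd E.rightEnd R E.background ρ E.contamination) :
    E.totalMass ≤ 3 / (E.F * E.a₀) * E.acceptance := by
  have hT := one_le_totalMass H
  have hF := hE.F_pos
  have ha := hE.a_pos
  have hZ := kernelMass_pos E.σ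
  have hZ' := kernelMass_le hE.σ_pos
  rw [hE.acceptance_eq]
  have h1 : 3 / (E.F * E.a₀) * (E.F * E.a₀ / kernelMass E.σ * E.σ * E.totalMass) =
      3 * E.σ / kernelMass E.σ * E.totalMass := by field_simp
  rw [h1]
  exact le_mul_of_one_le_left (by linarith) ((one_le_div hZ).2 hZ')

theorem acceptance_ge (hE : E.Admissible) {R ρ : ℝ}
    (H : Rescaled E.leftEnd E.rightEnd R E.background ρ E.contamination) :
    1 ≤ 3 / (E.F * E.a₀) * E.acceptance :=
  (one_le_totalMass H).trans (hE.totalMass_le H)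

theorem background_le (hE : E.Admissible) :
    E.background ≤ E.σ / (E.F * E.a₀) := by
  have hF := hE.F_pos
  have ha := hE.a_pos
  have hσ := hE.σ_pos
  have hZ := kernelMass_pos E.σ
  have hZ' := kernelMass_le hσ
  have hπ := Real.pi_gt_three
  rw [background, div_le_div_iff_of_pos_right (by positivity)]
  have h1 : (1 - E.F) * (1 / (2 * π)) ≤ 1 / 6 := by
    rw [mul_one_div, div_le_iff₀ (by positivity)]
    linarith
  calc _ ≤ 1 / 6 * kernelMass E.σ := by gcongr
    _ ≤ E.σ := by linarith

/-- The estimator attains root mean square error `ε` with about `m₀` times the acceptance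
probability samples as soon as its bias is at most `ε / 2` and `m₀` is large enough. -/
theorem attainsRMSE (hE : E.Admissible) {R ρ : ℝ}
    (H : Rescaled E.leftEnd E.rightEnd R E.background ρ E.contamination) {t : ℕ} (ht : 1 ≤ t)
    {ε m₀ m T : ℝ} (hε : 0 < ε)
    (hbias : E.σ * (1800 * R ^ 2 * ρ * (1 + E.background)) ≤ ε / 2)
    (hm₀ : 800000 * E.σ ^ 2 * (1 + E.background) ≤ m₀ * (E.F * E.a₀ * ε ^ 2))
    (hone : ε * t ≤ 1 → 3 / (E.F * E.a₀) ≤ m₀) (hm : m₀ ≤ m) (hT : m₀ * t ≤ T) :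
    E.AttainsRMSE t ε m T := by
  have hp := hE.acceptance_pos H
  have hp1 := hE.acceptance_le_one
  have hF := hE.F_pos
  have ha := hE.a_pos
  have hβ := H.β_nonneg
  have hσ := hE.σ_pos
  have htR : (1 : ℝ) ≤ t := by exact_mod_cast ht
  refine ⟨hE.exists_isFMPE H.β_nonneg H.neg_lt, fun est hest => ?_⟩
  obtain ⟨b, v, hb, hv, hv', hasy⟩ := hE.exists_hasAsymptoticError H
  set p := E.acceptance with hpdef
  have hvm : v ≤ 3 / 8 * (m₀ * p) * ε ^ 2 := by
    refine hv'.trans ?_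
    have h1 := hE.totalMass_le H
    calc E.σ ^ 2 * (100000 * (1 + E.background) * E.totalMass)
        ≤ E.σ ^ 2 * (100000 * (1 + E.background) * (3 / (E.F * E.a₀) * p)) := by gcongr
      _ = 3 / 8 * (800000 * E.σ ^ 2 * (1 + E.background)) * (p / (E.F * E.a₀)) := by
        field_simp; ring
      _ ≤ 3 / 8 * (m₀ * (E.F * E.a₀ * ε ^ 2)) * (p / (E.F * E.a₀)) := by gcongr
      _ = _ := by field_simp
  have hm₀pos : 0 < m₀ * p := by
    by_contra hcon
    push Not at hcon
    nlinarith [mul_nonneg (neg_nonneg.2 hcon) (sq_nonneg ε)]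
  have hm₀0 : 0 < m₀ := pos_of_mul_pos_left hm₀pos hp.le
  have hgood : ∀ M : ℕ, 1 ≤ M → m₀ * p / 2 ≤ M → √(b ^ 2 + v / M) ≤ ε := fun M hM hle => by
    have hM' : (0 : ℝ) < M := by exact_mod_cast hM
    have h1 : b ^ 2 ≤ (ε / 2) ^ 2 := by
      rw [← sq_abs b]
      have := hb.trans hbias
      gcongr
    have h2 : v / M ≤ 3 / 4 * ε ^ 2 := by
      rw [div_le_iff₀ hM']
      nlinarith [mul_le_mul_of_nonneg_right hle (sq_nonneg ε)]
    rw [Real.sqrt_le_left hε.le]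
    linarith
  have hmp : m₀ * p ≤ m₀ := mul_le_of_le_one_right hm₀0.le hp1
  have hcalls : ∀ M : ℕ, E.expectedCalls t M = ENNReal.ofReal (t * (M / p)) := fun M =>
    hE.expectedCalls_eq hp t M
  refine ⟨b, v, hasy est hest, fun M hM hle => hgood M hM ?_, ?_⟩
  · rw [hcalls, ENNReal.ofReal_le_ofReal_iff (by positivity)] at hle
    have h1 : m₀ * t ≤ M / p * t := by linarith
    have h2 := le_of_mul_le_mul_right h1 (by linarith)
    rw [le_div_iff₀ hp] at h2
    linarith
  · set M := max 1 ⌊m₀ * p⌋₊ with hMdef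
    have hM1 : 1 ≤ M := le_max_left _ _
    have hfl := Nat.lt_floor_add_one (m₀ * p)
    have hfl' := Nat.floor_le hm₀pos.le
    have hMf : ((⌊m₀ * p⌋₊ : ℕ) : ℝ) ≤ M := by exact_mod_cast le_max_right _ _
    have hM1' : (1 : ℝ) ≤ M := by exact_mod_cast hM1
    have hMle : (M : ℝ) ≤ m₀ * p + 1 := by
      rw [hMdef, Nat.cast_max]
      exact max_le (by simp; linarith) (by linarith)
    refine ⟨M, hM1, hgood M hM1 (by linarith), by linarith, ?_, fun hεt => ?_⟩
    · rw [hcalls, hcalls, ← ENNReal.ofReal_add (by nlinarith) (by positivity)]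
      refine ENNReal.ofReal_le_ofReal ?_
      calc (t : ℝ) * (M / p) ≤ t * ((m₀ * p + 1) / p) := by gcongr
        _ = m₀ * t + t * ((1 : ℕ) / p) := by push_cast; field_simp
        _ ≤ _ := by linarith
    · have h1 : 1 ≤ m₀ * p := (hE.acceptance_ge H).trans
        (mul_le_mul_of_nonneg_right (hone hεt) hp.le)
      have hMle' : (M : ℝ) ≤ m₀ * p := by
        rw [hMdef, Nat.cast_max]
        exact max_le (by simpa using h1) hfl'
      refine ⟨by linarith, ?_⟩
      rw [hcalls]
      refine ENNReal.ofReal_le_ofReal ?_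
      calc (t : ℝ) * (M / p) ≤ t * ((m₀ * p) / p) := by gcongr
        _ = m₀ * t := by field_simp
        _ ≤ _ := hT

end Experiment.Admissible

end

end QPE

namespace QPE

/-! ### Admissible depths -/

noncomputable section

/-- The standing assumptions on the problem, the guess, the noise rate and the accuracy. -/
structure PhaseProblem.Setting (S : PhaseProblem) (Δ guess γ ε : ℝ) : Prop where
  Δ_pos : 0 < Δ
  Δ_le : Δ ≤ π
  gap : ∀ j, j ≠ S.target → Δ < |S.phase j - S.φ₀|
  guess_close : |S.φ₀ - guess| < Δ / 3
  subset : Set.Icc (guess - Δ / 2) (guess + Δ / 2) ⊆ Set.Ico (Δ / 6) (2 * π - Δ / 6)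
  a_pos : 0 < S.a₀
  γ_nonneg : 0 ≤ γ
  ε_pos : 0 < ε
  ε_le : ε ≤ 1 / 2

theorem PhaseProblem.a₀_le_one (S : PhaseProblem) : S.a₀ ≤ 1 := by
  rw [← S.sum_weight]
  exact Finset.single_le_sum (f := S.weight) (fun j _ => S.weight_nonneg j)
    (Finset.mem_univ S.target)

theorem tendsto_cube_mul_bell :
    Tendsto (fun R : ℝ => R ^ 3 * (bell (R - 1) * Real.exp (R ^ 2 / 4))) atTop (𝓝 0) := by
  have h1 := Real.tendsto_pow_mul_exp_neg_atTop_nhds_zero 3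
  have h2 := h1.const_mul (Real.exp 4)
  rw [mul_zero] at h2
  refine tendsto_of_tendsto_of_tendsto_of_le_of_le' tendsto_const_nhds h2
    ((eventually_ge_atTop 0).mono fun R hR => ?_) ((eventually_ge_atTop 0).mono fun R hR => ?_)
  · have := bell_pos (R - 1); positivity
  · have h3 : bell (R - 1) * Real.exp (R ^ 2 / 4) ≤ Real.exp 4 * Real.exp (-R) := by
      rw [bell, ← Real.exp_add, ← Real.exp_add, Real.exp_le_exp]
      nlinarith [sq_nonneg (R - 4)]
    calc R ^ 3 * (bell (R - 1) * Real.exp (R ^ 2 / 4))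
        ≤ R ^ 3 * (Real.exp 4 * Real.exp (-R)) := by gcongr
      _ = _ := by ring

theorem Experiment.Admissible.one_add_background_le {E : Experiment} (hE : E.Admissible) {κ : ℝ}
    (hσκ : E.σ ≤ κ) : 1 + E.background ≤ (1 + κ) / (E.F * E.a₀) := by
  have hF := hE.F_pos
  have ha := hE.a_pos
  have hFa : E.F * E.a₀ ≤ 1 := mul_le_one₀ hE.F_le ha.le E.a₀_le_one
  have h1 := hE.background_le
  have h2 : E.σ / (E.F * E.a₀) ≤ κ / (E.F * E.a₀) := by gcongr
  have h3 : 1 ≤ 1 / (E.F * E.a₀) := (one_le_div (by positivity)).2 hFa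
  rw [add_div]; linarith

/-- If the Gaussian tail at the margin is small, the contamination and the bias are negligible. -/
theorem Experiment.Admissible.rescaled_and_bias_le {E : Experiment} (hE : E.Admissible) {κ ε : ℝ}
    (hε : 0 < ε) (hε2 : ε ≤ 1 / 2) (hσκ : E.σ ≤ κ) (hR2 : 2 ≤ E.margin)
    (hcube : E.margin ^ 3 * bell (E.margin - 1) ≤
      1 / (10 ^ 31 * (1 + κ) ^ 2) * (E.F * E.a₀ * ε) ^ 2) :
    Rescaled E.leftEnd E.rightEnd E.margin E.background (bell E.margin / E.a₀)
        E.contamination ∧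
      E.σ * (1800 * E.margin ^ 2 * (bell E.margin / E.a₀) * (1 + E.background)) ≤ ε / 2 := by
  have hF := hE.F_pos
  have hF1 := hE.F_le
  have ha := hE.a_pos
  have ha1 : E.a₀ ≤ 1 := E.a₀_le_one
  have hσ := hE.σ_pos
  have hκ : 0 < κ := hσ.trans_le hσκ
  have hβ := hE.background_nonneg
  have hβle := hE.one_add_background_le hσκ
  have hbell : bell E.margin ≤ bell (E.margin - 1) := bell_le_bell (by
    rw [abs_of_nonneg (by linarith), abs_of_nonneg (by linarith)]; linarith)
  have hb1 := bell_pos (E.margin - 1)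
  have hb0 := bell_pos E.margin
  set δ : ℝ := 1 / (10 ^ 31 * (1 + κ) ^ 2) with hδ
  have hδ0 : 0 < δ := by positivity
  clear_value δ
  have hmain : (1 + E.background) * (E.margin ^ 3 * (bell (E.margin - 1) / E.a₀)) ≤
      (1 + κ) * δ * ε ^ 2 := by
    calc (1 + E.background) * (E.margin ^ 3 * (bell (E.margin - 1) / E.a₀))
        = (1 + E.background) * ((E.margin ^ 3 * bell (E.margin - 1)) / E.a₀) := by ring
      _ ≤ (1 + κ) / (E.F * E.a₀) * (δ * (E.F * E.a₀ * ε) ^ 2 / E.a₀) := by gcongr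
      _ = (1 + κ) * δ * ε ^ 2 * E.F := by field_simp
      _ ≤ (1 + κ) * δ * ε ^ 2 := mul_le_of_le_one_right (by positivity) hF1
  have hδκ : (1 + κ) ^ 2 * δ = 1 / 10 ^ 31 := by rw [hδ]; field_simp
  have hε4 : ε ^ 2 ≤ ε / 2 := by nlinarith
  have hδ1 : (1 + κ) * δ ≤ 1 / 10 ^ 31 := by rw [← hδκ]; gcongr; nlinarith
  refine ⟨hE.rescaled hR2 ?_, ?_⟩
  · have h1 : bell (E.margin - 1) + bell E.margin / E.a₀ ≤ 2 * (bell (E.margin - 1) / E.a₀) := by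
      have h2 : bell (E.margin - 1) ≤ bell (E.margin - 1) / E.a₀ :=
        le_div_self hb1.le ha ha1
      have h3 : bell E.margin / E.a₀ ≤ bell (E.margin - 1) / E.a₀ := by gcongr
      linarith
    calc _ ≤ (1 + E.background) * E.margin ^ 3 * (2 * (bell (E.margin - 1) / E.a₀)) := by gcongr
      _ = 2 * ((1 + E.background) * (E.margin ^ 3 * (bell (E.margin - 1) / E.a₀))) := by ring
      _ ≤ 2 * ((1 + κ) * δ * ε ^ 2) := by gcongr
      _ ≤ 2 * (1 / 10 ^ 31 * 1) := by gcongr; linarith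
      _ ≤ _ := by norm_num
  · have h1 : E.margin ^ 2 ≤ E.margin ^ 3 := by gcongr <;> linarith
    calc E.σ * (1800 * E.margin ^ 2 * (bell E.margin / E.a₀) * (1 + E.background))
        ≤ κ * (1800 * E.margin ^ 3 * (bell (E.margin - 1) / E.a₀) * (1 + E.background)) := by
          gcongr
      _ = 1800 * κ *
          ((1 + E.background) * (E.margin ^ 3 * (bell (E.margin - 1) / E.a₀))) := by ring
      _ ≤ 1800 * κ * ((1 + κ) * δ * ε ^ 2) := by gcongr
      _ ≤ 1800 * (1 + κ) * ((1 + κ) * δ * ε ^ 2) := by gcongr; linarith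
      _ = 1800 * ((1 + κ) ^ 2 * δ) * ε ^ 2 := by ring
      _ ≤ ε / 2 := by rw [hδκ]; nlinarith

namespace PhaseProblem.Setting

variable {S : PhaseProblem} {Δ guess γ ε : ℝ}

theorem admissible (h : S.Setting Δ guess γ ε) {t : ℕ} {σ : ℝ} (hσ : 0 < σ) :
    (S.experiment guess Δ γ t σ).Admissible where
  Δ_pos := h.Δ_pos
  Δ_le := h.Δ_le
  gap := h.gap
  guess_close := h.guess_close
  D_subset := h.subset
  a_pos := h.a_pos
  F_pos := Real.exp_pos _
  F_le := Real.exp_le_one_iff.2 (by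
    have := mul_nonneg h.γ_nonneg (Nat.cast_nonneg (α := ℝ) t)
    linarith)
  σ_pos := hσ

theorem half_le_log (h : S.Setting Δ guess γ ε) : 1 / 2 ≤ Real.log (S.a₀⁻¹ * ε⁻¹) := by
  have ha := h.a_pos
  have hε := h.ε_pos
  have h1 : 1 ≤ S.a₀⁻¹ := (one_le_inv₀ ha).2 S.a₀_le_one
  have h2 : 2 ≤ ε⁻¹ := by rw [le_inv_comm₀ two_pos hε]; linarith [h.ε_le]
  have h3 : Real.log 2 ≤ Real.log (S.a₀⁻¹ * ε⁻¹) := Real.log_le_log two_pos (by nlinarith)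
  linarith [Real.log_two_gt_d9]

theorem le_mul_depth (h : S.Setting Δ guess γ ε) {C : ℝ} {t : ℕ}
    (ht : DepthOK C Δ γ S.a₀ ε t) :
    C * (γ * Δ⁻¹ + Real.log (S.a₀⁻¹ * ε⁻¹)) ≤ Δ * t := by
  have hΔ := h.Δ_pos
  have h1 := mul_le_mul_of_nonneg_left ht hΔ.le
  refine le_trans (le_of_eq ?_) h1
  field_simp

/-- For an admissible depth the squared margin dominates the noise and the accuracy. -/
theorem exp_margin_le (h : S.Setting Δ guess γ ε) {C κ : ℝ} (hκ : 0 < κ) (hC2 : 2 ≤ C)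
    (hC : 576 * κ ^ 2 ≤ C) {t : ℕ} {σ : ℝ} (hσ : 0 < σ) (hσκ : σ * t ≤ κ)
    (ht : DepthOK C Δ γ S.a₀ ε t) :
    C / (12 * κ) ≤ Δ / (6 * σ) ∧
    Real.exp (-((Δ / (6 * σ)) ^ 2 / 4)) ≤ (Real.exp (-γ * t) * S.a₀ * ε) ^ 2 := by
  have hΔ := h.Δ_pos
  have ha := h.a_pos
  have hε := h.ε_pos
  have hγ := h.γ_nonneg
  have hlog := h.half_le_log
  set Λ := Real.log (S.a₀⁻¹ * ε⁻¹) with hΛ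
  have hd := h.le_mul_depth ht
  have ht0 : (0 : ℝ) ≤ t := Nat.cast_nonneg t
  have hγΔ : 0 ≤ γ * Δ⁻¹ := by positivity
  have hCΛ : C * Λ ≤ Δ * t := by nlinarith
  have hΔt : C / 2 ≤ Δ * t := by nlinarith
  have hmar : Δ * t / (6 * κ) ≤ Δ / (6 * σ) := by
    rw [div_le_div_iff₀ (by positivity) (by positivity)]
    nlinarith
  refine ⟨?_, ?_⟩
  · refine le_trans ?_ hmar
    rw [div_le_div_iff₀ (by positivity) (by positivity)]
    nlinarith [mul_le_mul_of_nonneg_right hΔt hκ.le]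
  · have h1 : C * (γ * t) ≤ (Δ * t) ^ 2 := by
      have h2 : C * (γ * Δ⁻¹) ≤ Δ * t := by nlinarith
      have h3 := mul_le_mul_of_nonneg_right h2 (mul_nonneg hΔ.le ht0)
      calc C * (γ * t) = C * (γ * Δ⁻¹) * (Δ * t) := by field_simp
        _ ≤ _ := by linarith
    have h2 : C * Λ ≤ (Δ * t) ^ 2 := hCΛ.trans (le_self_pow₀ (by linarith) two_ne_zero)
    have h3 : (Δ * t / (6 * κ)) ^ 2 ≤ (Δ / (6 * σ)) ^ 2 := by gcongr
    have h4 : 8 * (γ * t + Λ) ≤ (Δ * t / (6 * κ)) ^ 2 := by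
      rw [div_pow, le_div_iff₀ (by positivity)]
      have h5 : 576 * κ ^ 2 * (γ * t + Λ) ≤ C * (γ * t + Λ) := by gcongr
      nlinarith
    have h6 : (Real.exp (-γ * t) * S.a₀ * ε) ^ 2 = Real.exp (-(2 * (γ * t + Λ))) := by
      have h7 : S.a₀ * ε = Real.exp (-Λ) := by
        rw [hΛ, ← Real.log_inv, Real.exp_log (by positivity)]
        field_simp
      rw [mul_assoc, h7, ← Real.exp_add, sq, ← Real.exp_add]
      congr 1; ring
    rw [h6, Real.exp_le_exp]
    linarith

/-- For depths satisfying the depth condition with a large constant, the contamination by the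
other phases and the bias are negligible. -/
theorem exists_depth_constant {κ : ℝ} (hκ : 0 < κ) : ∃ C₁ : ℝ, 2 ≤ C₁ ∧
    ∀ {S : PhaseProblem} {Δ guess γ ε : ℝ}, S.Setting Δ guess γ ε → ∀ {C : ℝ}, C₁ ≤ C →
    ∀ {t : ℕ} {σ : ℝ}, 1 ≤ t → 0 < σ → σ * t ≤ κ → DepthOK C Δ γ S.a₀ ε t →
      let E := S.experiment guess Δ γ t σ
      Rescaled E.leftEnd E.rightEnd E.margin E.background (bell E.margin / E.a₀)
        E.contamination ∧
      E.σ * (1800 * E.margin ^ 2 * (bell E.margin / E.a₀) * (1 + E.background)) ≤ ε / 2 := by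
  obtain ⟨R₀, hR₀⟩ := eventually_atTop.1 (tendsto_cube_mul_bell.eventually_le_const
    (show (0 : ℝ) < 1 / (10 ^ 31 * (1 + κ) ^ 2) by positivity))
  refine ⟨max (max 2 (576 * κ ^ 2)) (12 * κ * max 2 R₀),
    le_trans (le_max_left _ _) (le_max_left _ _), ?_⟩
  intro S Δ guess γ ε h C hC t σ ht hσ hσκ hdepth E
  have hC2 : 2 ≤ C := le_trans (le_trans (le_max_left _ _) (le_max_left _ _)) hC
  have hC3 : 576 * κ ^ 2 ≤ C := le_trans (le_trans (le_max_right _ _) (le_max_left _ _)) hC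
  have hC4 : 12 * κ * max 2 R₀ ≤ C := le_trans (le_max_right _ _) hC
  obtain ⟨hmar, hexp⟩ := h.exp_margin_le hκ hC2 hC3 hσ hσκ hdepth
  have hE : E.Admissible := h.admissible hσ
  have hRdef : E.margin = Δ / (6 * σ) := rfl
  have hR : max 2 R₀ ≤ E.margin := by
    rw [hRdef]
    refine le_trans ?_ hmar
    rw [le_div_iff₀ (by positivity)]; linarith
  have hR2 : 2 ≤ E.margin := (le_max_left _ _).trans hR
  have hsm := hR₀ _ ((le_max_right _ _).trans hR)
  have htR : (1 : ℝ) ≤ t := by exact_mod_cast ht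
  have hσle : σ ≤ κ := le_trans (le_mul_of_one_le_right hσ.le htR) hσκ
  have hexp' : Real.exp (-(E.margin ^ 2 / 4)) ≤ (E.F * E.a₀ * ε) ^ 2 := hexp
  refine hE.rescaled_and_bias_le h.ε_pos h.ε_le hσle hR2 ?_
  have hb1 := bell_pos (E.margin - 1)
  clear_value E
  calc E.margin ^ 3 * bell (E.margin - 1)
      = E.margin ^ 3 * (bell (E.margin - 1) * Real.exp (E.margin ^ 2 / 4)) *
        Real.exp (-(E.margin ^ 2 / 4)) := by
        rw [mul_assoc, mul_assoc, ← Real.exp_add]; simp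
    _ ≤ _ := by gcongr

end PhaseProblem.Setting

end

end QPE

namespace QPE

/-! ### The cost at an admissible depth and its optimisation -/

noncomputable section

namespace PhaseProblem.Setting

variable {S : PhaseProblem} {Δ guess γ ε : ℝ}

theorem attainsRMSE (h : S.Setting Δ guess γ ε) {κ : ℝ} {t : ℕ} {σ : ℝ} (ht : 1 ≤ t) (hσ : 0 < σ)
    (hσκ : σ * t ≤ κ)
    (hreg : let E := S.experiment guess Δ γ t σ
      Rescaled E.leftEnd E.rightEnd E.margin E.background (bell E.margin / E.a₀)
        E.contamination ∧
      E.σ * (1800 * E.margin ^ 2 * (bell E.margin / E.a₀) * (1 + E.background)) ≤ ε / 2)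
    {m T : ℝ}
    (hm : 10 ^ 7 * (1 + κ) ^ 3 *
      ((S.a₀ ^ 2)⁻¹ * ((t : ℝ) ^ 2)⁻¹ * (ε ^ 2)⁻¹ * Real.exp (2 * γ * t)) ≤ m)
    (hT : 10 ^ 7 * (1 + κ) ^ 3 *
      ((ε ^ 2)⁻¹ * (t : ℝ)⁻¹ * Real.exp (2 * γ * t) * (S.a₀ ^ 2)⁻¹) ≤ T) :
    (S.experiment guess Δ γ t σ).AttainsRMSE t ε m T := by
  obtain ⟨H, hbias⟩ := hreg
  have hE : (S.experiment guess Δ γ t σ).Admissible := h.admissible hσ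
  have htR : (1 : ℝ) ≤ t := by exact_mod_cast ht
  have ha := h.a_pos
  have hε := h.ε_pos
  have hκ : 0 < κ := lt_of_lt_of_le (by positivity) hσκ
  have hσt : σ ≤ κ / t := (le_div_iff₀ (by linarith)).2 hσκ
  have hσle : σ ≤ κ := le_trans (le_mul_of_one_le_right hσ.le htR) hσκ
  have hβ := hE.one_add_background_le (κ := κ) hσle
  set β := (S.experiment guess Δ γ t σ).background
  have hβ0 : 0 ≤ β := hE.background_nonneg
  set F := Real.exp (-γ * t) with hF
  have hF0 : 0 < F := Real.exp_pos _
  have hF1 : F ≤ 1 := hE.F_le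
  have hF2 : Real.exp (2 * γ * t) = (F ^ 2)⁻¹ := by
    rw [hF, ← Real.exp_nat_mul, ← Real.exp_neg]; congr 1; push_cast; ring
  rw [hF2] at hm hT
  change 1 + β ≤ (1 + κ) / (F * S.a₀) at hβ
  refine hE.attainsRMSE H ht hε hbias (m₀ := 10 ^ 7 * (1 + κ) ^ 3 *
      ((S.a₀ ^ 2)⁻¹ * ((t : ℝ) ^ 2)⁻¹ * (ε ^ 2)⁻¹ * (F ^ 2)⁻¹)) ?_ ?_ hm (le_trans (le_of_eq ?_) hT)
  · change 800000 * σ ^ 2 * (1 + β) ≤ _ * (F * S.a₀ * ε ^ 2)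
    calc 800000 * σ ^ 2 * (1 + β) ≤ 800000 * (κ / t) ^ 2 * ((1 + κ) / (F * S.a₀)) := by gcongr
      _ = 800000 * κ ^ 2 * (1 + κ) * (1 / (t ^ 2 * F * S.a₀)) := by field_simp
      _ ≤ 10 ^ 7 * (1 + κ) ^ 3 * (1 / (t ^ 2 * F * S.a₀)) := by
        refine mul_le_mul_of_nonneg_right ?_ (by positivity)
        nlinarith [pow_pos hκ 2, pow_pos hκ 3]
      _ = _ := by field_simp
  · intro hεt
    change 3 / (F * S.a₀) ≤ _
    have h1 : F * S.a₀ ≤ 1 := mul_le_one₀ hF1 ha.le S.a₀_le_one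
    have h2 : (ε * t) ^ 2 ≤ 1 := pow_le_one₀ (by positivity) hεt
    have h3 : (3 : ℝ) ≤ 10 ^ 7 * (1 + κ) ^ 3 := by nlinarith [pow_pos hκ 2, pow_pos hκ 3]
    have h4 : 10 ^ 7 * (1 + κ) ^ 3 *
        ((S.a₀ ^ 2)⁻¹ * ((t : ℝ) ^ 2)⁻¹ * (ε ^ 2)⁻¹ * (F ^ 2)⁻¹) =
        10 ^ 7 * (1 + κ) ^ 3 / ((F * S.a₀) * ((F * S.a₀) * (ε * t) ^ 2)) := by field_simp
    rw [h4]
    have h5 : (F * S.a₀) * (ε * t) ^ 2 ≤ 1 := mul_le_one₀ h1 (by positivity) h2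
    have h6 : (F * S.a₀) * ((F * S.a₀) * (ε * t) ^ 2) ≤ F * S.a₀ :=
      mul_le_of_le_one_right (by positivity) h5
    gcongr
  · field_simp

theorem attainsRMSE_of_le_one (h : S.Setting Δ guess γ ε) {κ : ℝ} {t : ℕ} {σ : ℝ} (ht : 1 ≤ t)
    (hσ : 0 < σ) (hσκ : σ * t ≤ κ)
    (hreg : let E := S.experiment guess Δ γ t σ
      Rescaled E.leftEnd E.rightEnd E.margin E.background (bell E.margin / E.a₀)
        E.contamination ∧
      E.σ * (1800 * E.margin ^ 2 * (bell E.margin / E.a₀) * (1 + E.background)) ≤ ε / 2)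
    (hγt : γ * t ≤ 1) (hat : 1 ≤ S.a₀ * t) {m T : ℝ}
    (hm : 10 ^ 7 * (1 + κ) ^ 3 * (S.a₀⁻¹ * ((t : ℝ) ^ 2)⁻¹ * (ε ^ 2)⁻¹) ≤ m)
    (hT : 10 ^ 7 * (1 + κ) ^ 3 * (S.a₀⁻¹ * (t : ℝ)⁻¹ * (ε ^ 2)⁻¹) ≤ T) :
    (S.experiment guess Δ γ t σ).AttainsRMSE t ε m T := by
  obtain ⟨H, hbias⟩ := hreg
  have hE : (S.experiment guess Δ γ t σ).Admissible := h.admissible hσ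
  have htR : (1 : ℝ) ≤ t := by exact_mod_cast ht
  have ha := h.a_pos
  have hε := h.ε_pos
  have hκ : 0 < κ := lt_of_lt_of_le (by positivity) hσκ
  have hσt : σ ≤ κ / t := (le_div_iff₀ (by linarith)).2 hσκ
  have hβ := hE.background_le
  set β := (S.experiment guess Δ γ t σ).background
  have hβ0 : 0 ≤ β := hE.background_nonneg
  set F := Real.exp (-γ * t) with hF
  have hF0 : 0 < F := Real.exp_pos _
  have hF1 : 1 ≤ 3 * F := by
    have h1 : Real.exp (-1) ≤ F := Real.exp_le_exp.2 (by linarith)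
    have h2 : Real.exp 1 * Real.exp (-1) = 1 := by rw [← Real.exp_add]; simp
    have h3 := Real.exp_one_lt_three
    nlinarith [Real.exp_pos (-1)]
  change β ≤ σ / (F * S.a₀) at hβ
  have hβ' : 1 + β ≤ 3 * (1 + κ) := by
    have h1 : σ / (F * S.a₀) ≤ 3 * κ := by
      rw [div_le_iff₀ (by positivity)]
      have h2 : σ ≤ κ * S.a₀ := by
        have h3 := mul_le_mul_of_nonneg_left hat hσ.le
        have h4 := mul_le_mul_of_nonneg_right hσκ ha.le
        nlinarith
      have h5 := mul_le_mul_of_nonneg_left hF1 (mul_nonneg hκ.le ha.le)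
      nlinarith
    linarith
  refine hE.attainsRMSE H ht hε hbias (m₀ := 10 ^ 7 * (1 + κ) ^ 3 *
      (S.a₀⁻¹ * ((t : ℝ) ^ 2)⁻¹ * (ε ^ 2)⁻¹)) ?_ ?_ hm (le_trans (le_of_eq ?_) hT)
  · change 800000 * σ ^ 2 * (1 + β) ≤ _ * (F * S.a₀ * ε ^ 2)
    calc 800000 * σ ^ 2 * (1 + β) ≤ 800000 * (κ / t) ^ 2 * (3 * (1 + κ)) := by gcongr
      _ ≤ 800000 * (κ / t) ^ 2 * (3 * (1 + κ)) * (3 * F) :=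
        le_mul_of_one_le_right (by positivity) hF1
      _ = 7200000 * κ ^ 2 * (1 + κ) * (F / t ^ 2) := by field_simp; ring
      _ ≤ 10 ^ 7 * (1 + κ) ^ 3 * (F / t ^ 2) := by
        refine mul_le_mul_of_nonneg_right ?_ (by positivity)
        nlinarith [pow_pos hκ 2, pow_pos hκ 3]
      _ = _ := by field_simp
  · intro hεt
    change 3 / (F * S.a₀) ≤ _
    have h2 : (ε * t) ^ 2 ≤ 1 := pow_le_one₀ (by positivity) hεt
    have h3 : (9 : ℝ) ≤ 10 ^ 7 * (1 + κ) ^ 3 := by nlinarith [pow_pos hκ 2, pow_pos hκ 3]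
    calc 3 / (F * S.a₀) ≤ 3 / (F * S.a₀) * (3 * F) := le_mul_of_one_le_right (by positivity) hF1
      _ = 9 / S.a₀ := by field_simp; norm_num
      _ ≤ 10 ^ 7 * (1 + κ) ^ 3 / (S.a₀ * (ε * t) ^ 2) := by
        gcongr
        exact mul_le_of_le_one_right ha.le h2
      _ = _ := by field_simp
  · field_simp

theorem one_le_of_depthOK (h : S.Setting Δ guess γ ε) {C : ℝ} (hC : 0 < C) {t : ℕ}
    (ht : DepthOK C Δ γ S.a₀ ε t) : 1 ≤ t := by
  have h1 := h.le_mul_depth ht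
  have h2 := h.half_le_log
  have h3 := h.Δ_pos
  have h4 := h.γ_nonneg
  have h5 : 0 < C * (γ * Δ⁻¹ + Real.log (S.a₀⁻¹ * ε⁻¹)) := by
    have : 0 ≤ γ * Δ⁻¹ := by positivity
    apply mul_pos hC; linarith
  by_contra hcon
  have : t = 0 := by omega
  rw [this, Nat.cast_zero, mul_zero] at h1
  linarith

end PhaseProblem.Setting

theorem callCost_eq (γ a ε : ℝ) (t : ℕ) :
    callCost γ a ε t = (ε ^ 2)⁻¹ * (a ^ 2)⁻¹ * (Real.exp (2 * γ * t) / t) := by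
  rw [callCost]; ring

theorem two_mul_sq_mul_le {γ : ℝ} (hγ : 0 < γ) {t : ℕ} (ht : 1 ≤ t) :
    2 * γ ^ 2 * t ≤ Real.exp (2 * γ * t) / t := by
  have htR : (1 : ℝ) ≤ t := by exact_mod_cast ht
  have h1 := Real.quadratic_le_exp_of_nonneg (show 0 ≤ 2 * γ * t by positivity)
  rw [le_div_iff₀ (by linarith)]
  have : 0 ≤ 2 * γ * t := by positivity
  nlinarith

theorem exists_isOptimalDepth {C Δ γ a ε : ℝ} (hγ : 0 < γ) (ha : 0 < a) (hε : 0 < ε)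
    (hpos : ∀ t, DepthOK C Δ γ a ε t → 1 ≤ t) (hne : ∃ t, DepthOK C Δ γ a ε t) :
    ∃ t, IsOptimalDepth C Δ γ a ε t := by
  classical
  obtain ⟨s, hs⟩ := hne
  set g : ℕ → ℝ := fun t => Real.exp (2 * γ * t) / t with hg
  obtain ⟨N, hN⟩ := exists_nat_ge (g s / (2 * γ ^ 2))
  obtain ⟨t, ht, hmin⟩ := ((Finset.range (max s N + 1)).filter
    (DepthOK C Δ γ a ε)).exists_min_image g ⟨s, by simp [hs]⟩
  rw [Finset.mem_filter] at ht
  refine ⟨t, ht.2, fun r hr => ?_⟩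
  rw [callCost_eq, callCost_eq]
  refine mul_le_mul_of_nonneg_left ?_ (by positivity)
  by_cases hrN : r ≤ max s N
  · exact hmin r (by simp only [Finset.mem_filter, Finset.mem_range]; exact ⟨by omega, hr⟩)
  · have h1 : g t ≤ g s := hmin s (by simp [hs])
    have h2 := two_mul_sq_mul_le hγ (hpos r hr)
    have h3 : (N : ℝ) ≤ r := by exact_mod_cast (by omega : N ≤ r)
    rw [div_le_iff₀ (by positivity)] at hN
    have h4 : (N : ℝ) * (2 * γ ^ 2) ≤ r * (2 * γ ^ 2) := by gcongr
    exact h1.trans (by linarith)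

/-- The size of a minimiser of `exp(2γt) / t` over the depths above a threshold of order at most
`1 / γ`, and of the minimal value. -/
theorem optimalDepth_bounds {C Δ γ a ε : ℝ} (hγ : 0 < γ) (ha : 0 < a) (hε : 0 < ε)
    (hpos : ∀ t, DepthOK C Δ γ a ε t → 1 ≤ t) {s : ℕ} (hs : DepthOK C Δ γ a ε s)
    (hγs : γ * s ≤ 1) {t : ℕ} (ht : IsOptimalDepth C Δ γ a ε t) :
    1 ≤ 162 * γ * t ∧ γ * t ≤ 81 ∧ γ ≤ Real.exp (2 * γ * t) / t ∧
      Real.exp (2 * γ * t) / t ≤ 162 * γ := by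
  have ht1 := hpos t ht.1
  have htR : (1 : ℝ) ≤ t := by exact_mod_cast ht1
  have ht0 : (0 : ℝ) < t := by linarith
  have hsR : (1 : ℝ) ≤ s := by exact_mod_cast hpos s hs
  have hγ1 : γ ≤ 1 := le_trans (le_mul_of_one_le_right hγ.le hsR) hγs
  set s' := max s ⌈1 / (2 * γ)⌉₊ with hs'
  have hs'OK : DepthOK C Δ γ a ε s' :=
    le_trans hs (by exact_mod_cast le_max_left s ⌈1 / (2 * γ)⌉₊)
  have hlow : 1 / (2 * γ) ≤ s' :=
    (Nat.le_ceil _).trans (by exact_mod_cast le_max_right s ⌈1 / (2 * γ)⌉₊)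
  have hs'0 : (0 : ℝ) < s' := lt_of_lt_of_le (by positivity) hlow
  have hup : γ * s' ≤ 2 := by
    have h1 : ((⌈1 / (2 * γ)⌉₊ : ℕ) : ℝ) < 1 / (2 * γ) + 1 :=
      Nat.ceil_lt_add_one (by positivity)
    have h2 : γ * (1 / (2 * γ) + 1) = 1 / 2 + γ := by field_simp
    have h3 : γ * (⌈1 / (2 * γ)⌉₊ : ℕ) ≤ 2 := by nlinarith
    rcases max_choice s ⌈1 / (2 * γ)⌉₊ with h4 | h4
    · rw [hs', h4]; linarith
    · rw [hs', h4]; exact h3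
  have hcost := ht.2 s' hs'OK
  rw [callCost_eq, callCost_eq] at hcost
  have hg := le_of_mul_le_mul_left hcost (by positivity)
  have hexp : Real.exp (2 * γ * s') ≤ 81 := by
    have h1 : Real.exp (2 * γ * s') ≤ Real.exp 4 := Real.exp_le_exp.2 (by linarith)
    have h2 : Real.exp 4 = Real.exp 1 ^ 4 := by rw [← Real.exp_nat_mul]; norm_num
    have h3 : Real.exp 1 ^ 4 ≤ 3 ^ 4 := by
      have := Real.exp_one_lt_three
      gcongr
    linarith
  have hgs : Real.exp (2 * γ * s') / s' ≤ 162 * γ := by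
    rw [div_le_iff₀ hs'0]
    rw [div_le_iff₀ (by positivity)] at hlow
    nlinarith
  have hgt := hg.trans hgs
  have hge := two_mul_sq_mul_le hγ ht1
  refine ⟨?_, ?_, ?_, hgt⟩
  · have h1 : 1 ≤ Real.exp (2 * γ * t) := Real.one_le_exp (by positivity)
    rw [div_le_iff₀ ht0] at hgt
    linarith
  · have h1 : 2 * γ * (γ * t) ≤ 2 * γ * 81 := by nlinarith
    exact le_of_mul_le_mul_left h1 (by positivity)
  · rw [le_div_iff₀ ht0]
    have h1 := Real.add_one_le_exp (2 * γ * t)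
    nlinarith [mul_pos hγ ht0]

end

end QPE

theorem theorem5 (κ₁ κ₂ : ℝ) (hκ₁ : 0 < κ₁) (hκ : κ₁ ≤ κ₂) :
    ∃ C : ℝ, 0 < C ∧
      ∀ (S : QPE.PhaseProblem) (Δ guess γ ε : ℝ),
        0 < Δ → Δ ≤ π →
        (∀ j, j ≠ S.target → Δ < |S.phase j - S.φ₀|) →
        |S.φ₀ - guess| < Δ / 3 →
        Set.Icc (guess - Δ / 2) (guess + Δ / 2) ⊆ Set.Ico (Δ / 6) (2 * π - Δ / 6) →
        0 < S.a₀ → 0 ≤ γ → 0 < ε → ε ≤ 1 / 2 →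
        -- cost at every admissible depth `t`, for a kernel width of order `1 / t`
        (∀ (t : ℕ) (σ : ℝ), QPE.DepthOK C Δ γ S.a₀ ε t → κ₁ ≤ σ * t → σ * t ≤ κ₂ →
          (S.experiment guess Δ γ t σ).AttainsRMSE t ε
            (C * ((S.a₀ ^ 2)⁻¹ * ((t : ℝ) ^ 2)⁻¹ * (ε ^ 2)⁻¹ * Real.exp (2 * γ * t)))
            (C * ((ε ^ 2)⁻¹ * (t : ℝ)⁻¹ * Real.exp (2 * γ * t) * (S.a₀ ^ 2)⁻¹)) ∧
          (γ * t ≤ 1 → 1 ≤ S.a₀ * t →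
            (S.experiment guess Δ γ t σ).AttainsRMSE t ε
              (C * (S.a₀⁻¹ * ((t : ℝ) ^ 2)⁻¹ * (ε ^ 2)⁻¹))
              (C * (S.a₀⁻¹ * (t : ℝ)⁻¹ * (ε ^ 2)⁻¹)))) ∧
        -- optimisation of the cost over the depth `t`
        (0 < γ → (∃ t : ℕ, QPE.DepthOK C Δ γ S.a₀ ε t ∧ γ * t ≤ 1) →
          (∃ t, QPE.IsOptimalDepth C Δ γ S.a₀ ε t) ∧
          ∀ t, QPE.IsOptimalDepth C Δ γ S.a₀ ε t →
            C⁻¹ * γ⁻¹ ≤ t ∧ t ≤ C * γ⁻¹ ∧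
            C⁻¹ * (γ * (ε ^ 2)⁻¹ * (S.a₀ ^ 2)⁻¹) ≤ QPE.callCost γ S.a₀ ε t ∧
            QPE.callCost γ S.a₀ ε t ≤ C * (γ * (ε ^ 2)⁻¹ * (S.a₀ ^ 2)⁻¹) ∧
            ∀ σ : ℝ, κ₁ ≤ σ * t → σ * t ≤ κ₂ →
              (S.experiment guess Δ γ t σ).AttainsRMSE t ε
                (C * (γ ^ 2 * (ε ^ 2)⁻¹ * (S.a₀ ^ 2)⁻¹))
                (C * (γ * (ε ^ 2)⁻¹ * (S.a₀ ^ 2)⁻¹))) := by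
  have hκ₂ : 0 < κ₂ := hκ₁.trans_le hκ
  obtain ⟨C₁, hC₁, hreg⟩ := QPE.PhaseProblem.Setting.exists_depth_constant hκ₂
  set C₀ : ℝ := 10 ^ 7 * (1 + κ₂) ^ 3 with hC₀
  have hC₀1 : 1 ≤ C₀ := by
    have := one_le_pow₀ (n := 3) (show (1 : ℝ) ≤ 1 + κ₂ by linarith)
    rw [hC₀]; linarith
  set C : ℝ := max C₁ (26244 * C₀) with hC
  have hCC₁ : C₁ ≤ C := le_max_left _ _
  have hCC₀' : 26244 * C₀ ≤ C := le_max_right _ _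
  have hCC₀ : C₀ ≤ C := by linarith
  have hC0 : 0 < C := by linarith
  clear_value C C₀
  refine ⟨C, hC0, ?_⟩
  intro S Δ guess γ ε h1 h2 h3 h4 h5 h6 h7 h8 h9
  have h : S.Setting Δ guess γ ε := ⟨h1, h2, h3, h4, h5, h6, h7, h8, h9⟩
  have hpos : ∀ t, QPE.DepthOK C Δ γ S.a₀ ε t → 1 ≤ t := fun t ht => h.one_le_of_depthOK hC0 ht
  have hσpos : ∀ (t : ℕ) (σ : ℝ), κ₁ ≤ σ * t → 0 < σ := fun t σ hle =>
    pos_of_mul_pos_left (hκ₁.trans_le hle) (Nat.cast_nonneg t)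
  refine ⟨fun t σ ht hσ₁ hσ₂ => ?_, fun hγ ⟨s, hs, hγs⟩ => ⟨?_, fun t ht => ?_⟩⟩
  · have hσ := hσpos t σ hσ₁
    have ht1 := hpos t ht
    have hr := hreg h hCC₁ ht1 hσ hσ₂ ht
    refine ⟨h.attainsRMSE ht1 hσ hσ₂ hr ?_ ?_, fun hγt hat =>
      h.attainsRMSE_of_le_one ht1 hσ hσ₂ hr hγt hat ?_ ?_⟩ <;> rw [← hC₀] <;> gcongr
  · exact QPE.exists_isOptimalDepth hγ h6 h8 hpos ⟨s, hs⟩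
  · obtain ⟨b1, b2, b3, b4⟩ := QPE.optimalDepth_bounds hγ h6 h8 hpos hs hγs ht
    have ht1 := hpos t ht.1
    have htR : (1 : ℝ) ≤ t := by exact_mod_cast ht1
    have ht0 : (0 : ℝ) < t := by linarith
    have hC162 : 162 ≤ C := by linarith
    have hTle : C₀ * (Real.exp (2 * γ * t) / t) ≤ C * γ := by
      calc C₀ * (Real.exp (2 * γ * t) / t) ≤ C₀ * (162 * γ) := by gcongr
        _ ≤ C * γ := by nlinarith
    have htinv : (t : ℝ)⁻¹ ≤ 162 * γ := by
      rw [inv_le_iff_one_le_mul₀ ht0]; exact b1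
    refine ⟨?_, ?_, ?_, ?_, fun σ hσ₁ hσ₂ => ?_⟩
    · rw [← mul_inv, inv_le_iff_one_le_mul₀ (by positivity)]
      nlinarith [mul_pos hγ ht0]
    · rw [← div_eq_mul_inv, le_div_iff₀ hγ]; linarith
    · rw [QPE.callCost_eq]
      have hC1 : C⁻¹ ≤ 1 := inv_le_one_of_one_le₀ (by linarith)
      calc C⁻¹ * (γ * (ε ^ 2)⁻¹ * (S.a₀ ^ 2)⁻¹) ≤ 1 * (γ * (ε ^ 2)⁻¹ * (S.a₀ ^ 2)⁻¹) := by
            gcongr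
        _ = (ε ^ 2)⁻¹ * (S.a₀ ^ 2)⁻¹ * γ := by ring
        _ ≤ _ := by gcongr
    · rw [QPE.callCost_eq]
      calc (ε ^ 2)⁻¹ * (S.a₀ ^ 2)⁻¹ * (Real.exp (2 * γ * t) / t)
          ≤ (ε ^ 2)⁻¹ * (S.a₀ ^ 2)⁻¹ * (C * γ) := by
            refine mul_le_mul_of_nonneg_left (b4.trans ?_) (by positivity)
            gcongr
        _ = _ := by ring
    · have hσ := hσpos t σ hσ₁
      have hr := hreg h hCC₁ ht1 hσ hσ₂ ht.1
      refine h.attainsRMSE ht1 hσ hσ₂ hr ?_ ?_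
      · rw [← hC₀]
        calc C₀ * ((S.a₀ ^ 2)⁻¹ * ((t : ℝ) ^ 2)⁻¹ * (ε ^ 2)⁻¹ * Real.exp (2 * γ * t))
            = (ε ^ 2)⁻¹ * (S.a₀ ^ 2)⁻¹ * (C₀ * ((Real.exp (2 * γ * t) / t) * (t : ℝ)⁻¹)) := by
              field_simp
          _ ≤ (ε ^ 2)⁻¹ * (S.a₀ ^ 2)⁻¹ * (C₀ * ((162 * γ) * (162 * γ))) := by gcongr
          _ = 26244 * C₀ * (γ ^ 2 * (ε ^ 2)⁻¹ * (S.a₀ ^ 2)⁻¹) := by ring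
          _ ≤ _ := by gcongr
      · rw [← hC₀]
        calc C₀ * ((ε ^ 2)⁻¹ * (t : ℝ)⁻¹ * Real.exp (2 * γ * t) * (S.a₀ ^ 2)⁻¹)
            = (ε ^ 2)⁻¹ * (S.a₀ ^ 2)⁻¹ * (C₀ * (Real.exp (2 * γ * t) / t)) := by ring
          _ ≤ (ε ^ 2)⁻¹ * (S.a₀ ^ 2)⁻¹ * (C * γ) := by gcongr
          _ = _ := by ring
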